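/- **Setting.** Let $r$ be fixed and consider the factor model $Y_t=\Lambda f_t+u_t$, $t=1,\dots,T$, with $Y_t,u_t\in\mathbb R^N$, $f_t\in\mathbb R^r$ and a deterministic $N\times r$ loading matrix $\Lambda=(\lambda_1,\dots,\lambda_N)'$. Asymptotics are along any sequence $(N,T)$ with $N\to\infty$ and $T\to\infty$; $\Lambda$ and the process $u_t$ may change along the sequence, and all constants and the $O,o,o_p$ are along it. Let $\Sigma_u=\mathrm{cov}(u_t)$, $W=\Sigma_u^{-1}$, $\Lambda'W=(\xi_1,\dots,\xi_N)$, $e_t=Wu_t$, and let $\|\cdot\|$ be the Euclidean, resp. operator norm. Put $\omega_T=\sqrt{\log N/T}+1/\sqrt N$ and $m_N=\max_{i\le N}\sum_{j\le N}|\Sigma_{u,ij}|^q$ (with $|x|^0=1_{\{x\neq0\}}$). **Assumptions.** (A1) $\{(u_t,f_t)\}_{t\in\mathbb Z}$ is strictly stationary; $Eu_{it}=Eu_{it}f_{jt}=0$. There are constants $c_1,c_2>0$ such that all eigenvalues of $\Sigma_u$ and of $\mathrm{cov}(f_t)$ lie in $(c_2,c_1)$ and $\max_j\|\lambda_j\|<c_1$.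 There are $r_1,r_2,b_1,b_2>0$ with $P(|u_{it}|>s)\le e^{-(s/b_1)^{r_1}}$ and $P(|f_{jt}|>s)\le e^{-(s/b_2)^{r_2}}$ for all $s>0$, $i,j,t$. The strong mixing coefficients $\alpha(k)=\sup\{|P(A)P(B)-P(A\cap B)|: A\in\sigma((u_t,f_t):t\le0),\ B\in\sigma((u_t,f_t):t\ge k)\}$ satisfy $\alpha(k)\le e^{-Ck^{r_3}}$ for all integers $k\ge1$, for some $r_3,C>0$. (A2) The eigenvalues of $\Lambda'\Lambda/N$ are bounded away from $0$ and $\infty$ as $N\to\infty$; the absolute row sums of $W$ are bounded. (A3) For each $t$, $E\|\frac1{\sqrt{NT}}\sum_{s=1}^Tf_s(u_s'Wu_t-Eu_s'Wu_t)\|^2=O(1)$; for each $i$, $E\|\frac1{\sqrt{NT}}\sum_{t=1}^T\sum_{j=1}^N\xi_j(u_{jt}u_{it}-Eu_{jt}u_{it})\|=O(1)$; for each $i\le r$, $E\|\frac1{\sqrt{NT}}\sum_{t=1}^T\sum_{j=1}^N\xi_ju_{jt}f_{it}\|=O(1)$; for some $\delta\ge4$ and $M>0$, eventually $E|\frac1{\sqrt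 N}(u_s'Wu_t-Eu_s'Wu_t)|^\delta<M$ and $E\|\frac1{\sqrt N}\Lambda'Wu_t\|^\delta<M$ for all $s,t\le T$. (A4) $\Lambda'W\Lambda/N\to\Sigma_\Lambda$ for some $r\times r$ matrix $\Sigma_\Lambda$, and $\Sigma_\Lambda\mathrm{cov}(f_t)$ has $r$ distinct eigenvalues; for each $t$, $(\Lambda'W\Sigma_uW\Lambda)^{-1/2}\Lambda'Wu_t\to^d\mathcal N(0,I_r)$. (A5) (Conditional sparsity.) $q\in[0,1/2)$ and $m_N=o\big(\min\{N^{-1/4}(T/\log N)^{(1-q)/2},\,N^{1/4-q/2}\}\big)$. There is a partition $\{1,\dots,N\}^2=S_L\cup S_U$ with $(i,i)\in S_U$ for all $i$, $\#\{(i,j)\in S_U:i\ne j\}=O(N)$, $\sum_{S_L}|\Sigma_{u,ij}|=O(1)$, $\max_{S_L}|\Sigma_{u,ij}|=O(\omega_T)$ and $\omega_T=o(\min_{S_U}|\Sigma_{u,ij}|)$. (A6) For this partition, for each fixed $t\ge1$ and each $k\le r$, the following are $o_p(1)$: (i) $\frac1{T\sqrt N}\sum_{i}\sum_{s}(u_{is}^2-Eu_{is}^2)\xi_ie_{it}$;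 (ii) $\frac1{NT\sqrt N}\sum_{i}\sum_{s}\sum_{j}(u_{js}u_{is}-Eu_{js}u_{is})\lambda_j\lambda_i'e_{it}\xi_{ik}$; (iii) $\frac1{T\sqrt N}\sum_{i\ne j,(i,j)\in S_U}\sum_{s}(u_{is}u_{js}-Eu_{is}u_{js})\xi_ie_{jt}$; (iv) $\frac1{NT\sqrt N}\sum_{i\ne j,(i,j)\in S_U}\sum_{v}\sum_{s}(u_{is}u_{vs}-Eu_{is}u_{vs})\xi_{ik}e_{jt}\lambda_v\lambda_j'$. (A7) $\sqrt N\,m_N^2\,\omega_T^{2-2q}=o(1)$. **Estimator.** Let $S_y=\frac1T\sum_{t=1}^TY_tY_t'$, with orthonormal eigenvectors $\zeta_j$ and eigenvalues $\nu_1\ge\dots\ge\nu_N$, and $R=S_y-\sum_{j\le r}\nu_j\zeta_j\zeta_j'$. For $C>0$ let $\tau_{ij}=C\sqrt{R_{ii}R_{jj}}\,\omega_T$, and let $s_{ij}:\mathbb R\to\mathbb R$ satisfy $s_{ij}(z)=0$ if $|z|<\tau_{ij}$, $|s_{ij}(z)-z|\le\tau_{ij}$, and $|s_{ij}(z)-z|\le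 a\tau_{ij}^2$ if $|z|>b\tau_{ij}$, where $a>0$, $b>1$ are constants. Put $\widehat\Sigma_{u,ii}=R_{ii}$ and $\widehat\Sigma_{u,ij}=s_{ij}(R_{ij})$ for $i\ne j$. **Proposition.** Under (A1)–(A7) there is $C_0>0$ such that for every $C\ge C_0$ and every such estimator $\widehat\Sigma_u$: 1. for each fixed $t\ge1$, $\ \big\|\frac1{\sqrt N}\Lambda'(\widehat\Sigma_u^{-1}-\Sigma_u^{-1})u_t\big\|=o_p(1)$; 2. $\|\widehat\Sigma_u^{-1}-\Sigma_u^{-1}\|=o_p\big(\min\{N^{-1/4},\sqrt{T/(N\log N)}\}\big)$; 3. if $T=O(N)$ (in particular if $N/T\to\infty$), or more generally if $m_N\omega_T^{1-q}=o(\min\{T^{-1/4},\sqrt{N/T}\})$, then $W_T=\widehat\Sigma_u^{-1}$ satisfies, with $W=\Sigma_u^{-1}$, both conditions required of a feasible weight matrix: $\|W_T-W\|=o_p\big(\min\{T^{-1/4},N^{-1/4},\sqrt{N/T},\sqrt{T/(N\log N)}\}\big)$, and $\|\frac1{\sqrt N}\Lambda'(W_T-W)u_t\|=o_p(1)$ for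 each $t$. -/

import Mathlib

open MeasureTheory ProbabilityTheory Filter Topology Matrix
open scoped MatrixOrder

noncomputable section

/-- Euclidean norm of a vector. -/
def euclNorm {k : ℕ} (v : Fin k → ℝ) : ℝ := ‖WithLp.toLp 2 v‖

/-- Operator norm of a square matrix (for the Euclidean norm). -/
def opNorm {k : ℕ} (A : Matrix (Fin k) (Fin k) ℝ) : ℝ := ‖Matrix.toEuclideanCLM (𝕜 := ℝ) A‖

/-- `X n = o_p(a n)`. Outer measure is used, so that `X n` need not be measurable. -/
def IsLittleOP {Ω : Type*} [MeasurableSpace Ω] (μ : Measure Ω) (X : ℕ → Ω → ℝ) (a : ℕ → ℝ) : Prop :=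
  ∀ ε : ℝ, 0 < ε → Tendsto (fun n => μ {ω | ε * a n < |X n ω|}) atTop (𝓝 0)

/-- `x n = O(1)` for a nonnegative sequence. -/
def IsBoundedSeq (x : ℕ → ℝ) : Prop := ∃ M : ℝ, ∀ᶠ n in atTop, x n ≤ M

/-- Strict stationarity of a process indexed by `ℤ`: all time shifts have the same law. -/
def IsStrictlyStationary {Ω E : Type*} [MeasurableSpace Ω] [MeasurableSpace E] (μ : Measure Ω)
    (X : ℤ → Ω → E) : Prop :=
  ∀ h : ℤ, μ.map (fun ω t => X (t + h) ω) = μ.map (fun ω t => X t ω)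

/-- The σ-algebra generated by `X t`, `t ∈ I`. -/
abbrev sigmaGen {Ω E : Type*} [MeasurableSpace E] (X : ℤ → Ω → E) (I : Set ℤ) : MeasurableSpace Ω :=
  ⨆ t ∈ I, MeasurableSpace.comap (X t) inferInstance

/-- Strong mixing coefficient between the past `t ≤ 0` and the future `t ≥ k`. -/
def alphaMixing {Ω E : Type*} [MeasurableSpace Ω] [MeasurableSpace E] (μ : Measure Ω)
    (X : ℤ → Ω → E) (k : ℕ) : ℝ :=
  sSup {x | ∃ A B : Set Ω, MeasurableSet[sigmaGen X (Set.Iic 0)] A ∧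
    MeasurableSet[sigmaGen X (Set.Ici (k : ℤ))] B ∧
    x = |μ.real A * μ.real B - μ.real (A ∩ B)|}

/-- `A^{-1/2}` for a positive definite matrix `A`. -/
def invSqrt {k : ℕ} (A : Matrix (Fin k) (Fin k) ℝ) : Matrix (Fin k) (Fin k) ℝ := CFC.sqrt A⁻¹

/-- The data of an approximate factor model `Y_t = Λ f_t + u_t` with `r` factors along an arbitrary
sequence of panel sizes `(N n, T n)`. The loadings and the idiosyncratic errors may change with `n`.
The observation times are `t = 1, …, T n`. -/
structure FactorModel (Ω : Type*) where
  /-- number of factors -/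
  r : ℕ
  /-- cross-sectional dimension -/
  N : ℕ → ℕ
  /-- sample size -/
  T : ℕ → ℕ
  /-- loadings; row `i` is `λ_i'` -/
  Lam : (n : ℕ) → Matrix (Fin (N n)) (Fin r) ℝ
  /-- factors -/
  f : ℤ → Ω → Fin r → ℝ
  /-- idiosyncratic errors -/
  u : (n : ℕ) → ℤ → Ω → Fin (N n) → ℝ

namespace FactorModel

variable {Ω : Type*} [MeasurableSpace Ω]

/-- The observations `Y_t = Λ f_t + u_t`. -/
def Y (D : FactorModel Ω) (n : ℕ) (t : ℤ) (ω : Ω) : Fin (D.N n) → ℝ :=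
  D.Lam n *ᵥ D.f t ω + D.u n t ω

/-- The observation times `1, …, T`. -/
def times (D : FactorModel Ω) (n : ℕ) : Finset ℤ := Finset.Icc 1 (D.T n : ℤ)

/-- `Σ_u = cov(u_t)` (it does not depend on `t` under stationarity). -/
def Sigu (D : FactorModel Ω) (μ : Measure Ω) (n : ℕ) : Matrix (Fin (D.N n)) (Fin (D.N n)) ℝ :=
  Matrix.of fun i j => cov[fun ω => D.u n 1 ω i, fun ω => D.u n 1 ω j; μ]

/-- `cov(f_t)`. -/
def covf (D : FactorModel Ω) (μ : Measure Ω) : Matrix (Fin D.r) (Fin D.r) ℝ :=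
  Matrix.of fun i j => cov[fun ω => D.f 1 ω i, fun ω => D.f 1 ω j; μ]

/-- `ω_T = √(log N / T) + 1 / √N`. -/
def omegaT (D : FactorModel Ω) (n : ℕ) : ℝ :=
  √(Real.log (D.N n) / D.T n) + 1 / √(D.N n : ℝ)

/-- `m_N = max_i ∑_j |Σ_{u,ij}|^q`, with `|x|^0` read as the indicator of `x ≠ 0`. -/
def mN (D : FactorModel Ω) (μ : Measure Ω) (q : ℝ) (n : ℕ) : ℝ :=
  ⨆ i, ∑ j, if D.Sigu μ n i j = 0 then 0 else |D.Sigu μ n i j| ^ q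

/-- Stationarity, moment, tail and strong mixing conditions on `(u_t, f_t)`. -/
structure Dynamics (D : FactorModel Ω) (μ : Measure Ω) : Prop where
  tendsto_N : Tendsto D.N atTop atTop
  tendsto_T : Tendsto D.T atTop atTop
  measurable_f : ∀ t, Measurable (D.f t)
  measurable_u : ∀ n t, Measurable (D.u n t)
  stationary : ∀ n, IsStrictlyStationary μ (fun t ω => (D.u n t ω, D.f t ω))
  mean_u : ∀ n t i, ∫ ω, D.u n t ω i ∂μ = 0
  mean_uf : ∀ n t i j, ∫ ω, D.u n t ω i * D.f t ω j ∂μ = 0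
  bounds : ∃ c₁ c₂ : ℝ, 0 < c₁ ∧ 0 < c₂ ∧
    (∀ n, spectrum ℝ (D.Sigu μ n) ⊆ Set.Ioo c₂ c₁) ∧
    (∀ n j, euclNorm (D.Lam n j) < c₁) ∧
    spectrum ℝ (D.covf μ) ⊆ Set.Ioo c₂ c₁
  tails : ∃ r₁ r₂ b₁ b₂ : ℝ, 0 < r₁ ∧ 0 < r₂ ∧ 0 < b₁ ∧ 0 < b₂ ∧ ∀ s : ℝ, 0 < s →
    (∀ n t i, μ.real {ω | s < |D.u n t ω i|} ≤ Real.exp (-(s / b₁) ^ r₁)) ∧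
    (∀ t j, μ.real {ω | s < |D.f t ω j|} ≤ Real.exp (-(s / b₂) ^ r₂))
  mixing : ∃ r₃ C : ℝ, 0 < r₃ ∧ 0 < C ∧ ∀ n, ∀ k : ℕ, 0 < k →
    alphaMixing μ (fun t ω => (D.u n t ω, D.f t ω)) k ≤ Real.exp (-C * (k : ℝ) ^ r₃)

/-- Pervasive factors: the eigenvalues of `Λ'Λ/N` stay away from `0` and `∞` as `N → ∞`. -/
def Pervasive (D : FactorModel Ω) : Prop :=
  ∃ c C : ℝ, 0 < c ∧ ∀ᶠ n in atTop,
    spectrum ℝ ((D.N n : ℝ)⁻¹ • ((D.Lam n)ᵀ * D.Lam n)) ⊆ Set.Icc c C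

/-- Bounded row sums of the weight matrices, `‖W‖₁ < M`. -/
def BoundedRowSums (D : FactorModel Ω) (W : (n : ℕ) → Matrix (Fin (D.N n)) (Fin (D.N n)) ℝ) :
    Prop :=
  ∃ M : ℝ, ∀ n i, ∑ j, |W n i j| < M

/-- The centred bilinear form `u_s' W u_t - E u_s' W u_t`. -/
def uWu (D : FactorModel Ω) (μ : Measure Ω)
    (W : (n : ℕ) → Matrix (Fin (D.N n)) (Fin (D.N n)) ℝ) (n : ℕ) (s t : ℤ) (ω : Ω) : ℝ :=
  D.u n s ω ⬝ᵥ (W n *ᵥ D.u n t ω) - ∫ ω', D.u n s ω' ⬝ᵥ (W n *ᵥ D.u n t ω') ∂μ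

/-- The centred product `u_{is} u_{js} - E u_{is} u_{js}`. -/
def uu (D : FactorModel Ω) (μ : Measure Ω) (n : ℕ) (s : ℤ) (i j : Fin (D.N n)) (ω : Ω) : ℝ :=
  D.u n s ω i * D.u n s ω j - ∫ ω', D.u n s ω' i * D.u n s ω' j ∂μ

/-- Moment conditions for the weight matrix `W`; `d_j` is the `j`-th column of `Λ'W`. -/
structure WeightMoments (D : FactorModel Ω) (μ : Measure Ω)
    (W : (n : ℕ) → Matrix (Fin (D.N n)) (Fin (D.N n)) ℝ) : Prop where
  factor_quad : ∀ t : ℤ, 1 ≤ t → IsBoundedSeq fun n =>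
    ∫ ω, euclNorm ((√((D.N n : ℝ) * D.T n))⁻¹ •
      ∑ s ∈ D.times n, D.uWu μ W n s t ω • D.f s ω) ^ 2 ∂μ
  cross_uu : ∀ i : ℕ, ∃ M : ℝ, ∀ᶠ n in atTop, ∀ hi : i < D.N n,
    ∫ ω, euclNorm ((√((D.N n : ℝ) * D.T n))⁻¹ •
      ∑ t ∈ D.times n, ∑ j, D.uu μ n t j ⟨i, hi⟩ ω • ((D.Lam n)ᵀ * W n).col j) ∂μ ≤ M
  cross_uf : ∀ i : Fin D.r, IsBoundedSeq fun n =>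
    ∫ ω, euclNorm ((√((D.N n : ℝ) * D.T n))⁻¹ •
      ∑ t ∈ D.times n, ∑ j, (D.u n t ω j * D.f t ω i) • ((D.Lam n)ᵀ * W n).col j) ∂μ
  higher : ∃ δ : ℝ, 4 ≤ δ ∧ ∃ M : ℝ, ∀ᶠ n in atTop,
    (∀ s ∈ D.times n, ∀ t ∈ D.times n,
      ∫ ω, |(√(D.N n : ℝ))⁻¹ * D.uWu μ W n s t ω| ^ δ ∂μ < M) ∧
    (∀ t ∈ D.times n,
      ∫ ω, euclNorm ((√(D.N n : ℝ))⁻¹ • ((D.Lam n)ᵀ *ᵥ (W n *ᵥ D.u n t ω))) ^ δ ∂μ < M)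

/-- `Λ'WΛ/N` converges, the limit times `cov(f_t)` has distinct eigenvalues, and a cross-sectional
central limit theorem holds. -/
structure WeightLimits (D : FactorModel Ω) (μ : Measure Ω) [IsProbabilityMeasure μ]
    (W : (n : ℕ) → Matrix (Fin (D.N n)) (Fin (D.N n)) ℝ) : Prop where
  limit : ∃ SL : Matrix (Fin D.r) (Fin D.r) ℝ,
    Tendsto (fun n => (D.N n : ℝ)⁻¹ • ((D.Lam n)ᵀ * W n * D.Lam n)) atTop (𝓝 SL) ∧
    ∃ e : Fin D.r → ℝ, Function.Injective e ∧
      ∀ k, Module.End.HasEigenvalue (Matrix.toLin' (SL * D.covf μ)) (e k)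
  clt : ∀ t : ℤ, 1 ≤ t → TendstoInDistribution
    (fun n ω => WithLp.toLp 2
      (invSqrt ((D.Lam n)ᵀ * W n * D.Sigu μ n * W n * D.Lam n) *ᵥ
        ((D.Lam n)ᵀ *ᵥ (W n *ᵥ D.u n t ω))))
    atTop (id : EuclideanSpace ℝ (Fin D.r) → EuclideanSpace ℝ (Fin D.r)) (fun _ => μ)
    (stdGaussian (EuclideanSpace ℝ (Fin D.r)))

/-- Conditional sparsity. `SU n` is the set of index pairs of the large entries of `Σ_u`, and its
complement is the set `S_L` of index pairs of the small entries. -/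
structure ConditionalSparsity (D : FactorModel Ω) (μ : Measure Ω) (q : ℝ)
    (SU : (n : ℕ) → Finset (Fin (D.N n) × Fin (D.N n))) : Prop where
  q_nonneg : 0 ≤ q
  q_lt : q < 1 / 2
  rate : (D.mN μ q) =o[atTop] fun n =>
    min (1 / (D.N n : ℝ) ^ (1 / 4 : ℝ) * ((D.T n : ℝ) / Real.log (D.N n)) ^ ((1 - q) / 2))
      ((D.N n : ℝ) ^ (1 / 4 - q / 2))
  diag_mem : ∀ n i, (i, i) ∈ SU n
  card_offDiag : IsBoundedSeq fun n =>
    (((SU n).filter fun p => p.1 ≠ p.2).card : ℝ) / D.N n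
  sum_small : IsBoundedSeq fun n => ∑ p ∈ (SU n)ᶜ, |D.Sigu μ n p.1 p.2|
  max_small : ∃ K : ℝ, ∀ᶠ n in atTop, ∀ p ∈ (SU n)ᶜ, |D.Sigu μ n p.1 p.2| ≤ K * D.omegaT n
  min_large : ∀ ε : ℝ, 0 < ε → ∀ᶠ n in atTop, ∀ p ∈ SU n,
    D.omegaT n ≤ ε * |D.Sigu μ n p.1 p.2|

/-- `ξ_{ik}`, the `k`-th coordinate of the `i`-th column of `Λ'Σ_u⁻¹`. -/
def xi (D : FactorModel Ω) (μ : Measure Ω) (n : ℕ) (i : Fin (D.N n)) (k : Fin D.r) : ℝ :=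
  ((D.Lam n)ᵀ * (D.Sigu μ n)⁻¹) k i

/-- `e_t = Σ_u⁻¹ u_t`. -/
def e (D : FactorModel Ω) (μ : Measure Ω) (n : ℕ) (t : ℤ) (ω : Ω) : Fin (D.N n) → ℝ :=
  (D.Sigu μ n)⁻¹ *ᵥ D.u n t ω

/-- The conditions on weighted averages of `u_{is}u_{js} - E u_{is}u_{js}`. Vector and matrix valued
statements are written coordinatewise. -/
structure WeightedAverages (D : FactorModel Ω) (μ : Measure Ω)
    (SU : (n : ℕ) → Finset (Fin (D.N n) × Fin (D.N n))) : Prop where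
  diag : ∀ t : ℤ, 1 ≤ t → ∀ k : Fin D.r, IsLittleOP μ (fun n ω =>
    1 / (D.T n * √(D.N n : ℝ)) *
      ∑ i, ∑ s ∈ D.times n, D.uu μ n s i i ω * D.xi μ n i k * D.e μ n t ω i) (fun _ => 1)
  diag_loading : ∀ t : ℤ, 1 ≤ t → ∀ k a b : Fin D.r, IsLittleOP μ (fun n ω =>
    1 / (D.N n * D.T n * √(D.N n : ℝ)) *
      ∑ i, ∑ s ∈ D.times n, ∑ j, D.uu μ n s j i ω * (D.Lam n j a * D.Lam n i b) *
        D.e μ n t ω i * D.xi μ n i k) (fun _ => 1)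
  offDiag : ∀ t : ℤ, 1 ≤ t → ∀ k : Fin D.r, IsLittleOP μ (fun n ω =>
    1 / (D.T n * √(D.N n : ℝ)) *
      ∑ p ∈ (SU n).filter fun p => p.1 ≠ p.2, ∑ s ∈ D.times n,
        D.uu μ n s p.1 p.2 ω * D.xi μ n p.1 k * D.e μ n t ω p.2) (fun _ => 1)
  offDiag_loading : ∀ t : ℤ, 1 ≤ t → ∀ k a b : Fin D.r, IsLittleOP μ (fun n ω =>
    1 / (D.N n * D.T n * √(D.N n : ℝ)) *
      ∑ p ∈ (SU n).filter fun p => p.1 ≠ p.2, ∑ v, ∑ s ∈ D.times n,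
        D.uu μ n s p.1 v ω * D.xi μ n p.1 k * D.e μ n t ω p.2 *
          (D.Lam n v a * D.Lam n p.2 b)) (fun _ => 1)

/-- `S_y = T⁻¹ ∑_t Y_t Y_t'`. -/
def Sy (D : FactorModel Ω) (n : ℕ) (ω : Ω) : Matrix (Fin (D.N n)) (Fin (D.N n)) ℝ :=
  (D.T n : ℝ)⁻¹ • ∑ t ∈ D.times n, Matrix.vecMulVec (D.Y n t ω) (D.Y n t ω)

end FactorModel

/-- `R = S - ∑_{j < r} ν_j ξ_j ξ_j'`, for some orthonormal eigenbasis `ξ` of `S` with eigenvalues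
`ν` in decreasing order. -/
def IsPCResidual {k : ℕ} (r : ℕ) (S R : Matrix (Fin k) (Fin k) ℝ) : Prop :=
  ∃ (ν : Fin k → ℝ) (ξ : OrthonormalBasis (Fin k) ℝ (EuclideanSpace ℝ (Fin k))),
    Antitone ν ∧ (∀ j, S *ᵥ (ξ j).ofLp = ν j • (ξ j).ofLp) ∧
    R = S - ∑ j with Fin.val j < r, ν j • Matrix.vecMulVec (ξ j).ofLp (ξ j).ofLp

/-- A generalized thresholding function with threshold `τ` and constants `a`, `b`. -/
structure IsThresholding (a b τ : ℝ) (s : ℝ → ℝ) : Prop where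
  zero : ∀ z, |z| < τ → s z = 0
  near : ∀ z, |s z - z| ≤ τ
  sharp : ∀ z, b * τ < |z| → |s z - z| ≤ a * τ ^ 2

namespace FactorModel

variable {Ω : Type*} [MeasurableSpace Ω]

/-- `Sig` is a thresholded principal component estimator of `Σ_u`, with entry-dependent thresholds
`τ_ij = C √(R_ii R_jj) ω_T`. -/
def IsThresholdEstimator (D : FactorModel Ω) (C : ℝ)
    (Sig : (n : ℕ) → Ω → Matrix (Fin (D.N n)) (Fin (D.N n)) ℝ) : Prop :=
  ∃ a b : ℝ, 0 < a ∧ 1 < b ∧ ∀ n ω, ∃ R : Matrix (Fin (D.N n)) (Fin (D.N n)) ℝ,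
    IsPCResidual D.r (D.Sy n ω) R ∧
    ∃ s : Fin (D.N n) → Fin (D.N n) → ℝ → ℝ,
      (∀ i j, IsThresholding a b (C * √(R i i * R j j) * D.omegaT n) (s i j)) ∧
      ∀ i j, Sig n ω i j = if i = j then R i i else s i j (R i j)

/-- The weighted error `‖N^{-1/2} Λ'(W_T - W)u_t‖`. -/
def weightedError (D : FactorModel Ω) (W : (n : ℕ) → Matrix (Fin (D.N n)) (Fin (D.N n)) ℝ)
    (WT : (n : ℕ) → Ω → Matrix (Fin (D.N n)) (Fin (D.N n)) ℝ) (t : ℤ) (n : ℕ) (ω : Ω) : ℝ :=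
  euclNorm ((√(D.N n : ℝ))⁻¹ • ((D.Lam n)ᵀ *ᵥ ((WT n ω - W n) *ᵥ D.u n t ω)))

/-- `W_T` estimates the weight matrix `W` well enough for weighted principal components:
the absolute error is `o_p(min{T^{-1/4}, N^{-1/4}, √(N/T), √(T/(N log N))})` and the weighted error
is `o_p(1)` for each `t`. -/
structure WeightConsistent (D : FactorModel Ω) (μ : Measure Ω)
    (W : (n : ℕ) → Matrix (Fin (D.N n)) (Fin (D.N n)) ℝ)
    (WT : (n : ℕ) → Ω → Matrix (Fin (D.N n)) (Fin (D.N n)) ℝ) : Prop where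
  absolute : IsLittleOP μ (fun n ω => opNorm (WT n ω - W n)) fun n =>
    min (min ((D.T n : ℝ) ^ (-(1 / 4) : ℝ)) ((D.N n : ℝ) ^ (-(1 / 4) : ℝ)))
      (min √((D.N n : ℝ) / D.T n) √((D.T n : ℝ) / (D.N n * Real.log (D.N n))))
  weighted : ∀ t : ℤ, 1 ≤ t → IsLittleOP μ (D.weightedError W WT t) (fun _ => 1)

end FactorModel

end

/-! Write G, B, E for the time averages of f f', u f', u u'. Then S_y = ΛGΛ' + ΛB' + BΛ' + E, a
large rank-r signal plus noise. The heart of the matter is that the residual R is closer to the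
infeasible sample covariance E than either is to Σ_u. Entrywise, R - Σ_u is of order ω, but R - E is
of order ω² + m_N/N plus rows of (E - Σ_u)Λ/N. The latter are averages over both i and t, hence
smaller than ω in mean square.

Deterministic part (`IsPCResidual.entry_bound`). The r leading eigenvalues are of order N, so the
matrix Z of leading eigenvectors equals ΛQ + Δ with ‖Q‖ of order N^{-1/2} and ‖Δ‖ of order ω.
Projecting off Z leaves only O(ω) in each row of Λ, so every factor term of the residual is a
product of two small terms, and the noise terms involve EZ, which is controlled through (E - Σ_u)Λ,
Σ_uΛ and EΔ.

Probabilistic part. `exists_tendsto_goodEvent` gives all entries of E, B, G within O(√(log N / T))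
of their means. It rests on a Bernstein inequality for mixing sequences
(`MixingBound.concentration`): truncate at T^{1/10}, cut time into blocks, and replace blocks of one
parity by independent copies after rounding them to a finite grid.
`ModelBounds.exists_crossAvg_sq_le` bounds the variance of the entries of (E - Σ_u)Λ/N by a multiple
of N^{-1/2}/T.

Thresholding (`exists_thresholding_bounds`). For C large the threshold exceeds both the small
entries and the entrywise error, so the estimator vanishes on S_L; on S_U the signal exceeds the
threshold by any factor, so the estimator inherits the accuracy of R as an estimate of E. Schur's
test turns the entrywise errors into ‖Σ̂ - Σ_u‖ = O(m_N ω^{1-q}), which passes to the inverses and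
gives part 2.

For part 1 put Δ = Σ̂ - Σ_u, W = Σ_u⁻¹, V = Σ̂⁻¹ and expand V - W = -WΔW + WΔVΔW. The quadratic term
contributes √N ‖Δ‖² O_p(1), which is negligible by (A7). The linear term is N^{-1/2} ∑ ξ_i Δ_ij
e_jt. On S_L, Δ_ij = -Σ_{u,ij} is absolutely summable. On S_U, replacing Σ̂ by E costs a term that
vanishes in mean, and what is left are the averages (i) and (iii) of (A6). Part 3 compares the rate
m_N ω^{1-q} with the additional bounds. -/

noncomputable section

set_option linter.unusedSectionVars false

/-! ### Operator norms, row norms and near-identity inverses -/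

section LinearAlgebra

open scoped Matrix.Norms.L2Operator

variable {l m n : Type*} [Fintype l] [Fintype m] [Fintype n] [DecidableEq l] [DecidableEq m]
  [DecidableEq n]

/-- Euclidean norm of a row of a matrix. -/
def rowNorm {m n : Type*} [Fintype n] (A : Matrix m n ℝ) (i : m) : ℝ := ‖WithLp.toLp 2 (A i)‖

lemma rowNorm_nonneg (A : Matrix m n ℝ) (i : m) : 0 ≤ rowNorm A i := norm_nonneg _

lemma rowNorm_add_le (A B : Matrix m n ℝ) (i : m) :
    rowNorm (A + B) i ≤ rowNorm A i + rowNorm B i :=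
  norm_add_le (WithLp.toLp 2 (A i)) (WithLp.toLp 2 (B i))

lemma rowNorm_sub_le (A B : Matrix m n ℝ) (i : m) :
    rowNorm (A - B) i ≤ rowNorm A i + rowNorm B i :=
  norm_sub_le (WithLp.toLp 2 (A i)) (WithLp.toLp 2 (B i))

lemma l2_opNorm_transpose (A : Matrix m n ℝ) : ‖Aᵀ‖ = ‖A‖ := by
  rw [← conjTranspose_eq_transpose_of_trivial, l2_opNorm_conjTranspose]

lemma norm_mulVec_le (A : Matrix m n ℝ) (x : n → ℝ) :
    ‖WithLp.toLp 2 (A *ᵥ x)‖ ≤ ‖A‖ * ‖WithLp.toLp 2 x‖ :=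
  l2_opNorm_mulVec A (WithLp.toLp 2 x)

lemma norm_vecMul_le (A : Matrix m n ℝ) (x : m → ℝ) :
    ‖WithLp.toLp 2 (x ᵥ* A)‖ ≤ ‖WithLp.toLp 2 x‖ * ‖A‖ := by
  rw [← mulVec_transpose, mul_comm, ← l2_opNorm_transpose A]
  exact norm_mulVec_le _ _

lemma rowNorm_mul_le (A : Matrix l m ℝ) (B : Matrix m n ℝ) (i : l) :
    rowNorm (A * B) i ≤ rowNorm A i * ‖B‖ := by
  have : (A * B) i = A i ᵥ* B := by
    ext j; simp [mul_apply, vecMul, dotProduct]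
  rw [rowNorm, this]
  exact norm_vecMul_le B (A i)

lemma abs_dotProduct_le (x y : n → ℝ) :
    |x ⬝ᵥ y| ≤ ‖WithLp.toLp 2 x‖ * ‖WithLp.toLp 2 y‖ := by
  have := abs_real_inner_le_norm (WithLp.toLp 2 y) (WithLp.toLp 2 x)
  rw [EuclideanSpace.inner_toLp_toLp] at this
  simpa [mul_comm] using this

lemma abs_mul_transpose_apply_le (A : Matrix l n ℝ) (B : Matrix m n ℝ) (i : l) (j : m) :
    |(A * Bᵀ) i j| ≤ rowNorm A i * rowNorm B j := by
  have : (A * Bᵀ) i j = A i ⬝ᵥ B j := by simp [mul_apply, dotProduct]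
  rw [this]
  exact abs_dotProduct_le _ _

lemma norm_sq_toLp (x : n → ℝ) : ‖WithLp.toLp 2 x‖ ^ 2 = ∑ i, x i ^ 2 := by
  simp [EuclideanSpace.norm_sq_eq]

/-- Cauchy–Schwarz bounds each coordinate of Ax by c‖x‖. The number s stands for the square root of
the number of rows, or an upper bound for it, so that square roots of casts stay out of the algebra.
-/
lemma l2_opNorm_le_of_rowNorm_le (A : Matrix m n ℝ) {s c : ℝ} (hs : 0 ≤ s) (hc : 0 ≤ c)
    (hcard : (Fintype.card m : ℝ) ≤ s ^ 2) (h : ∀ i, rowNorm A i ≤ c) : ‖A‖ ≤ s * c := by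
  rw [l2_opNorm_def]
  refine ContinuousLinearMap.opNorm_le_bound _ (by positivity) fun x => ?_
  have h1 : ‖WithLp.toLp 2 (A *ᵥ x.ofLp)‖ ^ 2 ≤ (s * c * ‖x‖) ^ 2 := by
    rw [norm_sq_toLp]
    calc ∑ i, (A *ᵥ x.ofLp) i ^ 2 ≤ ∑ i : m, (c * ‖x‖) ^ 2 := by
          refine Finset.sum_le_sum fun i _ => ?_
          refine sq_le_sq' ?_ ?_ <;>
          · have := abs_dotProduct_le (A i) x.ofLp
            have h2 : ‖WithLp.toLp 2 (A i)‖ * ‖x‖ ≤ c * ‖x‖ :=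
              mul_le_mul_of_nonneg_right (h i) (norm_nonneg _)
            have h3 := abs_le.1 (this.trans h2)
            simp only [mulVec]
            linarith [h3.1, h3.2]
      _ = Fintype.card m * (c * ‖x‖) ^ 2 := by simp
      _ ≤ s ^ 2 * (c * ‖x‖) ^ 2 := by gcongr
      _ = _ := by ring
  have := abs_le_of_sq_le_sq' h1 (by positivity)
  exact this.2

lemma rowNorm_sq (A : Matrix m n ℝ) (i : m) : rowNorm A i ^ 2 = ∑ j, A i j ^ 2 :=
  norm_sq_toLp _

lemma rowNorm_le_of_abs_le (A : Matrix m n ℝ) {s c : ℝ} (hs : 0 ≤ s) (hc : 0 ≤ c)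
    (hcard : (Fintype.card n : ℝ) ≤ s ^ 2) (i : m) (h : ∀ j, |A i j| ≤ c) :
    rowNorm A i ≤ s * c := by
  refine le_of_sq_le_sq ?_ (by positivity)
  rw [rowNorm_sq]
  calc ∑ j, A i j ^ 2 ≤ ∑ j : n, c ^ 2 := by
        refine Finset.sum_le_sum fun j _ => ?_
        rw [← sq_abs]; gcongr; exact h j
    _ = Fintype.card n * c ^ 2 := by simp
    _ ≤ s ^ 2 * c ^ 2 := by gcongr
    _ = _ := by ring

/-- Schur's test with a symmetric dominating matrix. -/
lemma l2_opNorm_le_of_symm_bound (A M : Matrix n n ℝ) {ρ : ℝ} (hρ : 0 ≤ ρ)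
    (hM : ∀ i j, M i j = M j i) (hA : ∀ i j, |A i j| ≤ M i j) (hrow : ∀ i, ∑ j, M i j ≤ ρ) :
    ‖A‖ ≤ ρ := by
  rw [l2_opNorm_def]
  refine ContinuousLinearMap.opNorm_le_bound _ hρ fun x => ?_
  have hM0 : ∀ i j, 0 ≤ M i j := fun i j => (abs_nonneg _).trans (hA i j)
  have h1 : ‖WithLp.toLp 2 (A *ᵥ x.ofLp)‖ ^ 2 ≤ (ρ * ‖x‖) ^ 2 := by
    rw [norm_sq_toLp]
    have hx : ‖x‖ ^ 2 = ∑ i, x.ofLp i ^ 2 := norm_sq_toLp x.ofLp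
    calc ∑ i, (A *ᵥ x.ofLp) i ^ 2 ≤ ∑ i, ρ * ∑ j, M i j * x.ofLp j ^ 2 := by
          refine Finset.sum_le_sum fun i _ => ?_
          -- Splitting M i j as √(M i j) · √(M i j) lets Cauchy–Schwarz separate the row sum from a
          -- weighted sum of squares; symmetry of M later turns the column sums into row sums.
          have h2 : |(A *ᵥ x.ofLp) i| ≤ ∑ j, √(M i j) * (√(M i j) * |x.ofLp j|) := by
            refine (Finset.abs_sum_le_sum_abs _ _).trans (Finset.sum_le_sum fun j _ => ?_)
            rw [abs_mul, ← mul_assoc, Real.mul_self_sqrt (hM0 i j)]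
            exact mul_le_mul_of_nonneg_right (hA i j) (abs_nonneg _)
          have h3 := Finset.sum_mul_sq_le_sq_mul_sq Finset.univ (fun j => √(M i j))
            (fun j => √(M i j) * |x.ofLp j|)
          simp only [mul_pow, Real.sq_sqrt (hM0 i _), sq_abs] at h3
          calc (A *ᵥ x.ofLp) i ^ 2 = |(A *ᵥ x.ofLp) i| ^ 2 := (sq_abs _).symm
            _ ≤ (∑ j, √(M i j) * (√(M i j) * |x.ofLp j|)) ^ 2 := by gcongr
            _ ≤ _ := h3
            _ ≤ _ := by
              refine mul_le_mul_of_nonneg_right (hrow i) ?_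
              exact Finset.sum_nonneg fun j _ => mul_nonneg (hM0 i j) (sq_nonneg _)
      _ = ρ * ∑ j, (∑ i, M j i) * x.ofLp j ^ 2 := by
          rw [← Finset.mul_sum, Finset.sum_comm]
          simp_rw [Finset.sum_mul]
          congr 1
          exact Finset.sum_congr rfl fun j _ => Finset.sum_congr rfl fun i _ => by rw [hM i j]
      _ ≤ ρ * ∑ j, ρ * x.ofLp j ^ 2 := by gcongr with j _; exact hrow j
      _ = (ρ * ‖x‖) ^ 2 := by rw [← Finset.mul_sum, ← hx]; ring
  exact (abs_le_of_sq_le_sq' h1 (by positivity)).2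

lemma l2_opNorm_le_one_of_transpose_mul_self (Z : Matrix m n ℝ) (h : Zᵀ * Z = 1) : ‖Z‖ ≤ 1 := by
  have h1 := l2_opNorm_conjTranspose_mul_self Z
  rw [conjTranspose_eq_transpose_of_trivial, h] at h1
  have h2 : ‖(1 : Matrix n n ℝ)‖ ≤ 1 := by
    rw [← diagonal_one, l2_opNorm_diagonal]
    exact (pi_norm_le_iff_of_nonneg zero_le_one).2 fun i => by simp
  nlinarith [norm_nonneg Z]

/-- Approximate inverse: if `‖Θ‖ ≤ 1/2`, then `1 - Θ` has an inverse `1 + E` with `‖E‖ ≤ 2‖Θ‖`. -/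
lemma exists_inverse_one_sub (Θ : Matrix n n ℝ) (h : ‖Θ‖ ≤ 1 / 2) :
    ∃ E : Matrix n n ℝ, (1 + E) * (1 - Θ) = 1 ∧ (1 - Θ) * (1 + E) = 1 ∧ ‖E‖ ≤ 2 * ‖Θ‖ := by
  have : CompleteSpace (Matrix n n ℝ) := FiniteDimensional.complete ℝ _
  have hlt : ‖Θ‖ < 1 := by linarith
  have hu := (Units.oneSub Θ hlt).inv_mul
  have hu' := (Units.oneSub Θ hlt).mul_inv
  set J : Matrix n n ℝ := ↑(Units.oneSub Θ hlt)⁻¹ with hJ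
  have hval : (↑(Units.oneSub Θ hlt) : Matrix n n ℝ) = 1 - Θ := rfl
  rw [hval] at hu hu'
  refine ⟨J - 1, by rw [add_sub_cancel]; exact hu, by rw [add_sub_cancel]; exact hu', ?_⟩
  -- Fixed-point equation for J - 1; with ‖Θ‖ ≤ 1/2 the last term is absorbed on the left.
  have h1 : J - 1 = Θ + Θ * (J - 1) := by
    have : J - Θ * J = 1 := by rw [← hu']; noncomm_ring
    rw [mul_sub, mul_one]
    rw [add_sub_cancel, sub_eq_iff_eq_add, ← sub_eq_iff_eq_add']; exact this
  have h2 : ‖J - 1‖ ≤ ‖Θ‖ + ‖Θ‖ * ‖J - 1‖ := by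
    calc ‖J - 1‖ = ‖Θ + Θ * (J - 1)‖ := by rw [← h1]
      _ ≤ ‖Θ‖ + ‖Θ * (J - 1)‖ := norm_add_le _ _
      _ ≤ _ := by gcongr; exact norm_mul_le _ _
  nlinarith [norm_nonneg (J - 1)]

end LinearAlgebra

/-! ### Lower bounds for the leading eigenvalues -/

section PrincipalComponents

open scoped Matrix.Norms.L2Operator InnerProductSpace

/-- Courant–Fischer lower bound: if the quadratic form of `S` is at least `c‖x‖²` on the range of an
injective `k × r` matrix, then the `r` largest eigenvalues of `S` are at least `c`. -/
lemma le_eigenvalue_of_quadForm_le {k r : ℕ} {S : Matrix (Fin k) (Fin k) ℝ} (hS : Sᵀ = S)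
    {ν : Fin k → ℝ} {ξ : OrthonormalBasis (Fin k) ℝ (EuclideanSpace ℝ (Fin k))}
    (hν : Antitone ν) (hξ : ∀ j, S *ᵥ (ξ j).ofLp = ν j • (ξ j).ofLp)
    {Λ : Matrix (Fin k) (Fin r) ℝ} (hinj : ∀ y, Λ *ᵥ y = 0 → y = 0) {c : ℝ}
    (hc : ∀ y, c * ‖WithLp.toLp 2 (Λ *ᵥ y)‖ ^ 2 ≤ (Λ *ᵥ y) ⬝ᵥ S *ᵥ (Λ *ᵥ y))
    {j : Fin k} (hj : j.val < r) : c ≤ ν j := by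
  -- The coordinates of Λy along the j eigenvectors preceding `ξ j`. As j < r the kernel is
  -- nontrivial, so the range of Λ contains a nonzero vector orthogonal to all of them.
  let φ : (Fin r → ℝ) →ₗ[ℝ] (Fin j.val → ℝ) :=
    { toFun := fun y i => (ξ (Fin.castLE j.2.le i)).ofLp ⬝ᵥ (Λ *ᵥ y)
      map_add' := fun x y => by ext i; simp [mulVec_add, dotProduct_add]
      map_smul' := fun a y => by ext i; simp [mulVec_smul, dotProduct_smul] }
  have hker : LinearMap.ker φ ≠ ⊥ := LinearMap.ker_ne_bot_of_finrank_lt (by simpa using hj)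
  obtain ⟨y, hy, hy0⟩ := Submodule.exists_mem_ne_zero_of_ne_bot hker
  set x := Λ *ᵥ y with hx
  have hx0 : x ≠ 0 := fun h => hy0 (hinj y h)
  have horth : ∀ i : Fin k, i < j → (ξ i).ofLp ⬝ᵥ x = 0 := fun i hi =>
    congrFun (LinearMap.mem_ker.1 hy) ⟨i.val, hi⟩
  have hin : ∀ (a b : Fin k → ℝ), ⟪WithLp.toLp 2 a, WithLp.toLp 2 b⟫_ℝ = a ⬝ᵥ b := fun a b => by
    rw [EuclideanSpace.inner_toLp_toLp]; simp [dotProduct_comm]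
  have hsq : ‖WithLp.toLp 2 x‖ ^ 2 = ∑ i, ((ξ i).ofLp ⬝ᵥ x) ^ 2 := by
    rw [← ξ.sum_sq_norm_inner_right (WithLp.toLp 2 x)]
    refine Finset.sum_congr rfl fun i _ => ?_
    rw [← hin, Real.norm_eq_abs, sq_abs]
  have hquad : x ⬝ᵥ S *ᵥ x = ∑ i, ν i * ((ξ i).ofLp ⬝ᵥ x) ^ 2 := by
    rw [← hin, ← ξ.sum_inner_mul_inner]
    refine Finset.sum_congr rfl fun i _ => ?_
    have h1 : ⟪ξ i, WithLp.toLp 2 (S *ᵥ x)⟫_ℝ = ν i * ((ξ i).ofLp ⬝ᵥ x) := by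
      have : ξ i = WithLp.toLp 2 (ξ i).ofLp := rfl
      rw [this, hin, dotProduct_mulVec, ← mulVec_transpose, hS, hξ, smul_dotProduct, smul_eq_mul]
    have h2 : ⟪WithLp.toLp 2 x, ξ i⟫_ℝ = (ξ i).ofLp ⬝ᵥ x := by
      rw [real_inner_comm]
      exact hin _ _
    rw [h1, h2]; ring
  have hle : x ⬝ᵥ S *ᵥ x ≤ ν j * ‖WithLp.toLp 2 x‖ ^ 2 := by
    rw [hquad, hsq, Finset.mul_sum]
    refine Finset.sum_le_sum fun i _ => ?_
    rcases lt_or_ge i j with h | h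
    · simp [horth i h]
    · exact mul_le_mul_of_nonneg_right (hν h) (sq_nonneg _)
  have hpos : 0 < ‖WithLp.toLp 2 x‖ ^ 2 := by
    have : WithLp.toLp 2 x ≠ 0 := fun h => hx0 (by simpa using h)
    positivity
  exact le_of_mul_le_mul_right ((hc y).trans hle) hpos

/-- Lower bound for the `r` largest eigenvalues of `ΛGΛ' + ΛB' + BΛ' + E`, with `E` positive
semidefinite and `B` small. -/
lemma quadForm_factor_lower {k r : ℕ} {K s ω : ℝ} (hK : 1 ≤ K) (hs : 0 < s)
    (hk : s ^ 2 = k) {Λ B : Matrix (Fin k) (Fin r) ℝ} {G : Matrix (Fin r) (Fin r) ℝ}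
    {E : Matrix (Fin k) (Fin k) ℝ} (hω : 0 ≤ ω) (hω' : ω ≤ 1 / (4 * K ^ 3))
    (hΛ' : ∀ y, s * ‖WithLp.toLp 2 y‖ ≤ K * ‖WithLp.toLp 2 (Λ *ᵥ y)‖)
    (hG' : ∀ y, ‖WithLp.toLp 2 y‖ ^ 2 ≤ K * (y ⬝ᵥ G *ᵥ y))
    (hB : ∀ i, rowNorm B i ≤ K * ω) (hE : ∀ x, 0 ≤ x ⬝ᵥ E *ᵥ x) (y : Fin r → ℝ) :
    s ^ 2 / (2 * K ^ 3) * ‖WithLp.toLp 2 (Λ *ᵥ y)‖ ^ 2 ≤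
      (Λ *ᵥ y) ⬝ᵥ (Λ * G * Λᵀ + Λ * Bᵀ + B * Λᵀ + E) *ᵥ (Λ *ᵥ y) := by
  set x := Λ *ᵥ y with hx
  set X := ‖WithLp.toLp 2 x‖ with hX
  set v := ‖WithLp.toLp 2 (Λᵀ *ᵥ x)‖ with hv
  have hX0 : 0 ≤ X := norm_nonneg _
  have hv0 : 0 ≤ v := norm_nonneg _
  have hK0 : 0 < K := by linarith
  have hcard : (Fintype.card (Fin k) : ℝ) ≤ s ^ 2 := by simp [hk]
  have hBn : ‖B‖ ≤ s * (K * ω) :=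
    l2_opNorm_le_of_rowNorm_le B hs.le (by positivity) hcard hB
  have hBx : ‖WithLp.toLp 2 (Bᵀ *ᵥ x)‖ ≤ s * (K * ω) * X := by
    refine (norm_mulVec_le _ _).trans ?_
    rw [l2_opNorm_transpose]; gcongr
  -- X² = y'Λ'x ≤ ‖y‖ v, and the quantitative injectivity of Λ bounds ‖y‖ by KX/s.
  have hvX : s * X ≤ K * v := by
    have h1 : X ^ 2 ≤ ‖WithLp.toLp 2 y‖ * v := by
      have : X ^ 2 = y ⬝ᵥ (Λᵀ *ᵥ x) := by
        rw [hX, norm_sq_toLp, dotProduct_mulVec, vecMul_transpose, ← hx]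
        simp [dotProduct, sq]
      rw [this]
      exact (le_abs_self _).trans (abs_dotProduct_le _ _)
    have h2 := hΛ' y
    rw [← hx, ← hX] at h2
    rcases hX0.eq_or_lt with h | h
    · rw [← h]; simp; positivity
    · have : s * X * X ≤ K * v * X := by nlinarith
      exact le_of_mul_le_mul_right this h
  have hquad : x ⬝ᵥ (Λ * G * Λᵀ + Λ * Bᵀ + B * Λᵀ + E) *ᵥ x =
      (Λᵀ *ᵥ x) ⬝ᵥ G *ᵥ (Λᵀ *ᵥ x) + 2 * ((Λᵀ *ᵥ x) ⬝ᵥ (Bᵀ *ᵥ x)) + x ⬝ᵥ E *ᵥ x := by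
    have e1 : x ⬝ᵥ (Λ * G * Λᵀ) *ᵥ x = (Λᵀ *ᵥ x) ⬝ᵥ G *ᵥ (Λᵀ *ᵥ x) := by
      rw [← mulVec_mulVec, ← mulVec_mulVec, dotProduct_mulVec, ← mulVec_transpose]
    have e2 : x ⬝ᵥ (Λ * Bᵀ) *ᵥ x = (Λᵀ *ᵥ x) ⬝ᵥ (Bᵀ *ᵥ x) := by
      rw [← mulVec_mulVec, dotProduct_mulVec, ← mulVec_transpose]
    have e3 : x ⬝ᵥ (B * Λᵀ) *ᵥ x = (Λᵀ *ᵥ x) ⬝ᵥ (Bᵀ *ᵥ x) := by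
      rw [← mulVec_mulVec, dotProduct_mulVec, ← mulVec_transpose, dotProduct_comm]
    rw [add_mulVec, add_mulVec, add_mulVec, dotProduct_add, dotProduct_add, dotProduct_add, e1, e2,
      e3]
    ring
  rw [hquad]
  have h1 : v ^ 2 ≤ K * ((Λᵀ *ᵥ x) ⬝ᵥ G *ᵥ (Λᵀ *ᵥ x)) := hG' _
  have h2 : |(Λᵀ *ᵥ x) ⬝ᵥ (Bᵀ *ᵥ x)| ≤ v * (s * (K * ω) * X) :=
    (abs_dotProduct_le _ _).trans (by gcongr)
  have h3 := (abs_le.1 h2).1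
  have h4 := hE x
  set a := (Λᵀ *ᵥ x) ⬝ᵥ G *ᵥ (Λᵀ *ᵥ x)
  set b := (Λᵀ *ᵥ x) ⬝ᵥ (Bᵀ *ᵥ x)
  have h5 : K * ω ≤ 1 / (4 * K ^ 2) := by
    calc K * ω ≤ K * (1 / (4 * K ^ 3)) := by gcongr
      _ = _ := by field_simp
  have h6 : v * (s * (K * ω) * X) ≤ v * (s * X) / (4 * K ^ 2) := by
    calc v * (s * (K * ω) * X) = v * (s * X) * (K * ω) := by ring
      _ ≤ v * (s * X) * (1 / (4 * K ^ 2)) := by gcongr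
      _ = _ := by ring
  have h7 : v ^ 2 / K ≤ a := by rw [div_le_iff₀ hK0]; linarith
  have h8 : v * (s * X) / (4 * K ^ 2) ≤ v ^ 2 / (4 * K) := by
    calc v * (s * X) / (4 * K ^ 2) ≤ v * (K * v) / (4 * K ^ 2) := by gcongr
      _ = _ := by field_simp
  have h9 : s ^ 2 / (2 * K ^ 3) * X ^ 2 ≤ v ^ 2 / (2 * K) := by
    calc s ^ 2 / (2 * K ^ 3) * X ^ 2 = (s * X) ^ 2 / (2 * K ^ 3) := by ring
      _ ≤ (K * v) ^ 2 / (2 * K ^ 3) := by gcongr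
      _ = _ := by field_simp
  have h10 : v ^ 2 / K = v ^ 2 / (2 * K) + 2 * (v ^ 2 / (4 * K)) := by field_simp; ring
  linarith

end PrincipalComponents

/-! ### Removing the leading eigenspace: algebra and entrywise bounds -/

section Residual

open scoped Matrix.Norms.L2Operator

/-- A row of AB is a combination of rows of B. Using the ℓ¹ norm of the row of A, not its Euclidean
norm, is what lets the sparsity of Σ_u enter. -/
lemma rowNorm_mul_le_sum {l m n : Type*} [Fintype m] [Fintype n] (A : Matrix l m ℝ)
    (B : Matrix m n ℝ) {K : ℝ} (hB : ∀ v, rowNorm B v ≤ K) (i : l) :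
    rowNorm (A * B) i ≤ (∑ v, |A i v|) * K := by
  have h : WithLp.toLp 2 ((A * B) i) = ∑ v, A i v • WithLp.toLp 2 (B v) := by
    ext j
    simp [mul_apply]
  rw [rowNorm, h, Finset.sum_mul]
  refine (norm_sum_le _ _).trans (Finset.sum_le_sum fun v _ => ?_)
  rw [norm_smul, Real.norm_eq_abs]
  exact mul_le_mul_of_nonneg_left (hB v) (abs_nonneg _)

variable {k r : ℕ}

/-- With P = ZZ', the signal is sandwiched between two copies of 1 - P, so Λ and B appear only
through (1 - P)Λ and (1 - P)B, while (1 - P)E(1 - P) - E = -EP - PE + PEP. Each remaining term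
contains small factors that can be bounded row by row. -/
lemma residual_decomposition {Λ B Z : Matrix (Fin k) (Fin r) ℝ}
    {G : Matrix (Fin r) (Fin r) ℝ} {E S : Matrix (Fin k) (Fin k) ℝ} (hEs : Eᵀ = E)
    (hS : S = Λ * G * Λᵀ + Λ * Bᵀ + B * Λᵀ + E) :
    (1 - Z * Zᵀ) * S * (1 - Z * Zᵀ) - E =
      (Λ - Z * (Zᵀ * Λ)) * G * (Λ - Z * (Zᵀ * Λ))ᵀ
      + (Λ - Z * (Zᵀ * Λ)) * (B - Z * (Zᵀ * B))ᵀ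
      + (B - Z * (Zᵀ * B)) * (Λ - Z * (Zᵀ * Λ))ᵀ
      - (E * Z) * Zᵀ - Z * (E * Z)ᵀ + (Z * Zᵀ) * ((E * Z) * Zᵀ) := by
  have h1 : ∀ M : Matrix (Fin k) (Fin r) ℝ, M - Z * (Zᵀ * M) = (1 - Z * Zᵀ) * M := fun M => by
    rw [Matrix.sub_mul, Matrix.one_mul, Matrix.mul_assoc]
  have h2 : (1 - Z * Zᵀ)ᵀ = 1 - Z * Zᵀ := by simp
  simp only [h1, transpose_mul, h2, hEs, hS]
  generalize hP : Z * Zᵀ = P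
  have e1 : E * Z * Zᵀ = E * P := by rw [Matrix.mul_assoc, hP]
  have e2 : Z * (Zᵀ * E) = P * E := by rw [← Matrix.mul_assoc, hP]
  rw [e1, e2]
  simp only [Matrix.mul_add, Matrix.add_mul, Matrix.sub_mul, Matrix.mul_sub, Matrix.one_mul,
    Matrix.mul_one, Matrix.mul_assoc]
  abel

set_option maxHeartbeats 1000000 in
/-- Entrywise accuracy of the residual after removing the leading eigenspace, spanned by the
orthonormal columns of `Z`, of an approximate factor structure. -/
lemma projected_residual_entry_bound {K s ω ρ c : ℝ} (hK : 1 ≤ K) (hs : 0 < s)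
    (hk : s ^ 2 = k) (hc : 0 < c) {Λ B Z : Matrix (Fin k) (Fin r) ℝ}
    {G V D : Matrix (Fin r) (Fin r) ℝ} {E Sg S : Matrix (Fin k) (Fin k) ℝ}
    (hEs : Eᵀ = E) (hS : S = Λ * G * Λᵀ + Λ * Bᵀ + B * Λᵀ + E)
    (hZ : Zᵀ * Z = 1) (hSZ : S * Z = Z * V) (hVD : V * D = 1) (hD : ‖D‖ ≤ c / s ^ 2)
    (hω : 0 ≤ ω) (hsω : 1 ≤ s * ω) (hω1 : ω ≤ 1) (hωd : 3 * K ^ 2 * c * ω ≤ 1 / 2)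
    (hΛ : ∀ i, rowNorm Λ i ≤ K) (hG : ‖G‖ ≤ K) (hB : ∀ i, rowNorm B i ≤ K * ω)
    (hEsg : ∀ i j, |E i j - Sg i j| ≤ K * ω) (hSg : ∀ i, rowNorm Sg i ≤ K) (hρ : 0 ≤ ρ)
    (hSgρ : ∀ i, ∑ j, |Sg i j| ≤ K * ρ) {q d z L b g : ℝ} (hq : q = 2 * K ^ 2 * c)
    (hd : d = 3 * K ^ 2 * c) (hz : z = K * q + d) (hL : L = 2 * K ^ 2 * q * d + d * K)
    (hb : b = K + z * K) (hg : g = q * K ^ 2 + 2 * K * d + q) (i j : Fin k) :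
    |((1 - Z * Zᵀ) * S * (1 - Z * Zᵀ) : Matrix (Fin k) (Fin k) ℝ) i j - E i j| ≤
      (L ^ 2 * K + 2 * (L * b) + g * z + g * z + g * z ^ 3) * (ω ^ 2 + ρ / s ^ 2 +
        rowNorm ((E - Sg) * Λ) i / s ^ 2 + rowNorm ((E - Sg) * Λ) j / s ^ 2
        + (∑ v, rowNorm ((E - Sg) * Λ) v / s ^ 2) / s ^ 2) := by
  have hK0 : 0 < K := by linarith
  have hq0 : 0 < q := by rw [hq]; positivity
  have hd0 : 0 < d := by rw [hd]; positivity
  have hz0 : 0 < z := by rw [hz]; positivity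
  have hL0 : 0 < L := by rw [hL]; positivity
  have hb0 : 0 < b := by rw [hb]; positivity
  have hg0 : 0 < g := by rw [hg]; positivity
  have hcard : (Fintype.card (Fin k) : ℝ) ≤ s ^ 2 := by simp [hk]
  have hΛn : ‖Λ‖ ≤ s * K := l2_opNorm_le_of_rowNorm_le Λ hs.le hK0.le hcard hΛ
  have hBn : ‖B‖ ≤ s * (K * ω) := l2_opNorm_le_of_rowNorm_le B hs.le (by positivity) hcard hB
  have hZn : ‖Z‖ ≤ 1 := l2_opNorm_le_one_of_transpose_mul_self Z hZ
  have hZtn : ‖Zᵀ‖ ≤ 1 := by rwa [l2_opNorm_transpose]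
  have hErow : ∀ i, rowNorm E i ≤ 2 * K * (s * ω) := fun i => by
    have h1 := rowNorm_add_le Sg (E - Sg) i
    rw [add_sub_cancel] at h1
    have h2 := rowNorm_le_of_abs_le (E - Sg) hs.le (by positivity) hcard i (hEsg i)
    have h3 := hSg i
    nlinarith
  have hΛtZ : ‖Λᵀ * Z‖ ≤ s * K := by
    refine (l2_opNorm_mul _ _).trans ?_
    rw [l2_opNorm_transpose]
    calc ‖Λ‖ * ‖Z‖ ≤ (s * K) * 1 := by gcongr
      _ = _ := by ring
  -- From Z = SZD, sort the four terms of S: those starting with Λ give ΛQ, the others give Δ.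
  set Q := (G * Λᵀ * Z + Bᵀ * Z) * D with hQdef
  set Δ := (B * (Λᵀ * Z) + E * Z) * D with hΔdef
  have hQn : ‖Q‖ ≤ q / s := by
    have h1 : ‖G * Λᵀ * Z‖ ≤ K * (s * K) := by
      rw [Matrix.mul_assoc]
      exact (l2_opNorm_mul _ _).trans (by gcongr)
    have h2 : ‖Bᵀ * Z‖ ≤ s * (K * ω) := by
      refine (l2_opNorm_mul _ _).trans ?_
      rw [l2_opNorm_transpose]
      calc ‖B‖ * ‖Z‖ ≤ (s * (K * ω)) * 1 := by gcongr
        _ = _ := by ring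
    calc ‖Q‖ ≤ ‖G * Λᵀ * Z + Bᵀ * Z‖ * ‖D‖ := l2_opNorm_mul _ _
      _ ≤ (K * (s * K) + s * (K * ω)) * (c / s ^ 2) := by
          gcongr; exact (norm_add_le _ _).trans (add_le_add h1 h2)
      _ ≤ (K * (s * K) + s * (K * K)) * (c / s ^ 2) := by gcongr; linarith
      _ = q / s := by rw [hq]; field_simp; ring
  have hΔrow : ∀ i, rowNorm Δ i ≤ d * ω / s := fun i => by
    have h1 : rowNorm (B * (Λᵀ * Z)) i ≤ K * ω * (s * K) :=
      (rowNorm_mul_le _ _ i).trans (mul_le_mul (hB i) hΛtZ (norm_nonneg _) (by positivity))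
    have h2 : rowNorm (E * Z) i ≤ 2 * K * (s * ω) * 1 :=
      (rowNorm_mul_le _ _ i).trans (mul_le_mul (hErow i) hZn (norm_nonneg _) (by positivity))
    calc rowNorm Δ i ≤ rowNorm (B * (Λᵀ * Z) + E * Z) i * ‖D‖ := rowNorm_mul_le _ _ i
      _ ≤ (K * ω * (s * K) + 2 * K * (s * ω) * 1) * (c / s ^ 2) := by
          gcongr
          exact (rowNorm_add_le _ _ i).trans (add_le_add h1 h2)
      _ ≤ (K * ω * (s * K) + 2 * K * (s * ω) * K) * (c / s ^ 2) := by gcongr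
      _ = d * ω / s := by rw [hd]; field_simp; ring
  have hΔn : ‖Δ‖ ≤ d * ω := by
    refine (l2_opNorm_le_of_rowNorm_le Δ hs.le (by positivity) hcard hΔrow).trans (le_of_eq ?_)
    field_simp
  have hZeq : Z = Λ * Q + Δ := by
    have h1 : Z = S * Z * D := by rw [hSZ, Matrix.mul_assoc, hVD, Matrix.mul_one]
    refine h1.trans ?_
    rw [hQdef, hΔdef, hS]
    simp only [Matrix.add_mul, Matrix.mul_add, Matrix.mul_assoc]
    abel
  have hZrow : ∀ i, rowNorm Z i ≤ z / s := fun i => by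
    have h1 : rowNorm (Λ * Q) i ≤ K * (q / s) :=
      (rowNorm_mul_le _ _ i).trans (mul_le_mul (hΛ i) hQn (norm_nonneg _) hK0.le)
    calc rowNorm Z i = rowNorm (Λ * Q + Δ) i := by rw [← hZeq]
      _ ≤ K * (q / s) + d * ω / s := (rowNorm_add_le _ _ i).trans (add_le_add h1 (hΔrow i))
      _ ≤ K * (q / s) + d * 1 / s := by gcongr
      _ = z / s := by rw [hz]; ring
  set A := Zᵀ * Λ with hA
  have hAn : ‖A‖ ≤ s * K := by
    calc ‖A‖ ≤ ‖Zᵀ‖ * ‖Λ‖ := l2_opNorm_mul _ _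
      _ ≤ 1 * (s * K) := by gcongr
      _ = _ := one_mul _
  have hΘn : ‖Zᵀ * Δ‖ ≤ d * ω := by
    calc ‖Zᵀ * Δ‖ ≤ ‖Zᵀ‖ * ‖Δ‖ := l2_opNorm_mul _ _
      _ ≤ 1 * (d * ω) := by gcongr
      _ = _ := one_mul _
  -- Multiply Z = ΛQ + Δ by Z'. Hence Z'Λ and Q are nearly inverse r × r matrices, so Q is
  -- invertible although no lower bound for it was assumed.
  have hAQ : A * Q = 1 - Zᵀ * Δ := by
    rw [hA, Matrix.mul_assoc, eq_sub_iff_add_eq, ← Matrix.mul_add, ← hZeq, hZ]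
  obtain ⟨F, hF1, -, hFn⟩ := exists_inverse_one_sub (Zᵀ * Δ) (by rw [← hd] at hωd; linarith)
  have hQA : Q * ((1 + F) * A) = 1 := by
    rw [mul_eq_one_comm, Matrix.mul_assoc, hAQ, hF1]
  -- Write Λ = ΛQ(1 + F)A and Z = ΛQ + Δ: the main terms ΛQA cancel, and what is left carries F or
  -- Δ, hence a factor ω.
  have hLeq : Λ - Z * A = Λ * (Q * (F * A)) - Δ * A := by
    have h1 : Λ = Λ * (Q * ((1 + F) * A)) := by rw [hQA, Matrix.mul_one]
    have h2 : Z * A = (Λ * Q + Δ) * A := by rw [← hZeq]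
    rw [h2]
    nth_rewrite 1 [h1]
    simp only [Matrix.add_mul, Matrix.mul_add, Matrix.one_mul, Matrix.mul_assoc]
    abel
  have hLrow : ∀ i, rowNorm (Λ - Z * A) i ≤ L * ω := fun i => by
    rw [hLeq]
    have h0 : ‖Q * (F * A)‖ ≤ q / s * (2 * (d * ω) * (s * K)) := by
      refine (l2_opNorm_mul _ _).trans (mul_le_mul hQn ?_ (norm_nonneg _) (by positivity))
      refine (l2_opNorm_mul _ _).trans (mul_le_mul (by linarith) hAn (norm_nonneg _) ?_)
      positivity
    have h1 : rowNorm (Λ * (Q * (F * A))) i ≤ K * (q / s * (2 * (d * ω) * (s * K))) :=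
      (rowNorm_mul_le _ _ i).trans (mul_le_mul (hΛ i) h0 (norm_nonneg _) hK0.le)
    have h2 : rowNorm (Δ * A) i ≤ d * ω / s * (s * K) :=
      (rowNorm_mul_le _ _ i).trans (mul_le_mul (hΔrow i) hAn (norm_nonneg _) (by positivity))
    refine (rowNorm_sub_le _ _ i).trans ((add_le_add h1 h2).trans (le_of_eq ?_))
    rw [hL]; field_simp
  have hBrow : ∀ i, rowNorm (B - Z * (Zᵀ * B)) i ≤ b * ω := fun i => by
    have h0 : ‖Zᵀ * B‖ ≤ s * (K * ω) := by
      calc ‖Zᵀ * B‖ ≤ ‖Zᵀ‖ * ‖B‖ := l2_opNorm_mul _ _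
        _ ≤ 1 * (s * (K * ω)) := by gcongr
        _ = _ := one_mul _
    have h1 : rowNorm (Z * (Zᵀ * B)) i ≤ z / s * (s * (K * ω)) :=
      (rowNorm_mul_le _ _ i).trans (mul_le_mul (hZrow i) h0 (norm_nonneg _) (by positivity))
    refine (rowNorm_sub_le _ _ i).trans ((add_le_add (hB i) h1).trans (le_of_eq ?_))
    rw [hb]; field_simp
  set δ := ω ^ 2 + ρ / s ^ 2 with hδ
  have hδ0 : 0 ≤ δ := by positivity
  set h : Fin k → ℝ := fun v => rowNorm ((E - Sg) * Λ) v / s ^ 2 with hh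
  have hh0 : ∀ v, 0 ≤ h v := fun v => div_nonneg (rowNorm_nonneg _ _) (by positivity)
  -- The crude bound for a row of EZ is of order sω, which would be too large. Substituting ΛQ + Δ
  -- for Z replaces it by the averaged quantity (E - Σ)Λ, by ΣΛ, which the sparsity bounds, and by a
  -- term of order sω².
  have hEZrow : ∀ i, rowNorm (E * Z) i ≤ s * (g * (h i + δ)) := fun i => by
    have h0 : E * Z = ((E - Sg) * Λ + Sg * Λ) * Q + E * Δ := by
      nth_rewrite 1 [hZeq]
      rw [← Matrix.add_mul, sub_add_cancel, Matrix.mul_add, Matrix.mul_assoc]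
    have h1 : rowNorm (Sg * Λ) i ≤ K * ρ * K :=
      (rowNorm_mul_le_sum Sg Λ hΛ i).trans (by gcongr; exact hSgρ i)
    have h2 : rowNorm (((E - Sg) * Λ + Sg * Λ) * Q) i ≤ (s ^ 2 * h i + K * ρ * K) * (q / s) := by
      refine (rowNorm_mul_le _ _ i).trans (mul_le_mul ?_ hQn (norm_nonneg _) ?_)
      · refine (rowNorm_add_le _ _ i).trans (add_le_add (le_of_eq ?_) h1)
        rw [hh]; field_simp
      · have := hh0 i; positivity
    have h3 : rowNorm (E * Δ) i ≤ 2 * K * (s * ω) * (d * ω) :=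
      (rowNorm_mul_le _ _ i).trans (mul_le_mul (hErow i) hΔn (norm_nonneg _) (by positivity))
    calc rowNorm (E * Z) i ≤ (s ^ 2 * h i + K * ρ * K) * (q / s) + 2 * K * (s * ω) * (d * ω) := by
          rw [h0]; exact (rowNorm_add_le _ _ i).trans (add_le_add h2 h3)
      _ = s * (q * h i + q * K ^ 2 * (ρ / s ^ 2) + 2 * K * d * ω ^ 2) := by field_simp
      _ ≤ s * (g * (h i + δ)) := by
          gcongr
          have a1 : 0 ≤ q * K ^ 2 * h i := by have := hh0 i; positivity
          have a2 : 0 ≤ 2 * K * d * h i := by have := hh0 i; positivity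
          have a3 : 0 ≤ (q * K ^ 2 + q) * ω ^ 2 := by positivity
          have a4 : 0 ≤ (2 * K * d + q) * (ρ / s ^ 2) := by positivity
          rw [hg, hδ]
          nlinarith
  have hM : ∀ i j, |(E * Z * Zᵀ) i j| ≤ g * z * (h i + δ) := fun i j => by
    refine (abs_mul_transpose_apply_le _ _ i j).trans ?_
    have := hh0 i
    calc rowNorm (E * Z) i * rowNorm Z j ≤ s * (g * (h i + δ)) * (z / s) :=
          mul_le_mul (hEZrow i) (hZrow j) (rowNorm_nonneg _ _) (by positivity)
      _ = _ := by field_simp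
  have hM' : |(Z * (E * Z)ᵀ) i j| ≤ g * z * (h j + δ) := by
    have : Z * (E * Z)ᵀ = (E * Z * Zᵀ)ᵀ := by
      rw [transpose_mul (E * Z) Zᵀ, transpose_transpose]
    rw [this, transpose_apply]
    exact hM j i
  -- Entries of ZZ' are of order 1/s², so this product averages the rows of EZZ'; this is the source
  -- of the mean over v in the final bound.
  have hPP : |(Z * Zᵀ * (E * Z * Zᵀ)) i j| ≤ g * z ^ 3 * ((∑ v, h v) / s ^ 2 + δ) := by
    rw [mul_apply]
    calc |∑ v, (Z * Zᵀ) i v * (E * Z * Zᵀ) v j|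
        ≤ ∑ v, (z / s * (z / s)) * (g * z * (h v + δ)) := by
          refine (Finset.abs_sum_le_sum_abs _ _).trans (Finset.sum_le_sum fun v _ => ?_)
          rw [abs_mul]
          refine mul_le_mul ?_ (hM v j) (abs_nonneg _) (by positivity)
          exact (abs_mul_transpose_apply_le _ _ i v).trans
            (mul_le_mul (hZrow i) (hZrow v) (rowNorm_nonneg _ _) (by positivity))
      _ = (z / s * (z / s)) * (g * z) * (∑ v, h v + s ^ 2 * δ) := by
          rw [← Finset.mul_sum, ← Finset.mul_sum, Finset.sum_add_distrib]
          simp [← hk]; ring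
      _ = _ := by field_simp
  have hLL : |((Λ - Z * A) * G * (Λ - Z * A)ᵀ) i j| ≤ L ^ 2 * K * ω ^ 2 := by
    refine (abs_mul_transpose_apply_le _ _ i j).trans ?_
    calc _ ≤ (L * ω * K) * (L * ω) := by
          refine mul_le_mul ?_ (hLrow j) (rowNorm_nonneg _ _) (by positivity)
          exact (rowNorm_mul_le _ _ i).trans (mul_le_mul (hLrow i) hG (norm_nonneg _)
            (by positivity))
      _ = _ := by ring
  have hLB : |((Λ - Z * A) * (B - Z * (Zᵀ * B))ᵀ) i j| ≤ L * b * ω ^ 2 := by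
    refine (abs_mul_transpose_apply_le _ _ i j).trans ?_
    calc _ ≤ (L * ω) * (b * ω) :=
          mul_le_mul (hLrow i) (hBrow j) (rowNorm_nonneg _ _) (by positivity)
      _ = _ := by ring
  have hBL : |((B - Z * (Zᵀ * B)) * (Λ - Z * A)ᵀ) i j| ≤ L * b * ω ^ 2 := by
    refine (abs_mul_transpose_apply_le _ _ i j).trans ?_
    calc _ ≤ (b * ω) * (L * ω) :=
          mul_le_mul (hBrow i) (hLrow j) (rowNorm_nonneg _ _) (by positivity)
      _ = _ := by ring
  have hdec := congrArg (fun M : Matrix (Fin k) (Fin k) ℝ => M i j)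
    (residual_decomposition (Z := Z) hEs hS)
  simp only [Matrix.sub_apply, Matrix.add_apply] at hdec
  rw [hdec]
  have hω2 : ω ^ 2 ≤ δ := by rw [hδ]; linarith [show 0 ≤ ρ / s ^ 2 by positivity]
  have hsum0 : 0 ≤ (∑ v, h v) / s ^ 2 := div_nonneg (Finset.sum_nonneg fun v _ => hh0 v)
    (by positivity)
  set X := δ + h i + h j + (∑ v, h v) / s ^ 2 with hX
  have hi := hh0 i
  have hj := hh0 j
  have b1 : L ^ 2 * K * ω ^ 2 ≤ L ^ 2 * K * X := by gcongr; linarith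
  have b2 : L * b * ω ^ 2 ≤ L * b * X := by gcongr; linarith
  have b3 : g * z * (h i + δ) ≤ g * z * X := by gcongr; linarith
  have b4 : g * z * (h j + δ) ≤ g * z * X := by gcongr; linarith
  have b5 : g * z ^ 3 * ((∑ v, h v) / s ^ 2 + δ) ≤ g * z ^ 3 * X := by gcongr; linarith
  have t1 := abs_le.1 (hLL.trans b1)
  have t2 := abs_le.1 (hLB.trans b2)
  have t3 := abs_le.1 (hBL.trans b2)
  have t4 := abs_le.1 ((hM i j).trans b3)
  have t5 := abs_le.1 (hM'.trans b4)
  have t6 := abs_le.1 (hPP.trans b5)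
  have e : (L ^ 2 * K + 2 * (L * b) + g * z + g * z + g * z ^ 3) * X =
    L ^ 2 * K * X + L * b * X + L * b * X + g * z * X + g * z * X + g * z ^ 3 * X := by ring
  rw [e]
  rw [abs_le]
  constructor <;> linarith [t1.1, t1.2, t2.1, t2.2, t3.1, t3.2, t4.1, t4.2, t5.1, t5.2, t6.1, t6.2]

end Residual

/-! ### Entrywise accuracy of the principal component residual -/

section Residual

open scoped Matrix.Norms.L2Operator

/-- Entrywise accuracy of the principal component residual of an approximate factor structure. -/
theorem IsPCResidual.entry_bound (r : ℕ) {K : ℝ} (hK : 1 ≤ K) : ∃ C ε : ℝ, 0 < C ∧ 0 < ε ∧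
    ∀ {k : ℕ} {s ω ρ : ℝ} {Λ B : Matrix (Fin k) (Fin r) ℝ} {G : Matrix (Fin r) (Fin r) ℝ}
      {E Sg S R : Matrix (Fin k) (Fin k) ℝ}, 0 < s → s ^ 2 = k → Eᵀ = E → Gᵀ = G →
      S = Λ * G * Λᵀ + Λ * Bᵀ + B * Λᵀ + E → 1 ≤ s * ω → ω ≤ ε →
      (∀ i, rowNorm Λ i ≤ K) →
      (∀ y, s * ‖WithLp.toLp 2 y‖ ≤ K * ‖WithLp.toLp 2 (Λ *ᵥ y)‖) →
      ‖G‖ ≤ K → (∀ y, ‖WithLp.toLp 2 y‖ ^ 2 ≤ K * (y ⬝ᵥ G *ᵥ y)) →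
      (∀ i, rowNorm B i ≤ K * ω) → (∀ x, 0 ≤ x ⬝ᵥ E *ᵥ x) →
      (∀ i j, |E i j - Sg i j| ≤ K * ω) → (∀ i, rowNorm Sg i ≤ K) → 0 ≤ ρ →
      (∀ i, ∑ j, |Sg i j| ≤ K * ρ) → IsPCResidual r S R → ∀ i j,
      |R i j - E i j| ≤ C * (ω ^ 2 + ρ / s ^ 2 +
        rowNorm ((E - Sg) * Λ) i / s ^ 2 + rowNorm ((E - Sg) * Λ) j / s ^ 2
        + (∑ v, rowNorm ((E - Sg) * Λ) v / s ^ 2) / s ^ 2) := by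
  have hK0 : 0 < K := by linarith
  -- The r leading eigenvalues will be at least s²/c, by `quadForm_factor_lower`.
  set c := 2 * K ^ 3 with hc
  have hc0 : 0 < c := by positivity
  set q := 2 * K ^ 2 * c with hq
  set d := 3 * K ^ 2 * c with hd
  set z := K * q + d with hz
  set L := 2 * K ^ 2 * q * d + d * K with hL
  set b := K + z * K with hb
  set g := q * K ^ 2 + 2 * K * d + q with hg
  -- The three bounds on ω serve respectively ω ≤ 1, the eigenvalue bound, and ‖Z'Δ‖ ≤ 1/2 in the
  -- near inversion.
  refine ⟨L ^ 2 * K + 2 * (L * b) + g * z + g * z + g * z ^ 3, min 1 (min (1 / (4 * K ^ 3))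
    (1 / (6 * K ^ 2 * c))), by positivity, by positivity, ?_⟩
  intro k s ω ρ Λ B G E Sg S R hs hk hEs hGs hS hsω hωε hΛ hΛ' hG hG' hB hE hEsg hSg hρ hSgρ hR i j
  obtain ⟨ν, ξ, hν, hξ, rfl⟩ := hR
  have hω : 0 ≤ ω := by
    by_contra h
    nlinarith
  have hω1 : ω ≤ 1 := hωε.trans (min_le_left _ _)
  have hω2 : ω ≤ 1 / (4 * K ^ 3) := hωε.trans ((min_le_right _ _).trans (min_le_left _ _))
  have hω3 : ω ≤ 1 / (6 * K ^ 2 * c) := hωε.trans ((min_le_right _ _).trans (min_le_right _ _))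
  have hωd : 3 * K ^ 2 * c * ω ≤ 1 / 2 := by
    calc 3 * K ^ 2 * c * ω ≤ 3 * K ^ 2 * c * (1 / (6 * K ^ 2 * c)) := by gcongr
      _ = 1 / 2 := by field_simp; norm_num
  have hinj : ∀ y, Λ *ᵥ y = 0 → y = 0 := fun y hy => by
    have h1 := hΛ' y
    rw [hy] at h1
    have h2 : ‖WithLp.toLp 2 y‖ = 0 := by
      have : s * ‖WithLp.toLp 2 y‖ ≤ 0 := by simpa using h1
      have h0 := norm_nonneg (WithLp.toLp 2 y)
      nlinarith
    simpa using h2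
  have hrk : r ≤ k := by
    have := LinearMap.finrank_le_finrank_of_injective (f := Λ.mulVecLin)
      (by
        rw [← LinearMap.ker_eq_bot, LinearMap.ker_eq_bot']
        intro y hy
        exact hinj y (by simpa using hy))
    simpa using this
  have hSs : Sᵀ = S := by
    rw [hS]
    simp only [transpose_add, transpose_mul, transpose_transpose, hEs, hGs, Matrix.mul_assoc]
    abel
  have hlow : ∀ j : Fin k, j.val < r → s ^ 2 / c ≤ ν j := fun j hj =>
    le_eigenvalue_of_quadForm_le hSs hν hξ hinj (fun y => by
      rw [hS]; exact quadForm_factor_lower hK hs hk hω hω2 hΛ' hG' hB hE y) hj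
  set Z : Matrix (Fin k) (Fin r) ℝ := Matrix.of fun i j => (ξ (Fin.castLE hrk j)).ofLp i with hZdef
  set V : Matrix (Fin r) (Fin r) ℝ := diagonal fun j => ν (Fin.castLE hrk j) with hV
  set D : Matrix (Fin r) (Fin r) ℝ := diagonal fun j => (ν (Fin.castLE hrk j))⁻¹ with hD
  have hνpos : ∀ j : Fin r, s ^ 2 / c ≤ ν (Fin.castLE hrk j) := fun j => hlow _ j.2
  have hpos : 0 < s ^ 2 / c := by positivity
  have hVD : V * D = 1 := by
    rw [hV, hD, diagonal_mul_diagonal, ← diagonal_one]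
    congr 1
    ext j
    exact mul_inv_cancel₀ (hpos.trans_le (hνpos j)).ne'
  have hDn : ‖D‖ ≤ c / s ^ 2 := by
    rw [hD, l2_opNorm_diagonal]
    refine (pi_norm_le_iff_of_nonneg (by positivity)).2 fun j => ?_
    rw [norm_inv, Real.norm_eq_abs, abs_of_pos (hpos.trans_le (hνpos j)), ← inv_div]
    exact inv_anti₀ hpos (hνpos j)
  have hZ : Zᵀ * Z = 1 := by
    ext a b
    have := (orthonormal_iff_ite.1 ξ.orthonormal) (Fin.castLE hrk a) (Fin.castLE hrk b)
    rw [PiLp.inner_apply] at this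
    simp only [mul_apply, transpose_apply, hZdef, of_apply, one_apply]
    simp only [RCLike.inner_apply, conj_trivial] at this
    simp_rw [mul_comm] at this ⊢
    rw [this]
    simp
  have hSZ : S * Z = Z * V := by
    ext a b
    have := congrFun (hξ (Fin.castLE hrk b)) a
    rw [hV, mul_diagonal]
    simp only [mul_apply, hZdef, of_apply]
    simpa [mulVec, dotProduct, mul_comm] using this
  have hZVZ : ∑ j with Fin.val j < r, ν j • vecMulVec (ξ j).ofLp (ξ j).ofLp = Z * V * Zᵀ := by
    ext a b
    have hZV : ∀ x, (Z * V) a x = Z a x * ν (Fin.castLE hrk x) := fun x => by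
      rw [hV, mul_diagonal]
    rw [mul_apply]
    simp only [hZV, Matrix.sum_apply, transpose_apply, Matrix.smul_apply,
      vecMulVec_apply, smul_eq_mul]
    symm
    refine Finset.sum_bij (fun j _ => Fin.castLE hrk j) (by simp) (by simp) ?_ ?_
    · intro j hj
      exact ⟨⟨j.val, (Finset.mem_filter.1 hj).2⟩, Finset.mem_univ _, rfl⟩
    · intro j _
      simp [hZdef]; ring
  -- Z spans an invariant subspace of the symmetric S, so deflating the leading eigenpairs is the
  -- same as projecting on both sides.
  have hRes : S - ∑ j with Fin.val j < r, ν j • vecMulVec (ξ j).ofLp (ξ j).ofLp =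
      (1 - Z * Zᵀ) * S * (1 - Z * Zᵀ) := by
    rw [hZVZ]
    have h1 : S * (Z * Zᵀ) = Z * V * Zᵀ := by rw [← Matrix.mul_assoc, hSZ]
    have h2 : Z * Zᵀ * S = Z * V * Zᵀ := by
      have := congrArg transpose h1
      rw [transpose_mul, hSs] at this
      simpa [hV, Matrix.mul_assoc] using this
    have h3 : Z * V * Zᵀ * (Z * Zᵀ) = Z * V * Zᵀ := by
      calc Z * V * Zᵀ * (Z * Zᵀ) = Z * V * (Zᵀ * Z) * Zᵀ := by simp only [Matrix.mul_assoc]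
        _ = _ := by rw [hZ, Matrix.mul_one]
    rw [Matrix.mul_sub, Matrix.mul_one, Matrix.sub_mul, Matrix.one_mul, Matrix.sub_mul, h1, h2, h3]
    abel
  rw [hRes]
  exact projected_residual_entry_bound hK hs hk hc0 hEs hS hZ hSZ hVD hDn hω hsω hω1 hωd hΛ hG hB
    hEsg hSg hρ hSgρ hq hd hz hL hb hg i j

end Residual

/-! ### Covariance inequalities under strong mixing -/

section MixingCovariance

variable {Ω : Type*} {m m₁ m₂ : MeasurableSpace Ω} [mΩ : MeasurableSpace Ω] {μ : Measure Ω}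

/-- If two finite measures differ by at most `a` on the sets of a sub-σ-algebra, then so do the
integrals of `[0,1]`-valued functions measurable with respect to it. -/
lemma abs_integral_sub_integral_le (hm : m ≤ mΩ)
    {ν₁ ν₂ : Measure Ω} [IsFiniteMeasure ν₁] [IsFiniteMeasure ν₂] {a : ℝ}
    (h : ∀ A, MeasurableSet[m] A → |ν₁.real A - ν₂.real A| ≤ a) {f : Ω → ℝ}
    (hf : Measurable[m] f) (h0 : ∀ ω, 0 ≤ f ω) (h1 : ∀ ω, f ω ≤ 1) :
    |∫ ω, f ω ∂ν₁ - ∫ ω, f ω ∂ν₂| ≤ a := by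
  have hf' : Measurable f := hf.mono hm le_rfl
  have hint : ∀ (ν : Measure Ω) [IsFiniteMeasure ν], Integrable f ν := fun ν _ =>
    Integrable.of_bound hf'.aestronglyMeasurable 1
      (ae_of_all _ fun ω => by rw [Real.norm_eq_abs, abs_of_nonneg (h0 ω)]; exact h1 ω)
  -- Layer-cake formula: the integral is an average over t in (0, 1] of measures of level sets, on
  -- each of which the two measures differ by at most a.
  have hlay : ∀ (ν : Measure Ω) [IsFiniteMeasure ν],
      ∫ ω, f ω ∂ν = ∫ t in Set.Ioc (0 : ℝ) 1, ν.real {ω | t ≤ f ω} := fun ν _ =>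
    (hint ν).integral_eq_integral_Ioc_meas_le (ae_of_all _ h0) (ae_of_all _ h1)
  have hint' : ∀ (ν : Measure Ω) [IsFiniteMeasure ν],
      IntegrableOn (fun t : ℝ => ν.real {ω | t ≤ f ω}) (Set.Ioc 0 1) := fun ν _ => by
    refine Integrable.of_bound (Measurable.aestronglyMeasurable ?_) (ν.real Set.univ)
      (ae_of_all _ fun t => ?_)
    · exact Antitone.measurable fun s t hst =>
        measureReal_mono (fun ω (hω : t ≤ f ω) => hst.trans hω)
    · rw [Real.norm_eq_abs, abs_of_nonneg measureReal_nonneg]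
      exact measureReal_mono (Set.subset_univ _)
  rw [hlay ν₁, hlay ν₂, ← integral_sub (hint' ν₁) (hint' ν₂)]
  have key := norm_setIntegral_le_of_norm_le_const (μ := volume) (s := Set.Ioc (0 : ℝ) 1) (C := a)
    (f := fun t => ν₁.real {ω | t ≤ f ω} - ν₂.real {ω | t ≤ f ω}) (by simp)
    fun t _ => h _ (hf measurableSet_Ici)
  simpa using key

variable [IsProbabilityMeasure μ] {a : ℝ}

/-- Covariance inequality for `[0,1]`-valued functions under strong mixing. -/
lemma abs_integral_mul_sub_le_of_unit (hm₁ : m₁ ≤ mΩ) (hm₂ : m₂ ≤ mΩ)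
    (h : ∀ A B, MeasurableSet[m₁] A → MeasurableSet[m₂] B →
      |μ.real (A ∩ B) - μ.real A * μ.real B| ≤ a) {f g : Ω → ℝ}
    (hf : Measurable[m₁] f) (hg : Measurable[m₂] g) (hf0 : ∀ ω, 0 ≤ f ω) (hf1 : ∀ ω, f ω ≤ 1)
    (hg0 : ∀ ω, 0 ≤ g ω) (hg1 : ∀ ω, g ω ≤ 1) :
    |∫ ω, f ω * g ω ∂μ - (∫ ω, f ω ∂μ) * ∫ ω, g ω ∂μ| ≤ a := by
  have hg' : Measurable g := hg.mono hm₂ le_rfl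
  have hgint : Integrable g μ := Integrable.of_bound hg'.aestronglyMeasurable 1
    (ae_of_all _ fun ω => by rw [Real.norm_eq_abs, abs_of_nonneg (hg0 ω)]; exact hg1 ω)
  have hgI : 0 ≤ ∫ ω, g ω ∂μ := integral_nonneg hg0
  -- The previous lemma is applied twice: here to g, comparing μ restricted to A with μ(A)μ; below
  -- to f, comparing the measure with density g to a multiple of μ.
  have hset : ∀ A, MeasurableSet[m₁] A →
      |∫ ω in A, g ω ∂μ - μ.real A * ∫ ω, g ω ∂μ| ≤ a := fun A hA => by
    have hfin : IsFiniteMeasure ((μ A) • μ) := Measure.smul_finite μ (measure_ne_top _ _)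
    have := abs_integral_sub_integral_le (ν₁ := μ.restrict A) (ν₂ := (μ A) • μ) hm₂ (a := a)
      (fun B hB => ?_) hg hg0 hg1
    · rwa [integral_smul_measure] at this
    · rw [measureReal_restrict_apply (hm₂ _ hB), Set.inter_comm]
      have e : ((μ A) • μ).real B = μ.real A * μ.real B := by
        simp [measureReal_def]
      rw [e]
      exact h A B hA hB
  have hfin : IsFiniteMeasure (μ.withDensity fun ω => ENNReal.ofReal (g ω)) :=
    isFiniteMeasure_withDensity_ofReal hgint.2
  have hfin' : IsFiniteMeasure ((ENNReal.ofReal (∫ ω, g ω ∂μ)) • μ) :=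
    Measure.smul_finite μ ENNReal.ofReal_ne_top
  have key := abs_integral_sub_integral_le
    (ν₁ := μ.withDensity fun ω => ENNReal.ofReal (g ω))
    (ν₂ := (ENNReal.ofReal (∫ ω, g ω ∂μ)) • μ) hm₁ (a := a) (fun A hA => ?_) hf hf0 hf1
  · rw [integral_smul_measure, integral_withDensity_eq_integral_toReal_smul
      hg'.ennreal_ofReal (ae_of_all _ fun ω => ENNReal.ofReal_lt_top)] at key
    simp only [ENNReal.toReal_ofReal (hg0 _), ENNReal.toReal_ofReal hgI, smul_eq_mul] at key
    simpa only [mul_comm] using key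
  · have e1 : (μ.withDensity fun ω => ENNReal.ofReal (g ω)).real A = ∫ ω in A, g ω ∂μ := by
      rw [measureReal_def, withDensity_apply _ (hm₁ _ hA),
        ← ofReal_integral_eq_lintegral_ofReal hgint.integrableOn (ae_of_all _ hg0),
        ENNReal.toReal_ofReal (integral_nonneg hg0)]
    have e2 : ((ENNReal.ofReal (∫ ω, g ω ∂μ)) • μ).real A = μ.real A * ∫ ω, g ω ∂μ := by
      simp [measureReal_def, hgI, mul_comm]
    rw [e1, e2]
    exact hset A hA

/-- Covariance inequality for bounded functions under strong mixing. -/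
lemma abs_integral_mul_sub_le_of_bounded (hm₁ : m₁ ≤ mΩ) (hm₂ : m₂ ≤ mΩ)
    (h : ∀ A B, MeasurableSet[m₁] A → MeasurableSet[m₂] B →
      |μ.real (A ∩ B) - μ.real A * μ.real B| ≤ a) {f g : Ω → ℝ} {H : ℝ} (hH : 0 < H)
    (hf : Measurable[m₁] f) (hg : Measurable[m₂] g) (hfH : ∀ ω, |f ω| ≤ H)
    (hgH : ∀ ω, |g ω| ≤ H) :
    |∫ ω, f ω * g ω ∂μ - (∫ ω, f ω ∂μ) * ∫ ω, g ω ∂μ| ≤ 4 * a * H ^ 2 := by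
  have hf' : Measurable f := hf.mono hm₁ le_rfl
  have hg' : Measurable g := hg.mono hm₂ le_rfl
  -- The affine map from [-H, H] to [0, 1] scales each factor by 1/(2H), hence the 4H² in the
  -- result.
  have key := abs_integral_mul_sub_le_of_unit (μ := μ) hm₁ hm₂ h
    (f := fun ω => (f ω + H) / (2 * H)) (g := fun ω => (g ω + H) / (2 * H))
    ((hf.add_const H).div_const _) ((hg.add_const H).div_const _)
    (fun ω => div_nonneg (by linarith [(abs_le.1 (hfH ω)).1]) (by positivity))
    (fun ω => (div_le_one (by positivity)).2 (by linarith [(abs_le.1 (hfH ω)).2]))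
    (fun ω => div_nonneg (by linarith [(abs_le.1 (hgH ω)).1]) (by positivity))
    (fun ω => (div_le_one (by positivity)).2 (by linarith [(abs_le.1 (hgH ω)).2]))
  have fi : Integrable f μ := Integrable.of_bound hf'.aestronglyMeasurable H
    (ae_of_all _ fun ω => hfH ω)
  have gi : Integrable g μ := Integrable.of_bound hg'.aestronglyMeasurable H
    (ae_of_all _ fun ω => hgH ω)
  have fgi : Integrable (fun ω => f ω * g ω) μ :=
    Integrable.of_bound (hf'.mul hg').aestronglyMeasurable (H * H)
    (ae_of_all _ fun ω => by
      rw [Real.norm_eq_abs, abs_mul]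
      exact mul_le_mul (hfH ω) (hgH ω) (abs_nonneg _) hH.le)
  have e1 : ∫ ω, (f ω + H) / (2 * H) * ((g ω + H) / (2 * H)) ∂μ =
      (∫ ω, f ω * g ω ∂μ + H * ∫ ω, f ω ∂μ + H * ∫ ω, g ω ∂μ + H ^ 2) / (4 * H ^ 2) := by
    have : ∀ ω, (f ω + H) / (2 * H) * ((g ω + H) / (2 * H)) =
        (f ω * g ω + H * f ω + H * g ω + H ^ 2) / (4 * H ^ 2) := fun ω => by field_simp; ring
    simp_rw [this]
    have i1 : Integrable (fun ω => f ω * g ω + H * f ω) μ := fgi.add (fi.const_mul H)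
    have i2 : Integrable (fun ω => f ω * g ω + H * f ω + H * g ω) μ := i1.add (gi.const_mul H)
    rw [integral_div, integral_add i2 (integrable_const _), integral_add i1 (gi.const_mul H),
      integral_add fgi (fi.const_mul H), integral_const_mul, integral_const_mul]
    simp
  have e2 : ∀ {u : Ω → ℝ}, Integrable u μ →
      ∫ ω, (u ω + H) / (2 * H) ∂μ = (∫ ω, u ω ∂μ + H) / (2 * H) := fun hu => by
    rw [integral_div, integral_add hu (integrable_const _)]
    simp
  rw [e1, e2 fi, e2 gi] at key
  set I := ∫ ω, f ω * g ω ∂μ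
  set If := ∫ ω, f ω ∂μ
  set Ig := ∫ ω, g ω ∂μ
  have e3 : (I + H * If + H * Ig + H ^ 2) / (4 * H ^ 2) - (If + H) / (2 * H) * ((Ig + H) / (2 * H))
      = (I - If * Ig) / (4 * H ^ 2) := by field_simp; ring
  rw [e3, abs_div, abs_of_pos (show 0 < 4 * H ^ 2 by positivity), div_le_iff₀ (by positivity)]
    at key
  linarith

/-- Truncation at level `H`. -/
def clip (H x : ℝ) : ℝ := max (-H) (min x H)

lemma abs_clip_le {H : ℝ} (hH : 0 ≤ H) (x : ℝ) : |clip H x| ≤ H :=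
  abs_le.2 ⟨le_max_left _ _, max_le (by linarith) (min_le_right _ _)⟩

lemma clip_eq_self {H x : ℝ} (h : |x| ≤ H) : clip H x = x := by
  rw [clip, min_eq_left (abs_le.1 h).2, max_eq_right (abs_le.1 h).1]

lemma abs_clip_le_abs {H : ℝ} (hH : 0 ≤ H) (x : ℝ) : |clip H x| ≤ |x| := by
  rcases le_total |x| H with h | h
  · rw [clip_eq_self h]
  · exact (abs_clip_le hH x).trans h

/-- The difference vanishes when |x| ≤ H and is otherwise at most |x| ≤ |x|(|x|/H)^p. -/
lemma abs_sub_clip_le {H : ℝ} (hH : 0 < H) (x : ℝ) (p : ℕ) :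
    |x - clip H x| ≤ |x| ^ (p + 1) / H ^ p := by
  rcases le_total |x| H with h | h
  · rw [clip_eq_self h]; simp; positivity
  · have h1 : |x - clip H x| ≤ |x| := by
      rcases le_total 0 x with hx | hx
      · rw [abs_of_nonneg hx] at h ⊢
        rw [clip, min_eq_right h, max_eq_right (by linarith), abs_of_nonneg (by linarith)]
        linarith
      · rw [abs_of_nonpos hx] at h ⊢
        rw [clip, min_eq_left (by linarith), max_eq_left (by linarith), abs_of_nonpos (by linarith)]
        linarith
    refine h1.trans ?_
    rw [le_div_iff₀ (by positivity), pow_succ, mul_comm]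
    gcongr

lemma measurable_clip (H : ℝ) : Measurable (clip H) :=
  measurable_const.max (measurable_id.min measurable_const)

lemma sq_le_one_add_pow_four (x : ℝ) : x ^ 2 ≤ 1 + x ^ 4 := by
  nlinarith [sq_nonneg (x ^ 2 - 1), sq_nonneg (x ^ 2)]

lemma abs_le_one_add_pow_four (x : ℝ) : |x| ≤ 1 + x ^ 4 := by
  have h := sq_le_one_add_pow_four x
  rw [← sq_abs] at h
  rw [← Even.pow_abs (by decide : Even 4)] at h ⊢
  nlinarith [sq_nonneg (|x| - 1), sq_nonneg (|x| ^ 2 - 1)]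

lemma sq_mul_abs_le (x y : ℝ) : x ^ 2 * |y| ≤ 1 + x ^ 4 + y ^ 4 := by
  have h := sq_le_one_add_pow_four y
  nlinarith [sq_nonneg (x ^ 2 - |y|), sq_abs y, sq_nonneg (x ^ 2), sq_nonneg (y ^ 2 - 1)]

/-- Covariance inequality under strong mixing for functions with bounded fourth moments. -/
lemma abs_integral_mul_sub_le_of_moments (hm₁ : m₁ ≤ mΩ) (hm₂ : m₂ ≤ mΩ) (ha : 0 < a)
    (h : ∀ A B, MeasurableSet[m₁] A → MeasurableSet[m₂] B →
      |μ.real (A ∩ B) - μ.real A * μ.real B| ≤ a) {f g : Ω → ℝ} {κ : ℝ}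
    (hf : Measurable[m₁] f) (hg : Measurable[m₂] g)
    (hf4 : Integrable (fun ω => f ω ^ 4) μ) (hg4 : Integrable (fun ω => g ω ^ 4) μ)
    (hfκ : ∫ ω, f ω ^ 4 ∂μ ≤ κ) (hgκ : ∫ ω, g ω ^ 4 ∂μ ≤ κ) :
    |∫ ω, f ω * g ω ∂μ - (∫ ω, f ω ∂μ) * ∫ ω, g ω ∂μ| ≤
      (4 + 2 * (1 + 2 * κ) + 2 * (1 + κ) ^ 2) * a ^ (1 / 3 : ℝ) := by
  -- This level balances the bounded-case error aH² against the truncation error 1/H; both become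
  -- a^{1/3}.
  set H : ℝ := a ^ (-(1 / 3) : ℝ) with hHdef
  have hH : 0 < H := Real.rpow_pos_of_pos ha _
  have hf' : Measurable f := hf.mono hm₁ le_rfl
  have hg' : Measurable g := hg.mono hm₂ le_rfl
  have hκ : 0 ≤ κ := (integral_nonneg fun ω => by positivity).trans hfκ
  have hcf := (measurable_clip H).comp hf
  have hcg := (measurable_clip H).comp hg
  have key := abs_integral_mul_sub_le_of_bounded (μ := μ) hm₁ hm₂ h hH hcf hcg
    (fun ω => abs_clip_le hH.le _) (fun ω => abs_clip_le hH.le _)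
  simp only [Function.comp_def] at key
  have hdom1 : ∀ {u : Ω → ℝ}, Measurable u → Integrable (fun ω => u ω ^ 4) μ →
      Integrable u μ := fun {u} hu hu4 => by
    refine ((integrable_const (1 : ℝ)).add hu4).mono' hu.aestronglyMeasurable
      (ae_of_all _ fun ω => ?_)
    simp only [Real.norm_eq_abs, Pi.add_apply]
    exact abs_le_one_add_pow_four _
  have fi := hdom1 hf' hf4
  have gi := hdom1 hg' hg4
  have hI1 : ∀ {u : Ω → ℝ}, Integrable (fun ω => u ω ^ 4) μ → ∫ ω, u ω ^ 4 ∂μ ≤ κ →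
      ∫ ω, (1 + u ω ^ 4) ∂μ ≤ 1 + κ := fun hu hk => by
    rw [integral_add (integrable_const _) hu]; simpa using hk
  have hfc : Measurable fun ω => clip H (f ω) := (measurable_clip H).comp hf'
  have hgc : Measurable fun ω => clip H (g ω) := (measurable_clip H).comp hg'
  have fci : Integrable (fun ω => clip H (f ω)) μ := Integrable.of_bound hfc.aestronglyMeasurable H
    (ae_of_all _ fun ω => abs_clip_le hH.le _)
  have gci : Integrable (fun ω => clip H (g ω)) μ := Integrable.of_bound hgc.aestronglyMeasurable H
    (ae_of_all _ fun ω => abs_clip_le hH.le _)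
  have hmean : ∀ {u : Ω → ℝ}, Integrable (fun ω => u ω ^ 4) μ → ∫ ω, u ω ^ 4 ∂μ ≤ κ →
      |∫ ω, u ω ∂μ| ≤ 1 + κ := fun {u} hu4 hk => by
    refine (abs_integral_le_integral_abs).trans ((integral_mono_of_nonneg
      (ae_of_all _ fun ω => abs_nonneg _) ((integrable_const _).add hu4)
      (ae_of_all _ fun ω => abs_le_one_add_pow_four (u ω))).trans (hI1 hu4 hk))
  have hmeanc : ∀ {u : Ω → ℝ}, Integrable (fun ω => u ω ^ 4) μ → ∫ ω, u ω ^ 4 ∂μ ≤ κ →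
      |∫ ω, clip H (u ω) ∂μ| ≤ 1 + κ := fun {u} hu4 hk => by
    refine (abs_integral_le_integral_abs).trans ((integral_mono_of_nonneg
      (ae_of_all _ fun ω => abs_nonneg _) ((integrable_const _).add hu4)
      (ae_of_all _ fun ω => (abs_clip_le_abs hH.le _).trans
        (abs_le_one_add_pow_four (u ω)))).trans (hI1 hu4 hk))
  have hdiff : ∀ {u : Ω → ℝ}, Measurable u → Integrable (fun ω => u ω ^ 4) μ →
      ∫ ω, u ω ^ 4 ∂μ ≤ κ →
      |∫ ω, u ω ∂μ - ∫ ω, clip H (u ω) ∂μ| ≤ (1 + κ) / H := fun {u} hu hu4 hk => by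
    have uci : Integrable (fun ω => clip H (u ω)) μ :=
      Integrable.of_bound ((measurable_clip H).comp hu).aestronglyMeasurable H
        (ae_of_all _ fun ω => abs_clip_le hH.le _)
    rw [← integral_sub (hdom1 hu hu4) uci]
    refine (abs_integral_le_integral_abs).trans ((integral_mono_of_nonneg
      (ae_of_all _ fun ω => abs_nonneg _) (((integrable_const (1 : ℝ)).add hu4).div_const H)
      (ae_of_all _ fun ω => ?_)).trans ?_)
    · refine (abs_sub_clip_le hH (u ω) 1).trans ?_
      simp only [pow_one, Pi.add_apply, sq_abs, Nat.reduceAdd]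
      gcongr
      exact sq_le_one_add_pow_four _
    · simp only [Pi.add_apply]
      rw [integral_div]
      gcongr
      exact hI1 hu4 hk
  have fgi : Integrable (fun ω => f ω * g ω) μ := by
    refine (((integrable_const (1 : ℝ)).add hf4).add hg4).mono' (hf'.mul hg').aestronglyMeasurable
      (ae_of_all _ fun ω => ?_)
    simp only [Real.norm_eq_abs, Pi.add_apply, abs_mul]
    have e1 := sq_le_one_add_pow_four (f ω)
    have e2 := sq_le_one_add_pow_four (g ω)
    nlinarith [sq_nonneg (|f ω| - |g ω|), sq_abs (f ω), sq_abs (g ω), sq_nonneg (f ω ^ 2),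
      sq_nonneg (g ω ^ 2), sq_nonneg (f ω ^ 2 - 1), sq_nonneg (g ω ^ 2 - 1)]
  have fgci : Integrable (fun ω => clip H (f ω) * clip H (g ω)) μ :=
    Integrable.of_bound (hfc.mul hgc).aestronglyMeasurable (H * H) (ae_of_all _ fun ω => by
      rw [Real.norm_eq_abs, abs_mul]
      exact mul_le_mul (abs_clip_le hH.le _) (abs_clip_le hH.le _) (abs_nonneg _) hH.le)
  have hprod : |∫ ω, f ω * g ω ∂μ - ∫ ω, clip H (f ω) * clip H (g ω) ∂μ| ≤
      2 * (1 + 2 * κ) / H := by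
    rw [← integral_sub fgi fgci]
    refine (abs_integral_le_integral_abs).trans ((integral_mono_of_nonneg
      (ae_of_all _ fun ω => abs_nonneg _)
      (((((integrable_const (1 : ℝ)).add hf4).add hg4).const_mul 2).div_const H)
      (ae_of_all _ fun ω => ?_)).trans ?_)
    · have e1 := abs_sub_clip_le hH (f ω) 1
      have e2 := abs_sub_clip_le hH (g ω) 1
      have e3 := abs_clip_le_abs hH.le (f ω)
      simp only [pow_one, Nat.reduceAdd, sq_abs] at e1 e2
      simp only [Pi.add_apply]
      calc |f ω * g ω - clip H (f ω) * clip H (g ω)|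
          = |(f ω - clip H (f ω)) * g ω + clip H (f ω) * (g ω - clip H (g ω))| := by ring_nf
        _ ≤ |f ω - clip H (f ω)| * |g ω| + |clip H (f ω)| * |g ω - clip H (g ω)| := by
          rw [← abs_mul, ← abs_mul]; exact abs_add_le _ _
        _ ≤ f ω ^ 2 / H * |g ω| + |f ω| * (g ω ^ 2 / H) := by gcongr
        _ = (f ω ^ 2 * |g ω| + g ω ^ 2 * |f ω|) / H := by ring
        _ ≤ _ := by
          gcongr
          linarith [sq_mul_abs_le (f ω) (g ω), sq_mul_abs_le (g ω) (f ω)]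
    · simp only [Pi.add_apply]
      rw [integral_div, integral_const_mul]
      gcongr
      have i1 : Integrable (fun ω => 1 + f ω ^ 4) μ := (integrable_const _).add hf4
      rw [integral_add i1 hg4]
      linarith [hI1 hf4 hfκ]
  have hHsq : a * H ^ 2 = a ^ (1 / 3 : ℝ) := by
    rw [hHdef, ← Real.rpow_natCast, ← Real.rpow_mul ha.le]
    nth_rewrite 1 [← Real.rpow_one a]
    rw [← Real.rpow_add ha]; norm_num
  have hHinv : 1 / H = a ^ (1 / 3 : ℝ) := by
    rw [hHdef, Real.rpow_neg ha.le]; simp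
  set I := ∫ ω, f ω * g ω ∂μ
  set Ic := ∫ ω, clip H (f ω) * clip H (g ω) ∂μ
  have d1 := hdiff hf' hf4 hfκ
  have d2 := hdiff hg' hg4 hgκ
  have m1 := hmean hg4 hgκ
  have m2 := hmeanc hf4 hfκ
  set F := ∫ ω, f ω ∂μ
  set Fc := ∫ ω, clip H (f ω) ∂μ
  set G := ∫ ω, g ω ∂μ
  set Gc := ∫ ω, clip H (g ω) ∂μ
  have hFG : |F * G - Fc * Gc| ≤ 2 * (1 + κ) ^ 2 / H := by
    calc |F * G - Fc * Gc| = |(F - Fc) * G + Fc * (G - Gc)| := by ring_nf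
      _ ≤ |F - Fc| * |G| + |Fc| * |G - Gc| := by
        rw [← abs_mul, ← abs_mul]; exact abs_add_le _ _
      _ ≤ (1 + κ) / H * (1 + κ) + (1 + κ) * ((1 + κ) / H) := by gcongr
      _ = _ := by ring
  have hfin : |I - F * G| ≤ 2 * (1 + 2 * κ) / H + 4 * a * H ^ 2 + 2 * (1 + κ) ^ 2 / H := by
    calc |I - F * G| = |(I - Ic) + (Ic - Fc * Gc) - (F * G - Fc * Gc)| := by ring_nf
      _ ≤ |I - Ic| + |Ic - Fc * Gc| + |F * G - Fc * Gc| := by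
        refine (abs_sub _ _).trans ?_
        gcongr
        exact abs_add_le _ _
      _ ≤ _ := by gcongr
  refine hfin.trans (le_of_eq ?_)
  rw [div_eq_mul_one_div, div_eq_mul_one_div (2 * (1 + κ) ^ 2), hHinv, mul_assoc 4 a, hHsq]
  ring

end MixingCovariance

/-! ### Exponential inequality for nearly independent blocks -/

section Blocks

variable {Ω : Type*} [mΩ : MeasurableSpace Ω] {μ : Measure Ω} [IsProbabilityMeasure μ]

/-- Exponential moment of a bounded centred random variable. -/
lemma integral_exp_mul_le {S : Ω → ℝ} (hS : Measurable S) {b v l : ℝ} (hb : ∀ ω, |S ω| ≤ b)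
    (h0 : ∫ ω, S ω ∂μ = 0) (hv : ∫ ω, S ω ^ 2 ∂μ ≤ v) (hl : 0 ≤ l) (hlb : l * b ≤ 1) :
    ∫ ω, Real.exp (l * S ω) ∂μ ≤ Real.exp (l ^ 2 * v) := by
  have hSi : Integrable S μ := Integrable.of_bound hS.aestronglyMeasurable b (ae_of_all _ hb)
  have hS2 : Integrable (fun ω => S ω ^ 2) μ := by
    refine Integrable.of_bound (hS.pow_const 2).aestronglyMeasurable (b ^ 2) (ae_of_all _ fun ω => ?_)
    rw [Real.norm_eq_abs, abs_pow]
    gcongr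
    exact hb ω
  -- The inequality e^x ≤ 1 + x + x², valid for |x| ≤ 1, which is where lb ≤ 1 is needed.
  have hle : ∀ ω, Real.exp (l * S ω) ≤ 1 + l * S ω + l ^ 2 * S ω ^ 2 := fun ω => by
    have h1 : |l * S ω| ≤ 1 := by
      rw [abs_mul, abs_of_nonneg hl]
      exact (mul_le_mul_of_nonneg_left (hb ω) hl).trans hlb
    have h2 := (abs_le.1 (Real.abs_exp_sub_one_sub_id_le h1)).2
    nlinarith
  have i1 : Integrable (fun ω => 1 + l * S ω) μ := (integrable_const _).add (hSi.const_mul l)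
  have i2 : Integrable (fun ω => 1 + l * S ω + l ^ 2 * S ω ^ 2) μ := i1.add (hS2.const_mul _)
  calc ∫ ω, Real.exp (l * S ω) ∂μ ≤ ∫ ω, (1 + l * S ω + l ^ 2 * S ω ^ 2) ∂μ :=
        integral_mono_of_nonneg (ae_of_all _ fun ω => (Real.exp_pos _).le) i2 (ae_of_all _ hle)
    _ = 1 + l ^ 2 * ∫ ω, S ω ^ 2 ∂μ := by
        rw [integral_add i1 (hS2.const_mul _), integral_add (integrable_const _) (hSi.const_mul l),
          integral_const_mul, integral_const_mul, h0]
        simp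
    _ ≤ 1 + l ^ 2 * v := by gcongr
    _ ≤ Real.exp (l ^ 2 * v) := by linarith [Real.add_one_le_exp (l ^ 2 * v)]

/-- Replacement of an almost independent integer-valued variable by an independent copy. -/
lemma integral_add_int_le {Ω : Type*} {P F : MeasurableSpace Ω} [mΩ : MeasurableSpace Ω]
    {μ : Measure Ω} [IsProbabilityMeasure μ] (hP : P ≤ mΩ) (hF : F ≤ mΩ) {a : ℝ}
    (h : ∀ A B, MeasurableSet[P] A → MeasurableSet[F] B →
      |μ.real (A ∩ B) - μ.real A * μ.real B| ≤ a) {W : Ω → ℝ} {J : Ω → ℤ}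
    (hW : Measurable[P] W) (hJ : Measurable[F] J) {s : Finset ℤ} (hs : ∀ ω, J ω ∈ s) {δ : ℝ}
    {φ : ℝ → ℝ} (hφ : Measurable φ) (h0 : ∀ v, 0 ≤ φ v) (h1 : ∀ v, φ v ≤ 1) :
    ∫ ω, φ (W ω + δ * J ω) ∂μ ≤
      ∫ ω, ∑ j ∈ s, μ.real {ω' | J ω' = j} * φ (W ω + δ * j) ∂μ + s.card * a := by
  have hW' : @Measurable _ _ mΩ _ W := hW.mono hP le_rfl
  have hJset : ∀ j, MeasurableSet[F] {ω | J ω = j} := fun j => hJ (measurableSet_singleton j)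
  -- Because J takes finitely many values, the expectation splits over the events J = j, and the
  -- covariance inequality costs a on each; this is why the blocks are rounded to a grid.
  set g : ℤ → Ω → ℝ := fun j => {ω | J ω = j}.indicator 1 with hg
  have hgm : ∀ j, Measurable[F] (g j) := fun j =>
    Measurable.indicator (f := fun _ => (1 : ℝ)) measurable_const (hJset j)
  have hg0 : ∀ j ω, 0 ≤ g j ω := fun j ω => Set.indicator_nonneg (fun _ _ => zero_le_one) ω
  have hg1 : ∀ j ω, g j ω ≤ 1 := fun j ω => Set.indicator_le_self' (fun _ _ => zero_le_one) ω
  have hgI : ∀ j, ∫ ω, g j ω ∂μ = μ.real {ω | J ω = j} := fun j =>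
    integral_indicator_one (hF _ (hJset j))
  have hφj : ∀ j : ℤ, Measurable[P] fun ω => φ (W ω + δ * j) := fun j =>
    hφ.comp (hW.add_const _)
  have hφi : ∀ j : ℤ, Integrable (fun ω => φ (W ω + δ * j)) μ := fun j =>
    Integrable.of_bound ((hφj j).mono hP le_rfl).aestronglyMeasurable 1
      (ae_of_all _ fun ω => by rw [Real.norm_eq_abs, abs_of_nonneg (h0 _)]; exact h1 _)
  have hprodi : ∀ j : ℤ, Integrable (fun ω => φ (W ω + δ * j) * g j ω) μ := fun j =>
    Integrable.of_bound
      (((hφj j).mono hP le_rfl).mul ((hgm j).mono hF le_rfl)).aestronglyMeasurable 1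
      (ae_of_all _ fun ω => by
        rw [Real.norm_eq_abs, abs_of_nonneg (mul_nonneg (h0 _) (hg0 _ _))]
        exact mul_le_one₀ (h1 _) (hg0 _ _) (hg1 _ _))
  have hdec : ∀ ω, φ (W ω + δ * J ω) = ∑ j ∈ s, φ (W ω + δ * j) * g j ω := fun ω => by
    rw [Finset.sum_eq_single_of_mem (J ω) (hs ω)]
    · simp [hg]
    · intro j _ hj
      simp [hg, hj.symm]
  calc ∫ ω, φ (W ω + δ * J ω) ∂μ = ∑ j ∈ s, ∫ ω, φ (W ω + δ * j) * g j ω ∂μ := by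
        simp_rw [hdec]
        exact integral_finsetSum _ fun j _ => hprodi j
    _ ≤ ∑ j ∈ s, ((∫ ω, φ (W ω + δ * j) ∂μ) * μ.real {ω' | J ω' = j} + a) := by
        refine Finset.sum_le_sum fun j _ => ?_
        have := abs_integral_mul_sub_le_of_unit hP hF h (hφj j) (hgm j) (fun _ => h0 _)
          (fun _ => h1 _) (hg0 j) (hg1 j)
        rw [hgI] at this
        linarith [(abs_le.1 this).2]
    _ = _ := by
        rw [Finset.sum_add_distrib, integral_finsetSum _ fun j _ => (hφi j).const_mul _]
        simp only [integral_const_mul, Finset.sum_const, nsmul_eq_mul]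
        congr 1
        exact Finset.sum_congr rfl fun j _ => mul_comm _ _

/-- Exponential inequality for sums of almost independent bounded blocks. -/
lemma integral_comp_sum_floor_le {P F : ℕ → MeasurableSpace Ω} (hP : ∀ k, P k ≤ mΩ)
    (hF : ∀ k, F k ≤ mΩ) {a : ℝ}
    (h : ∀ k A B, MeasurableSet[P k] A → MeasurableSet[F k] B →
      |μ.real (A ∩ B) - μ.real A * μ.real B| ≤ a) {S : ℕ → Ω → ℝ}
    (hSP : ∀ j k, j < k → Measurable[P k] (S j)) (hSF : ∀ k, Measurable[F k] (S k))
    {b l δ x : ℝ} {v : ℕ → ℝ} (hb : ∀ k ω, |S k ω| ≤ b) (hS0 : ∀ k, ∫ ω, S k ω ∂μ = 0)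
    (hv : ∀ k, ∫ ω, S k ω ^ 2 ∂μ ≤ v k) (hl : 0 ≤ l) (hlb : l * b ≤ 1) (hδ : 0 < δ)
    {s : Finset ℤ} (hs : ∀ k ω, ⌊S k ω / δ⌋ ∈ s) (M : ℕ) :
    ∀ {φ : ℝ → ℝ} {c : ℝ}, Measurable φ → (∀ w, 0 ≤ φ w) → (∀ w, φ w ≤ 1) → 0 ≤ c →
      (∀ w, φ w ≤ c * Real.exp (l * (w - x))) →
      ∫ ω, φ (∑ k ∈ Finset.range M, δ * ⌊S k ω / δ⌋) ∂μ ≤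
        c * Real.exp (-(l * x) + l ^ 2 * ∑ k ∈ Finset.range M, v k) + M * (s.card * a) := by
  have hJF : ∀ k, Measurable[F k] fun ω => ⌊S k ω / δ⌋ := fun k =>
    Int.measurable_floor.comp ((hSF k).div_const δ)
  -- The induction runs over all test functions with an exponential envelope: integrating out the
  -- last block maps φ to ψ, whose envelope has the same shape and a constant larger by exp(l² v).
  induction M with
  | zero =>
    intro φ c hφ h0 h1 hc hφc
    have := hφc 0
    simpa using this
  | succ M ih =>
    intro φ c hφ h0 h1 hc hφc
    set J : Ω → ℤ := fun ω => ⌊S M ω / δ⌋ with hJ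
    set W : Ω → ℝ := fun ω => ∑ k ∈ Finset.range M, δ * ⌊S k ω / δ⌋ with hW
    have hWm : Measurable[P M] W := by
      refine Finset.measurable_fun_sum _ fun k hk => ?_
      have h1 : Measurable[P M] fun ω => ⌊S k ω / δ⌋ :=
        Int.measurable_floor.comp ((hSP k M (Finset.mem_range.1 hk)).div_const δ)
      exact ((measurable_from_top (f := fun j : ℤ => (j : ℝ))).comp h1).const_mul δ
    have step := integral_add_int_le (hP M) (hF M) (h M) hWm (hJF M) (hs M) (δ := δ) hφ h0 h1
    set ψ : ℝ → ℝ := fun w => ∑ j ∈ s, μ.real {ω' | J ω' = j} * φ (w + δ * j) with hψ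
    have hpsum : ∑ j ∈ s, μ.real {ω' | J ω' = j} = 1 := by
      have hd : (Finset.univ : Finset Unit).card = 1 := rfl
      have hmeas : ∀ j, MeasurableSet {ω' | J ω' = j} := fun j =>
        (hF M) _ (hJF M (measurableSet_singleton j))
      rw [← measureReal_biUnion_finset (f := fun j => {ω' | J ω' = j})]
      · have : (⋃ j ∈ s, {ω' | J ω' = j}) = Set.univ := by
          ext ω; simpa using hs M ω
        rw [this]; simp
      · intro i _ j _ hij
        exact Set.disjoint_left.2 fun ω h1 h2 => hij (h1.symm.trans h2)
      · exact fun j _ => hmeas j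
    -- Rounding down can only decrease the exponential moment since l ≥ 0, so the bound for the
    -- original block applies.
    have hexp : ∑ j ∈ s, μ.real {ω' | J ω' = j} * Real.exp (l * (δ * j)) ≤
        Real.exp (l ^ 2 * v M) := by
      have hSm : Measurable (S M) := (hSF M).mono (hF M) le_rfl
      have hmeas : ∀ j, MeasurableSet {ω' | J ω' = j} := fun j =>
        (hF M) _ (hJF M (measurableSet_singleton j))
      have e1 : ∫ ω, ∑ j ∈ s, {ω' | J ω' = j}.indicator (fun _ => Real.exp (l * (δ * j))) ω ∂μ =
          ∑ j ∈ s, μ.real {ω' | J ω' = j} * Real.exp (l * (δ * j)) := by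
        rw [integral_finsetSum _ fun j _ => (integrable_const _).indicator (hmeas j)]
        refine Finset.sum_congr rfl fun j _ => ?_
        rw [integral_indicator_const _ (hmeas j), smul_eq_mul]
      rw [← e1]
      refine le_trans (integral_mono_of_nonneg (ae_of_all _ fun ω => ?_) ?_
        (ae_of_all _ fun ω => ?_))
        (integral_exp_mul_le hSm (hb M) (hS0 M) (hv M) hl hlb)
      · exact Finset.sum_nonneg fun j _ => Set.indicator_nonneg (fun _ _ => (Real.exp_pos _).le) ω
      · refine Integrable.of_bound
          (Real.measurable_exp.comp (hSm.const_mul l)).aestronglyMeasurable (Real.exp (l * b))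
          (ae_of_all _ fun ω => ?_)
        rw [Real.norm_eq_abs, Real.abs_exp]
        exact Real.exp_le_exp.2 (mul_le_mul_of_nonneg_left ((le_abs_self _).trans (hb M ω)) hl)
      · simp only
        rw [Finset.sum_eq_single_of_mem (J ω) (hs M ω)]
        · simp only [Set.indicator, Set.mem_ofPred_eq, if_true]
          refine Real.exp_le_exp.2 (mul_le_mul_of_nonneg_left ?_ hl)
          have := Int.floor_le (S M ω / δ)
          rw [le_div_iff₀ hδ] at this
          rw [mul_comm]; exact this
        · intro j _ hj
          simp [Set.indicator, hj.symm]
    have hψm : Measurable ψ :=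
      Finset.measurable_fun_sum _ fun j _ => (hφ.comp (measurable_id.add_const _)).const_mul _
    have hψ0 : ∀ w, 0 ≤ ψ w := fun w =>
      Finset.sum_nonneg fun j _ => mul_nonneg measureReal_nonneg (h0 _)
    have hψ1 : ∀ w, ψ w ≤ 1 := fun w => by
      rw [← hpsum]
      exact Finset.sum_le_sum fun j _ => mul_le_of_le_one_right measureReal_nonneg (h1 _)
    have hψc : ∀ w, ψ w ≤ c * Real.exp (l ^ 2 * v M) * Real.exp (l * (w - x)) := fun w => by
      calc ψ w ≤ ∑ j ∈ s, μ.real {ω' | J ω' = j} * (c * Real.exp (l * (w + δ * j - x))) :=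
            Finset.sum_le_sum fun j _ => mul_le_mul_of_nonneg_left (hφc _) measureReal_nonneg
        _ = c * Real.exp (l * (w - x)) *
            ∑ j ∈ s, μ.real {ω' | J ω' = j} * Real.exp (l * (δ * j)) := by
          rw [Finset.mul_sum]
          refine Finset.sum_congr rfl fun j _ => ?_
          rw [show l * (w + δ * j - x) = l * (w - x) + l * (δ * j) by ring, Real.exp_add]
          ring
        _ ≤ c * Real.exp (l * (w - x)) * Real.exp (l ^ 2 * v M) := by gcongr
        _ = _ := by ring
    have hih := ih hψm hψ0 hψ1 (by positivity) hψc
    have e : ∀ ω, ∑ k ∈ Finset.range (M + 1), δ * (⌊S k ω / δ⌋ : ℝ) = W ω + δ * J ω := fun ω => by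
      rw [Finset.sum_range_succ]
    simp_rw [e]
    refine step.trans ((add_le_add_left hih _).trans (le_of_eq ?_))
    rw [Finset.sum_range_succ, mul_add (l ^ 2), ← add_assoc, Real.exp_add _ (l ^ 2 * v M)]
    push_cast
    ring

/-- Bernstein-type inequality for sums of almost independent bounded blocks. -/
lemma measureReal_sum_blocks_le {P F : ℕ → MeasurableSpace Ω} (hP : ∀ k, P k ≤ mΩ)
    (hF : ∀ k, F k ≤ mΩ) {a : ℝ}
    (h : ∀ k A B, MeasurableSet[P k] A → MeasurableSet[F k] B →
      |μ.real (A ∩ B) - μ.real A * μ.real B| ≤ a) {S : ℕ → Ω → ℝ}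
    (hSP : ∀ j k, j < k → Measurable[P k] (S j)) (hSF : ∀ k, Measurable[F k] (S k))
    {b l δ x : ℝ} {v : ℕ → ℝ} (hb : ∀ k ω, |S k ω| ≤ b) (hS0 : ∀ k, ∫ ω, S k ω ∂μ = 0)
    (hv : ∀ k, ∫ ω, S k ω ^ 2 ∂μ ≤ v k) (hl : 0 ≤ l) (hlb : l * b ≤ 1) (hδ : 0 < δ)
    (ha : 0 ≤ a) (M : ℕ) :
    μ.real {ω | x + M * δ < ∑ k ∈ Finset.range M, S k ω} ≤
      Real.exp (-(l * x) + l ^ 2 * ∑ k ∈ Finset.range M, v k) + M * ((2 * (b / δ) + 5) * a) := by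
  have hb0 : 0 ≤ b := by
    obtain ⟨ω⟩ : Nonempty Ω := μ.nonempty_of_neZero
    exact (abs_nonneg _).trans (hb 0 ω)
  set s : Finset ℤ := Finset.Icc (-(⌈b / δ⌉ + 1)) (⌈b / δ⌉) with hs
  have hsmem : ∀ k ω, ⌊S k ω / δ⌋ ∈ s := fun k ω => by
    have h1 : |S k ω / δ| ≤ b / δ := by
      rw [abs_div, abs_of_pos hδ]; gcongr; exact hb k ω
    have h2 := abs_le.1 h1
    rw [hs, Finset.mem_Icc]
    constructor
    · rw [Int.le_floor]
      push_cast
      linarith [Int.le_ceil (b / δ)]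
    · have := (Int.floor_le (S k ω / δ)).trans (h2.2.trans (Int.le_ceil (b / δ)))
      exact_mod_cast this
  have hcard : (s.card : ℝ) ≤ 2 * (b / δ) + 5 := by
    have h0 : 0 ≤ ⌈b / δ⌉ := Int.ceil_nonneg (by positivity)
    have h1 : (s.card : ℤ) = 2 * ⌈b / δ⌉ + 2 := by
      rw [hs, Int.card_Icc]
      omega
    have h2 : (s.card : ℝ) = 2 * (⌈b / δ⌉ : ℝ) + 2 := by exact_mod_cast h1
    linarith [Int.ceil_lt_add_one (b / δ)]
  -- Chernoff's bound: the indicator of w > x is at most exp(l(w - x)).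
  set φ : ℝ → ℝ := (Set.Ioi x).indicator 1 with hφ
  have hφm : Measurable φ := measurable_one.indicator measurableSet_Ioi
  have key := integral_comp_sum_floor_le hP hF h hSP hSF hb hS0 hv hl hlb hδ hsmem M (x := x)
    hφm (fun w => Set.indicator_nonneg (fun _ _ => zero_le_one) w)
    (fun w => Set.indicator_le_self' (fun _ _ => zero_le_one) w) zero_le_one (fun w => by
      rw [one_mul]
      by_cases hw : x < w
      · simp only [hφ, Set.indicator, Set.mem_Ioi, hw, if_true, Pi.one_apply]
        exact Real.one_le_exp (mul_nonneg hl (by linarith))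
      · simp only [hφ, Set.indicator, Set.mem_Ioi, hw, if_false]
        exact (Real.exp_pos _).le)
  rw [one_mul] at key
  have hSm : ∀ k, Measurable (S k) := fun k => (hSF k).mono (hF k) le_rfl
  have hUm : Measurable fun ω => ∑ k ∈ Finset.range M, δ * (⌊S k ω / δ⌋ : ℝ) := by
    refine Finset.measurable_fun_sum _ fun k _ => ?_
    have h1 : Measurable fun ω => ⌊S k ω / δ⌋ := Int.measurable_floor.comp ((hSm k).div_const δ)
    exact ((measurable_from_top (f := fun j : ℤ => (j : ℝ))).comp h1).const_mul δ
  have e : ∫ ω, φ (∑ k ∈ Finset.range M, δ * (⌊S k ω / δ⌋ : ℝ)) ∂μ =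
      μ.real {ω | x < ∑ k ∈ Finset.range M, δ * (⌊S k ω / δ⌋ : ℝ)} := by
    rw [← integral_indicator_one (measurableSet_lt measurable_const hUm)]
    rfl
  rw [e] at key
  calc μ.real {ω | x + M * δ < ∑ k ∈ Finset.range M, S k ω}
      ≤ μ.real {ω | x < ∑ k ∈ Finset.range M, δ * (⌊S k ω / δ⌋ : ℝ)} := by
        refine measureReal_mono fun ω hω => ?_
        simp only [Set.mem_ofPred_eq] at hω ⊢
        have h1 : ∑ k ∈ Finset.range M, S k ω ≤
            ∑ k ∈ Finset.range M, (δ * (⌊S k ω / δ⌋ : ℝ) + δ) := by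
          refine Finset.sum_le_sum fun k _ => ?_
          have := (Int.lt_floor_add_one (S k ω / δ)).le
          rw [div_le_iff₀ hδ] at this
          linarith
        rw [Finset.sum_add_distrib] at h1
        simp only [Finset.sum_const, Finset.card_range, nsmul_eq_mul] at h1
        linarith
    _ ≤ _ := key
    _ ≤ _ := by gcongr

end Blocks

/-! ### Mixing bounds at all times and variances of sums -/

section MixingProcess

variable {Ω E : Type*} [mΩ : MeasurableSpace Ω] [mE : MeasurableSpace E] {μ : Measure Ω}

/-- `a k` bounds the strong mixing coefficients of `X` at lag `k`, at all times. -/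
def MixingBound (μ : Measure Ω) (X : ℤ → Ω → E) (a : ℕ → ℝ) : Prop :=
  ∀ (s : ℤ) (k : ℕ) (A B : Set Ω), MeasurableSet[sigmaGen X (Set.Iic s)] A →
    MeasurableSet[sigmaGen X (Set.Ici (s + k))] B → |μ.real (A ∩ B) - μ.real A * μ.real B| ≤ a k

lemma sigmaGen_le {X : ℤ → Ω → E} (hX : ∀ t, Measurable (X t)) (I : Set ℤ) : sigmaGen X I ≤ mΩ :=
  iSup₂_le fun t _ => (hX t).comap_le

omit mΩ in
lemma comap_le_sigmaGen {X : ℤ → Ω → E} {I : Set ℤ} {t : ℤ} (ht : t ∈ I) :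
    MeasurableSpace.comap (X t) mE ≤ sigmaGen X I :=
  le_iSup₂ (f := fun t (_ : t ∈ I) => MeasurableSpace.comap (X t) mE) t ht

omit mΩ in
/-- Events generated by the coordinates in `I` are events of the path lying in a set generated by
the coordinates in `I`. -/
lemma exists_path_set {X : ℤ → Ω → E} {I : Set ℤ} {A : Set Ω}
    (hA : MeasurableSet[sigmaGen X I] A) :
    ∃ S : Set (ℤ → E), MeasurableSet[sigmaGen (fun t (p : ℤ → E) => p t) I] S ∧
      A = (fun ω t => X t ω) ⁻¹' S := by
  have : sigmaGen X I = MeasurableSpace.comap (fun ω t => X t ω)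
      (sigmaGen (fun t (p : ℤ → E) => p t) I) := by
    simp only [sigmaGen, MeasurableSpace.comap_iSup, MeasurableSpace.comap_comp, Function.comp_def]
  rw [this] at hA
  obtain ⟨S, hS, rfl⟩ := hA
  exact ⟨S, hS, rfl⟩

omit mΩ in
lemma measurableSet_preimage_path {X : ℤ → Ω → E} {I J : Set ℤ} (c : ℤ) {S : Set (ℤ → E)}
    (hS : MeasurableSet[sigmaGen (fun t (p : ℤ → E) => p t) I] S) (h : ∀ t ∈ I, t + c ∈ J) :
    MeasurableSet[sigmaGen X J] ((fun ω t => X (t + c) ω) ⁻¹' S) := by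
  have hle : MeasurableSpace.comap (fun ω t => X (t + c) ω)
      (sigmaGen (fun t (p : ℤ → E) => p t) I) ≤ sigmaGen X J := by
    simp only [sigmaGen, MeasurableSpace.comap_iSup, MeasurableSpace.comap_comp, Function.comp_def]
    exact iSup₂_le fun t ht => comap_le_sigmaGen (h t ht)
  exact hle _ ⟨S, hS, rfl⟩

/-- The mixing coefficients are defined with the past ending at time 0. Stationarity of the path law
moves the split from time s to time 0, once events are expressed as preimages of sets of paths. -/
lemma mixingBound_alphaMixing [IsProbabilityMeasure μ] {X : ℤ → Ω → E}
    (hX : ∀ t, Measurable (X t)) (hst : IsStrictlyStationary μ X) :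
    MixingBound μ X (alphaMixing μ X) := by
  intro s k A B hA hB
  obtain ⟨S, hS, rfl⟩ := exists_path_set hA
  obtain ⟨S', hS', rfl⟩ := exists_path_set hB
  have hpath : ∀ c : ℤ, Measurable fun ω t => X (t + c) ω := fun c =>
    measurable_pi_lambda _ fun t => hX _
  have hle : ∀ I : Set ℤ, sigmaGen (fun t (p : ℤ → E) => p t) I ≤ MeasurableSpace.pi := fun I =>
    sigmaGen_le (fun t => measurable_pi_apply t) I
  have hshift : ∀ {U : Set (ℤ → E)}, MeasurableSet U →
      μ.real ((fun ω t => X (t + s) ω) ⁻¹' U) = μ.real ((fun ω t => X t ω) ⁻¹' U) := by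
    intro U hU
    have h0 : Measurable fun ω t => X t ω := measurable_pi_lambda _ fun t => hX _
    rw [measureReal_def, measureReal_def, ← Measure.map_apply (hpath s) hU,
      ← Measure.map_apply h0 hU, hst s]
  -- Path shift by -s. Events of the original path are preimages, under the path shifted by s, of
  -- the sets θ⁻¹U, so stationarity replaces them by the events of X moved back s steps.
  set θ : (ℤ → E) → (ℤ → E) := fun p t => p (t + -s) with hθ
  have hθm : Measurable θ := measurable_pi_lambda _ fun t => measurable_pi_apply _
  have e : ∀ U : Set (ℤ → E), (fun ω t => X (t + s) ω) ⁻¹' (θ ⁻¹' U) = (fun ω t => X t ω) ⁻¹' U := by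
    intro U
    ext ω
    simp [hθ]
  have e' : ∀ U : Set (ℤ → E), (fun ω t => X t ω) ⁻¹' (θ ⁻¹' U) =
      (fun ω t => X (t + -s) ω) ⁻¹' U := fun U => rfl
  have hm : ∀ {I U}, MeasurableSet[sigmaGen (fun t (p : ℤ → E) => p t) I] U →
      MeasurableSet (θ ⁻¹' U) := fun hU => hθm (hle _ _ hU)
  rw [← e S, ← e S', ← Set.preimage_inter, hshift ((hm hS).inter (hm hS')), hshift (hm hS),
    hshift (hm hS'), Set.preimage_inter]
  rw [abs_sub_comm]
  refine le_csSup ⟨1, ?_⟩ ⟨_, _, ?_, ?_, rfl⟩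
  · rintro x ⟨A, B, -, -, rfl⟩
    have hA0 := measureReal_nonneg (μ := μ) (s := A)
    have hA1 := measureReal_le_one (μ := μ) (s := A)
    have hB0 := measureReal_nonneg (μ := μ) (s := B)
    have hB1 := measureReal_le_one (μ := μ) (s := B)
    have hC0 := measureReal_nonneg (μ := μ) (s := A ∩ B)
    have hC1 := measureReal_le_one (μ := μ) (s := A ∩ B)
    rw [abs_le]
    constructor <;> nlinarith
  · rw [e']
    exact measurableSet_preimage_path _ hS fun t ht => by simpa using ht
  · rw [e']
    refine measurableSet_preimage_path _ hS' fun t ht => ?_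
    simp only [Set.mem_Ici] at ht ⊢
    linarith

/-- Lag 0 is covered by the trivial bound 1, so a rate assumed only at positive lags extends to all
lags. -/
lemma MixingBound.of_le [IsProbabilityMeasure μ] {X : ℤ → Ω → E} {a : ℕ → ℝ}
    (h : MixingBound μ X a) {a' : ℕ → ℝ} (ha : ∀ k, 0 < k → a k ≤ a' k) (h0 : 1 ≤ a' 0) :
    MixingBound μ X a' := by
  intro s k A B hA hB
  rcases Nat.eq_zero_or_pos k with rfl | hk
  · have hA0 := measureReal_nonneg (μ := μ) (s := A)
    have hA1 := measureReal_le_one (μ := μ) (s := A)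
    have hB0 := measureReal_nonneg (μ := μ) (s := B)
    have hB1 := measureReal_le_one (μ := μ) (s := B)
    have hC0 := measureReal_nonneg (μ := μ) (s := A ∩ B)
    have hC1 := measureReal_le_one (μ := μ) (s := A ∩ B)
    refine le_trans ?_ h0
    rw [abs_le]
    constructor <;> nlinarith
  · exact (h s k A B hA hB).trans (ha k hk)

/-- Covariances decay with the lag. -/
lemma MixingBound.abs_cov_le [IsProbabilityMeasure μ] {X : ℤ → Ω → E} {a : ℕ → ℝ}
    (h : MixingBound μ X a) (hX : ∀ t, Measurable (X t)) (ha : ∀ k, 0 < a k) {V : ℤ → Ω → ℝ}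
    (hV : ∀ t, Measurable[MeasurableSpace.comap (X t) mE] (V t)) {κ : ℝ}
    (h4 : ∀ t, Integrable (fun ω => V t ω ^ 4) μ) (hκ : ∀ t, ∫ ω, V t ω ^ 4 ∂μ ≤ κ) (s t : ℤ) :
    |∫ ω, V s ω * V t ω ∂μ - (∫ ω, V s ω ∂μ) * ∫ ω, V t ω ∂μ| ≤
      (4 + 2 * (1 + 2 * κ) + 2 * (1 + κ) ^ 2) * a (t - s).natAbs ^ (1 / 3 : ℝ) := by
  have hle : ∀ s t : ℤ, s ≤ t → |∫ ω, V s ω * V t ω ∂μ - (∫ ω, V s ω ∂μ) * ∫ ω, V t ω ∂μ| ≤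
      (4 + 2 * (1 + 2 * κ) + 2 * (1 + κ) ^ 2) * a (t - s).natAbs ^ (1 / 3 : ℝ) := by
    intro s t hst
    refine abs_integral_mul_sub_le_of_moments (sigmaGen_le hX (Set.Iic s))
      (sigmaGen_le hX (Set.Ici (s + (t - s).natAbs))) (ha _) (fun A B hA hB => h s _ A B hA hB)
      ((hV s).mono (comap_le_sigmaGen (by simp)) le_rfl)
      ((hV t).mono (comap_le_sigmaGen ?_) le_rfl) (h4 s) (h4 t) (hκ s) (hκ t)
    simp only [Set.mem_Ici]
    omega
  rcases le_total s t with hst | hst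
  · exact hle s t hst
  · have := hle t s hst
    rw [show (t - s).natAbs = (s - t).natAbs by omega]
    simp_rw [mul_comm (V s _)]
    rwa [mul_comm (∫ ω, V s ω ∂μ)]

/-- Variance of a sum with summable covariances. -/
lemma integral_sum_sq_le [IsProbabilityMeasure μ] {V : ℤ → Ω → ℝ} {c : ℝ} {g : ℕ → ℝ}
    (hV2 : ∀ s t, Integrable (fun ω => V s ω * V t ω) μ) (hc : 0 ≤ c) (hg : ∀ k, 0 ≤ g k)
    (hsum : Summable fun d : ℤ => g d.natAbs)
    (hcov : ∀ s t, |∫ ω, V s ω * V t ω ∂μ| ≤ c * g (t - s).natAbs) (I : Finset ℤ) :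
    ∫ ω, (∑ s ∈ I, V s ω) ^ 2 ∂μ ≤ c * (∑' d : ℤ, g d.natAbs) * I.card := by
  calc ∫ ω, (∑ s ∈ I, V s ω) ^ 2 ∂μ = ∑ s ∈ I, ∑ t ∈ I, ∫ ω, V s ω * V t ω ∂μ := by
        simp_rw [sq, Finset.sum_mul_sum]
        rw [integral_finsetSum _ fun s _ => integrable_finsetSum _ fun t _ => hV2 s t]
        exact Finset.sum_congr rfl fun s _ => integral_finsetSum _ fun t _ => hV2 s t
    _ ≤ ∑ s ∈ I, c * ∑' d : ℤ, g d.natAbs := by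
        refine Finset.sum_le_sum fun s _ => ?_
        calc ∑ t ∈ I, ∫ ω, V s ω * V t ω ∂μ ≤ ∑ t ∈ I, c * g (t - s).natAbs :=
              Finset.sum_le_sum fun t _ => (le_abs_self _).trans (hcov s t)
          -- For fixed s the lags t - s are distinct, so the sum is part of the full series over ℤ.
          _ = c * ∑ d ∈ I.map ⟨fun t => t - s, sub_left_injective⟩, g d.natAbs := by
              rw [← Finset.mul_sum, Finset.sum_map]; rfl
          _ ≤ _ := by
              gcongr
              exact hsum.sum_le_tsum _ fun d _ => hg _
    _ = _ := by rw [Finset.sum_const, nsmul_eq_mul]; ring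

end MixingProcess

/-! ### Bernstein inequality for bounded functions of a mixing process -/

section Bernstein

variable {Ω E : Type*} [mΩ : MeasurableSpace Ω] [mE : MeasurableSpace E] {μ : Measure Ω}
  [IsProbabilityMeasure μ]

/-- The times in `{1, …, T}` which belong to the `m`-th block of length `ℓ`. -/
def timeBlock (T ℓ m : ℕ) : Finset ℤ := (Finset.Icc 1 (T : ℤ)).filter fun s => (s - 1) / ℓ = m

lemma mem_timeBlock {T ℓ m : ℕ} (hℓ : 0 < ℓ) {s : ℤ} (hs : s ∈ timeBlock T ℓ m) :
    (m : ℤ) * ℓ + 1 ≤ s ∧ s ≤ (m + 1) * ℓ := by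
  have h1 := (Finset.mem_filter.1 hs).2
  have hℓ' : (0 : ℤ) < ℓ := by exact_mod_cast hℓ
  rw [Int.ediv_eq_iff_of_pos hℓ'] at h1
  constructor <;> nlinarith [h1.1, h1.2]

lemma card_timeBlock_le {T ℓ m : ℕ} (hℓ : 0 < ℓ) : (timeBlock T ℓ m).card ≤ ℓ := by
  have h : timeBlock T ℓ m ⊆ Finset.Icc ((m : ℤ) * ℓ + 1) ((m + 1) * ℓ) := fun s hs =>
    Finset.mem_Icc.2 (mem_timeBlock hℓ hs)
  refine (Finset.card_le_card h).trans ?_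
  rw [Int.card_Icc]
  have : ((m : ℤ) + 1) * ℓ + 1 - (m * ℓ + 1) = ℓ := by ring
  rw [this]; simp

/-- Each time lies in exactly one block, whose index is even or odd. Block indices are below T, so T
blocks of each parity more than suffice; the surplus ones are empty. -/
lemma sum_timeBlock_eq {T ℓ : ℕ} (hℓ : 0 < ℓ) (g : ℤ → ℝ) :
    ∑ s ∈ Finset.Icc 1 (T : ℤ), g s = ∑ k ∈ Finset.range T, ∑ s ∈ timeBlock T ℓ (2 * k), g s +
      ∑ k ∈ Finset.range T, ∑ s ∈ timeBlock T ℓ (2 * k + 1), g s := by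
  simp only [timeBlock, Finset.sum_filter]
  rw [Finset.sum_comm, Finset.sum_comm (s := Finset.range T), ← Finset.sum_add_distrib]
  refine Finset.sum_congr rfl fun s hs => ?_
  rw [Finset.mem_Icc] at hs
  rw [← Finset.sum_add_distrib]
  have h0 : 0 ≤ (s - 1) / (ℓ : ℤ) := Int.ediv_nonneg (by omega) (by omega)
  have h1 : (s - 1) / (ℓ : ℤ) ≤ s - 1 := Int.ediv_le_self _ (by omega)
  generalize (s - 1) / (ℓ : ℤ) = m at h0 h1
  obtain ⟨n, rfl⟩ := Int.eq_ofNat_of_zero_le h0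
  have hn : n / 2 < T := by omega
  rw [Finset.sum_eq_single_of_mem (n / 2) (Finset.mem_range.2 hn)]
  · rcases Nat.even_or_odd' n with ⟨c, rfl | rfl⟩
    · rw [if_pos (by push_cast; omega), if_neg (by push_cast; omega), add_zero]
    · rw [if_neg (by push_cast; omega), if_pos (by push_cast; omega), zero_add]
  · intro k _ hk
    rw [if_neg (by push_cast; omega), if_neg (by push_cast; omega), add_zero]

lemma sum_card_timeBlock_le {T ℓ : ℕ} (p : ℕ) (hℓ : 0 < ℓ) (hp : p < 2) :
    ∑ k ∈ Finset.range T, ((timeBlock T ℓ (2 * k + p)).card : ℝ) ≤ T := by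
  have h := sum_timeBlock_eq (T := T) hℓ fun _ => 1
  simp only [Finset.sum_const, Int.card_Icc, nsmul_eq_mul, mul_one] at h
  have h0 : ((T : ℤ) + 1 - 1).toNat = T := by omega
  rw [h0] at h
  have e0 : 0 ≤ ∑ k ∈ Finset.range T, ((timeBlock T ℓ (2 * k)).card : ℝ) :=
    Finset.sum_nonneg fun _ _ => Nat.cast_nonneg _
  have e1 : 0 ≤ ∑ k ∈ Finset.range T, ((timeBlock T ℓ (2 * k + 1)).card : ℝ) :=
    Finset.sum_nonneg fun _ _ => Nat.cast_nonneg _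
  interval_cases p
  · simp only [add_zero]; linarith
  · linarith

/-- Bernstein-type inequality for bounded functions of a strongly mixing process. -/
lemma MixingBound.measureReal_sum_gt_le {X : ℤ → Ω → E} {a : ℕ → ℝ}
    (h : MixingBound μ X a) (hX : ∀ t, Measurable (X t)) {V : ℤ → Ω → ℝ}
    (hV : ∀ t, Measurable[MeasurableSpace.comap (X t) mE] (V t)) {H Γ l δ x : ℝ} {ℓ T : ℕ}
    (hb : ∀ t ω, |V t ω| ≤ H) (h0 : ∀ t, ∫ ω, V t ω ∂μ = 0) (hΓ0 : 0 ≤ Γ)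
    (hΓ : ∀ I : Finset ℤ, ∫ ω, (∑ s ∈ I, V s ω) ^ 2 ∂μ ≤ Γ * I.card) (hℓ : 0 < ℓ) (hl : 0 ≤ l)
    (hlH : l * (ℓ * H) ≤ 1) (hδ : 0 < δ) (ha : 0 ≤ a ℓ) :
    μ.real {ω | 2 * (x + T * δ) < ∑ s ∈ Finset.Icc 1 (T : ℤ), V s ω} ≤
      2 * (Real.exp (-(l * x) + l ^ 2 * (Γ * T)) + T * ((2 * (ℓ * H / δ) + 5) * a ℓ)) := by
  have hH : 0 ≤ H := by
    obtain ⟨ω⟩ : Nonempty Ω := μ.nonempty_of_neZero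
    exact (abs_nonneg _).trans (hb 0 ω)
  have hblock : ∀ p : ℕ, p < 2 →
      μ.real {ω | x + T * δ < ∑ k ∈ Finset.range T, ∑ s ∈ timeBlock T ℓ (2 * k + p), V s ω} ≤
      Real.exp (-(l * x) + l ^ 2 * (Γ * T)) + T * ((2 * (ℓ * H / δ) + 5) * a ℓ) := by
    intro p hp
    -- With m = 2k + p, the preceding block of the same parity ends at (m - 1)ℓ and block m starts
    -- after mℓ. The skipped block provides a lag of ℓ.
    set P : ℕ → MeasurableSpace Ω := fun k =>
      sigmaGen X (Set.Iic ((((2 * k + p : ℕ) : ℤ) - 1) * ℓ)) with hPdef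
    set F : ℕ → MeasurableSpace Ω := fun k =>
      sigmaGen X (Set.Ici ((((2 * k + p : ℕ) : ℤ) - 1) * ℓ + ℓ)) with hFdef
    have hVi : ∀ t, Integrable (V t) μ := fun t =>
      Integrable.of_bound ((hV t).mono ((hX t).comap_le) le_rfl).aestronglyMeasurable H
        (ae_of_all _ (hb t))
    have key := measureReal_sum_blocks_le (μ := μ) (P := P) (F := F)
      (S := fun k ω => ∑ s ∈ timeBlock T ℓ (2 * k + p), V s ω) (b := ℓ * H) (l := l) (δ := δ)
      (x := x) (v := fun k => Γ * (timeBlock T ℓ (2 * k + p)).card) (a := a ℓ)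
      (fun k => sigmaGen_le hX _) (fun k => sigmaGen_le hX _) (fun k A B hA hB => h _ ℓ A B hA hB)
      ?_ ?_ ?_ ?_ (fun k => hΓ _) hl hlH hδ ha T
    · refine key.trans ?_
      gcongr
      rw [← Finset.mul_sum]
      gcongr
      exact sum_card_timeBlock_le p hℓ hp
    · intro j k hjk
      refine Finset.measurable_fun_sum _ fun s hs => (hV s).mono (comap_le_sigmaGen ?_) le_rfl
      have h1 := (mem_timeBlock hℓ hs).2
      simp only [Set.mem_Iic]
      refine h1.trans (mul_le_mul_of_nonneg_right ?_ (by positivity))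
      push_cast
      omega
    · intro k
      refine Finset.measurable_fun_sum _ fun s hs => (hV s).mono (comap_le_sigmaGen ?_) le_rfl
      have h1 := (mem_timeBlock hℓ hs).1
      simp only [Set.mem_Ici]
      nlinarith
    · intro k ω
      refine (Finset.abs_sum_le_sum_abs _ _).trans ((Finset.sum_le_sum fun s _ => hb s ω).trans ?_)
      rw [Finset.sum_const, nsmul_eq_mul]
      gcongr
      exact_mod_cast card_timeBlock_le hℓ
    · intro k
      rw [integral_finsetSum _ fun s _ => hVi s]
      exact Finset.sum_eq_zero fun s _ => h0 s
  have hsub : {ω | 2 * (x + T * δ) < ∑ s ∈ Finset.Icc 1 (T : ℤ), V s ω} ⊆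
      {ω | x + T * δ < ∑ k ∈ Finset.range T, ∑ s ∈ timeBlock T ℓ (2 * k + 0), V s ω} ∪
      {ω | x + T * δ < ∑ k ∈ Finset.range T, ∑ s ∈ timeBlock T ℓ (2 * k + 1), V s ω} := by
    intro ω hω
    simp only [Set.mem_ofPred_eq] at hω
    rw [sum_timeBlock_eq hℓ fun s => V s ω] at hω
    by_contra hcon
    simp only [Set.mem_union, Set.mem_ofPred_eq, not_or, not_lt] at hcon
    simp only [add_zero] at hcon
    linarith [hcon.1, hcon.2]
  refine (measureReal_mono hsub).trans ((measureReal_union_le _ _).trans ?_)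
  linarith [hblock 0 (by norm_num), hblock 1 (by norm_num)]

end Bernstein

/-! ### Stretched exponential rates and variance bounds -/

section Concentration

lemma summable_exp_neg_rpow {c p : ℝ} (hc : 0 < c) (hp : 0 < p) :
    Summable fun k : ℕ => Real.exp (-c * (k : ℝ) ^ p) := by
  have h1 := isLittleO_exp_neg_mul_rpow_atTop hc (-(2 / p))
  have h2 : Tendsto (fun k : ℕ => (k : ℝ) ^ p) atTop atTop :=
    (tendsto_rpow_atTop hp).comp tendsto_natCast_atTop_atTop
  have h3 := (h1.comp_tendsto h2).isBigO
  refine summable_of_isBigO_nat (Real.summable_nat_rpow.2 (by norm_num : (-2 : ℝ) < -1)) ?_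
  refine h3.congr_right fun k => ?_
  simp only [Function.comp_apply]
  rw [← Real.rpow_mul (by positivity)]
  congr 1
  field_simp

lemma summable_int_exp_neg_rpow {c p : ℝ} (hc : 0 < c) (hp : 0 < p) :
    Summable fun d : ℤ => Real.exp (-c * (d.natAbs : ℝ) ^ p) := by
  refine Summable.of_nat_of_neg ?_ ?_ <;>
  · simpa using summable_exp_neg_rpow hc hp

/-- Stretched exponential mixing rate. -/
def expRate (c p : ℝ) (k : ℕ) : ℝ := Real.exp (-c * (k : ℝ) ^ p)

lemma expRate_pos (c p : ℝ) (k : ℕ) : 0 < expRate c p k := Real.exp_pos _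

lemma expRate_rpow (c p θ : ℝ) (k : ℕ) : expRate c p k ^ θ = expRate (c * θ) p k := by
  rw [expRate, expRate, ← Real.exp_mul]
  congr 1; ring

lemma summable_expRate {c p : ℝ} (hc : 0 < c) (hp : 0 < p) :
    Summable fun d : ℤ => expRate c p d.natAbs := summable_int_exp_neg_rpow hc hp

variable {Ω : Type*} [mΩ : MeasurableSpace Ω] {μ : Measure Ω} [IsProbabilityMeasure μ]

lemma integrable_of_integrable_pow {f : Ω → ℝ} (hf : Measurable f) {p q : ℕ} (hpq : p ≤ q)
    (hq : Even q) (h : Integrable (fun ω => f ω ^ q) μ) : Integrable (fun ω => f ω ^ p) μ := by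
  refine ((integrable_const (1 : ℝ)).add h).mono' (hf.pow_const p).aestronglyMeasurable
    (ae_of_all _ fun ω => ?_)
  simp only [Real.norm_eq_abs, Pi.add_apply, abs_pow, ← hq.pow_abs (f ω)]
  rcases le_total |f ω| 1 with h1 | h1
  · have := pow_le_one₀ (n := p) (abs_nonneg (f ω)) h1
    have := pow_nonneg (abs_nonneg (f ω)) q
    linarith
  · have := pow_le_pow_right₀ h1 hpq
    linarith

lemma integral_pow_le {f : Ω → ℝ} {p q : ℕ} (hpq : p ≤ q) (hp : Even p)
    (hq : Even q) (h : Integrable (fun ω => f ω ^ q) μ) {κ : ℝ} (hκ : ∫ ω, f ω ^ q ∂μ ≤ κ) :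
    ∫ ω, f ω ^ p ∂μ ≤ 1 + κ := by
  refine (integral_mono_of_nonneg (ae_of_all _ fun ω => hp.pow_nonneg _)
    ((integrable_const (1 : ℝ)).add h) (ae_of_all _ fun ω => ?_)).trans ?_
  · simp only [Pi.add_apply]
    rw [← hq.pow_abs, ← hp.pow_abs]
    rcases le_total |f ω| 1 with h1 | h1
    · have := pow_le_one₀ (n := p) (abs_nonneg (f ω)) h1
      have := pow_nonneg (abs_nonneg (f ω)) q
      linarith
    · have := pow_le_pow_right₀ h1 hpq
      linarith
  · simp only [Pi.add_apply]
    rw [integral_add (integrable_const _) h]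
    simpa using hκ

/-- Variance constant of partial sums of a process with eighth moments at most `κ` and stretched
exponential mixing rate. -/
def varConst (κ c p : ℝ) : ℝ :=
  (4 + 2 * (1 + 2 * κ) + 2 * (1 + κ) ^ 2) * ∑' d : ℤ, expRate (c * (1 / 3)) p d.natAbs

lemma varConst_nonneg {κ : ℝ} (hκ : 0 ≤ κ) (c p : ℝ) : 0 ≤ varConst κ c p :=
  mul_nonneg (by positivity) (tsum_nonneg fun _ => (expRate_pos _ _ _).le)

variable {E : Type*} [mE : MeasurableSpace E] {X : ℤ → Ω → E}

/-- Bounded fourth moments make the covariance at lag d at most a constant times the cube root of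
the mixing coefficient, which is still a summable stretched exponential. -/
lemma MixingBound.integral_centered_sum_sq_le {c p : ℝ} (hc : 0 < c) (hp : 0 < p)
    (h : MixingBound μ X (expRate c p)) (hX : ∀ t, Measurable (X t)) {V : ℤ → Ω → ℝ}
    (hV : ∀ t, Measurable[MeasurableSpace.comap (X t) mE] (V t)) {κ : ℝ}
    (h4 : ∀ t, Integrable (fun ω => V t ω ^ 4) μ) (hκ : ∀ t, ∫ ω, V t ω ^ 4 ∂μ ≤ κ)
    (I : Finset ℤ) :
    ∫ ω, (∑ s ∈ I, (V s ω - ∫ ω', V s ω' ∂μ)) ^ 2 ∂μ ≤ varConst κ c p * I.card := by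
  have hV' : ∀ t, Measurable (V t) := fun t => (hV t).mono ((hX t).comap_le) le_rfl
  have hκ0 : 0 ≤ κ := (integral_nonneg fun ω => by positivity).trans (hκ 0)
  have h2 : ∀ t, Integrable (fun ω => V t ω ^ 2) μ := fun t =>
    integrable_of_integrable_pow (hV' t) (by norm_num) (by decide) (h4 t)
  have h1 : ∀ t, Integrable (V t) μ := fun t => by
    simpa using integrable_of_integrable_pow (p := 1) (hV' t) (by norm_num) (by decide) (h4 t)
  have hm : ∀ t, MemLp (V t) 2 μ := fun t =>
    (memLp_two_iff_integrable_sq (hV' t).aestronglyMeasurable).2 (h2 t)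
  have hprod : ∀ s t, Integrable (fun ω => V s ω * V t ω) μ := fun s t =>
    (hm s).integrable_mul (hm t)
  have hcent : ∀ t, MemLp (fun ω => V t ω - ∫ ω', V t ω' ∂μ) 2 μ := fun t =>
    (hm t).sub (memLp_const _)
  refine integral_sum_sq_le (g := expRate (c * (1 / 3)) p)
    (fun s t => (hcent s).integrable_mul (hcent t)) (by positivity)
    (fun k => (expRate_pos _ _ _).le) (summable_expRate (by positivity) hp) (fun s t => ?_) I
  have e : ∫ ω, (V s ω - ∫ ω', V s ω' ∂μ) * (V t ω - ∫ ω', V t ω' ∂μ) ∂μ =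
      ∫ ω, V s ω * V t ω ∂μ - (∫ ω, V s ω ∂μ) * ∫ ω, V t ω ∂μ := by
    have := covariance_eq_sub (hm s) (hm t)
    simpa [covariance] using this
  rw [e, ← expRate_rpow]
  exact h.abs_cov_le hX (fun k => expRate_pos _ _ _) hV h4 hκ s t

end Concentration

/-! ### Concentration at the rate √(T L) -/

section Concentration

variable {Ω : Type*} [mΩ : MeasurableSpace Ω] {μ : Measure Ω} [IsProbabilityMeasure μ]
variable {E : Type*} [mE : MeasurableSpace E] {X : ℤ → Ω → E}

/-- Concentration of sums of a strongly mixing process at the rate `√(T L)`, for `L` at most a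
power of `T`. -/
theorem MixingBound.concentration {c p : ℝ} (hc : 0 < c) (hp : 0 < p)
    (h : MixingBound μ X (expRate c p)) (hX : ∀ t, Measurable (X t)) {V : ℤ → Ω → ℝ}
    (hV : ∀ t, Measurable[MeasurableSpace.comap (X t) mE] (V t)) {κ : ℝ}
    (h8 : ∀ t, Integrable (fun ω => V t ω ^ 8) μ) (hκ : ∀ t, ∫ ω, V t ω ^ 8 ∂μ ≤ κ)
    {T : ℕ} {y L τ : ℝ} (hy : 1 ≤ y) (hyT : y ^ 10 = T) (hκy : κ ≤ y ^ 2) (hL : 1 ≤ L)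
    (hLy : 16 * L ≤ y ^ 6) (hτ : ∀ t, μ.real {ω | y < |V t ω|} ≤ τ) :
    μ.real {ω | 2 * (varConst (1 + κ) c p + 5) * √(T * L) <
        |∑ s ∈ Finset.Icc 1 (T : ℤ), (V s ω - ∫ ω', V s ω' ∂μ)|} ≤
      T * τ + 4 * (Real.exp (-(3 * L)) + 13 * (T : ℝ) ^ 3 * Real.exp (-c * y ^ p)) := by
  have hy0 : 0 < y := by linarith
  have hκ0 : 0 ≤ κ := (integral_nonneg fun ω => (by decide : Even 8).pow_nonneg _).trans (hκ 0)
  have hV' : ∀ t, Measurable (V t) := fun t => (hV t).mono ((hX t).comap_le) le_rfl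
  have hT0 : (0 : ℝ) < T := by rw [← hyT]; positivity
  set Γ := varConst (1 + κ) c p with hΓ
  have hΓ0 : 0 ≤ Γ := varConst_nonneg (by linarith) c p
  -- Blocks of length about y = T^{1/10}: long enough for the mixing error exp(-c y^p) to beat
  -- powers of T, short enough that block sums, of size at most 4y², stay far below √T.
  set ℓ := ⌈y⌉₊ with hℓ
  have hℓ0 : 0 < ℓ := Nat.ceil_pos.2 hy0
  have hℓy : y ≤ ℓ := Nat.le_ceil y
  have hℓy2 : (ℓ : ℝ) ≤ 2 * y := by linarith [Nat.ceil_lt_add_one hy0.le]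
  set W : ℤ → Ω → ℝ := fun t ω => clip y (V t ω) with hW
  have hWm : ∀ t, Measurable[MeasurableSpace.comap (X t) mE] (W t) := fun t =>
    (measurable_clip y).comp (hV t)
  have hWm' : ∀ t, Measurable (W t) := fun t => (measurable_clip y).comp (hV' t)
  have hWb : ∀ t ω, |W t ω| ≤ y := fun t ω => abs_clip_le hy0.le _
  have hWi : ∀ t, Integrable (W t) μ := fun t =>
    Integrable.of_bound (hWm' t).aestronglyMeasurable y (ae_of_all _ (hWb t))
  have hVi : ∀ t, Integrable (V t) μ := fun t => by
    simpa using integrable_of_integrable_pow (p := 1) (hV' t) (by norm_num) (by decide) (h8 t)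
  have hW4 : ∀ t, Integrable (fun ω => W t ω ^ 4) μ := fun t => by
    refine Integrable.of_bound ((hWm' t).pow_const 4).aestronglyMeasurable (y ^ 4)
      (ae_of_all _ fun ω => ?_)
    rw [Real.norm_eq_abs, abs_pow]
    gcongr
    exact hWb t ω
  have hW4κ : ∀ t, ∫ ω, W t ω ^ 4 ∂μ ≤ 1 + κ := fun t => by
    refine le_trans (integral_mono_of_nonneg (ae_of_all _ fun ω => by positivity)
      (integrable_of_integrable_pow (hV' t) (by norm_num) (by decide) (h8 t))
      (ae_of_all _ fun ω => ?_)) (integral_pow_le (p := 4) (by norm_num) (by decide) (by decide)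
        (h8 t) (hκ t))
    simp only
    rw [← (by decide : Even 4).pow_abs, ← (by decide : Even 4).pow_abs (V t ω)]
    exact pow_le_pow_left₀ (abs_nonneg _) (abs_clip_le_abs hy0.le _) 4
  set m : ℤ → ℝ := fun t => ∫ ω, W t ω ∂μ with hm
  have hmb : ∀ t, |m t| ≤ y := fun t => by
    refine abs_integral_le_integral_abs.trans ((integral_mono (hWi t).abs (integrable_const y)
      (hWb t)).trans (by simp))
  -- Bias of truncation at y by the eighth moment. Summed over T = y^10 times it is at most κy³ ≤
  -- y^5, within the target deviation.
  have hbias : ∀ t, |∫ ω, V t ω ∂μ - m t| ≤ κ / y ^ 7 := fun t => by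
    rw [hm, ← integral_sub (hVi t) (hWi t)]
    refine abs_integral_le_integral_abs.trans ((integral_mono_of_nonneg
      (ae_of_all _ fun ω => abs_nonneg _) ((h8 t).div_const (y ^ 7)) (ae_of_all _ fun ω => ?_)).trans
      (by rw [integral_div]; gcongr; exact hκ t))
    have := abs_sub_clip_le hy0 (V t ω) 7
    rwa [(by decide : Even (7 + 1)).pow_abs] at this
  set Z : ℤ → Ω → ℝ := fun t ω => W t ω - m t with hZ
  have hZb : ∀ t ω, |Z t ω| ≤ 2 * y := fun t ω => by
    refine (abs_sub _ _).trans ?_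
    linarith [hWb t ω, hmb t]
  have hZ0 : ∀ t, ∫ ω, Z t ω ∂μ = 0 := fun t => by
    rw [hZ, integral_sub (hWi t) (integrable_const _)]; simp [hm]
  have hZΓ : ∀ I : Finset ℤ, ∫ ω, (∑ s ∈ I, Z s ω) ^ 2 ∂μ ≤ Γ * I.card := fun I =>
    h.integral_centered_sum_sq_le hc hp hX hWm hW4 hW4κ I
  have hZm : ∀ t, Measurable[MeasurableSpace.comap (X t) mE] (Z t) := fun t =>
    (hWm t).sub_const _
  have hs : √(T * L) = y ^ 5 * √L := by
    rw [Real.sqrt_mul hT0.le, ← hyT, show y ^ 10 = (y ^ 5) ^ 2 by ring,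
      Real.sqrt_sq (by positivity)]
  have hsL : √L ≤ y ^ 3 / 4 := by
    rw [Real.sqrt_le_left (by positivity)]
    nlinarith
  have hsL1 : 1 ≤ √L := Real.one_le_sqrt.2 hL
  have hsL0 : 0 ≤ √L := Real.sqrt_nonneg _
  -- With l below, the Chernoff exponent -lx + l²ΓT equals -(Γ + 3)L + ΓL = -3L. The assumption 16L
  -- ≤ y^6 ensures that l times a block sum is at most 1.
  set x := (Γ + 3) * (y ^ 5 * √L) with hx
  set l := √L / y ^ 5 with hl
  have hlx : -(l * x) + l ^ 2 * (Γ * T) = -(3 * L) := by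
    rw [hl, hx, ← hyT]
    field_simp
    rw [Real.sq_sqrt (by linarith)]
    ring
  have hlH : l * (ℓ * (2 * y)) ≤ 1 := by
    calc l * (ℓ * (2 * y)) ≤ (y ^ 3 / 4 / y ^ 5) * ((2 * y) * (2 * y)) := by
          rw [hl]; gcongr
      _ = 1 := by field_simp; norm_num
  -- Grid width 1/T, so that all the rounding together costs 1.
  have hrate : (T : ℝ) * ((2 * (ℓ * (2 * y) / (1 / (T : ℝ))) + 5) * expRate c p ℓ) ≤
      13 * (T : ℝ) ^ 3 * Real.exp (-c * y ^ p) := by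
    have e1 : expRate c p ℓ ≤ Real.exp (-c * y ^ p) := by
      rw [expRate, Real.exp_le_exp]
      have := Real.rpow_le_rpow hy0.le hℓy hp.le
      nlinarith
    have hT1 : (1 : ℝ) ≤ T := by rw [← hyT]; exact one_le_pow₀ hy
    have hyT2 : y ^ 2 ≤ T := by rw [← hyT]; exact pow_le_pow_right₀ hy (by norm_num)
    have e2 : (T : ℝ) * (2 * (ℓ * (2 * y) / (1 / (T : ℝ))) + 5) ≤ 13 * (T : ℝ) ^ 3 := by
      rw [div_div_eq_mul_div, div_one]
      calc (T : ℝ) * (2 * (ℓ * (2 * y) * T) + 5)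
          ≤ (T : ℝ) * (2 * ((2 * y) * (2 * y) * T) + 5) := by gcongr
        _ = (T : ℝ) * (8 * y ^ 2 * T + 5) := by ring
        _ ≤ (T : ℝ) * (8 * T * T + 5 * (T * T)) := by gcongr; nlinarith
        _ = _ := by ring
    rw [← mul_assoc]
    exact mul_le_mul e2 e1 (expRate_pos _ _ _).le (by positivity)
  have hTδ : x + T * (1 / (T : ℝ)) = x + 1 := by field_simp
  have hup := h.measureReal_sum_gt_le (T := T) hX hZm (x := x) hZb hZ0 hΓ0 hZΓ hℓ0 (by positivity) hlH
    (δ := 1 / (T : ℝ)) (by positivity) (expRate_pos _ _ _).le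
  have hdown := h.measureReal_sum_gt_le (T := T) hX (V := fun t ω => -Z t ω) (fun t => (hZm t).neg) (x := x)
    (fun t ω => by rw [abs_neg]; exact hZb t ω) (fun t => by rw [integral_neg, hZ0, neg_zero]) hΓ0
    (fun I => by simp only [Finset.sum_neg_distrib, neg_sq]; exact hZΓ I) hℓ0 (by positivity) hlH
    (δ := 1 / (T : ℝ)) (by positivity) (expRate_pos _ _ _).le
  rw [hTδ, hlx] at hup hdown
  set I := Finset.Icc 1 (T : ℤ) with hI
  have hIcard : (I.card : ℝ) = T := by
    rw [hI, Int.card_Icc]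
    have : ((T : ℤ) + 1 - 1).toNat = T := by omega
    rw [this]
  -- Off the truncation event the sum differs from the truncated centred one only by the bias, at
  -- most y^5. The step from Γ + 3 to Γ + 5 absorbs this bias and the rounding.
  have hsub : {ω | 2 * (Γ + 5) * √(T * L) < |∑ s ∈ I, (V s ω - ∫ ω', V s ω' ∂μ)|} ⊆
      (⋃ s ∈ I, {ω | y < |V s ω|}) ∪ ({ω | 2 * (x + 1) < ∑ s ∈ I, Z s ω} ∪
        {ω | 2 * (x + 1) < ∑ s ∈ I, -Z s ω}) := by
    intro ω hω
    by_contra hcon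
    simp only [Set.mem_union, Set.mem_iUnion, Set.mem_ofPred_eq, not_or, not_exists, not_lt]
      at hcon hω
    obtain ⟨h1, h2, h3⟩ := hcon
    have e1 : ∀ s ∈ I, V s ω - ∫ ω', V s ω' ∂μ = Z s ω - (∫ ω', V s ω' ∂μ - m s) := fun s hs => by
      have : W s ω = V s ω := clip_eq_self (h1 s hs)
      rw [hZ]; simp only [this]; ring
    rw [Finset.sum_congr rfl e1, Finset.sum_sub_distrib] at hω
    have e2 : |∑ s ∈ I, (∫ ω', V s ω' ∂μ - m s)| ≤ T * (κ / y ^ 7) := by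
      refine (Finset.abs_sum_le_sum_abs _ _).trans ((Finset.sum_le_sum fun s _ => hbias s).trans ?_)
      rw [Finset.sum_const, nsmul_eq_mul, hIcard]
    have e3 : (T : ℝ) * (κ / y ^ 7) ≤ y ^ 5 := by
      rw [← hyT]
      calc y ^ 10 * (κ / y ^ 7) = y ^ 3 * κ := by field_simp
        _ ≤ y ^ 3 * y ^ 2 := by gcongr
        _ = y ^ 5 := by ring
    rw [Finset.sum_neg_distrib] at h3
    have e4 : |∑ s ∈ I, Z s ω| ≤ 2 * (x + 1) := abs_le.2 ⟨by linarith, by linarith⟩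
    have e5 := (abs_sub (∑ s ∈ I, Z s ω) (∑ s ∈ I, (∫ ω', V s ω' ∂μ - m s))).trans
      (add_le_add e4 (e2.trans e3))
    have e6 : y ^ 5 ≤ y ^ 5 * √L := le_mul_of_one_le_right (by positivity) hsL1
    have e7 : 1 ≤ y ^ 5 := one_le_pow₀ hy
    rw [hs] at hω
    nlinarith
  refine (measureReal_mono hsub).trans ((measureReal_union_le _ _).trans (add_le_add ?_
    ((measureReal_union_le _ _).trans ?_)))
  · refine (measureReal_biUnion_finset_le _ _).trans ((Finset.sum_le_sum fun s _ => hτ s).trans ?_)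
    rw [Finset.sum_const, nsmul_eq_mul, hIcard]
  · linarith

end Concentration

/-! ### Moments from tails, and variances with small second moments -/

section Moments

variable {Ω : Type*} [mΩ : MeasurableSpace Ω] {μ : Measure Ω} [IsProbabilityMeasure μ]

/-- Stretched exponential tails give uniform bounds on moments. -/
lemma exists_moment_bound (μ : Measure Ω) [IsProbabilityMeasure μ] {b ρ : ℝ} (hb : 0 < b)
    (hρ : 0 < ρ) {q : ℕ} (hq : Even q) (hq0 : 0 < q) :
    ∃ κ : ℝ, 0 ≤ κ ∧ ∀ f : Ω → ℝ, Measurable f →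
      (∀ s : ℝ, 0 < s → μ.real {ω | s < |f ω|} ≤ Real.exp (-(s / b) ^ ρ)) →
      Integrable (fun ω => f ω ^ q) μ ∧ ∫ ω, f ω ^ q ∂μ ≤ κ := by
  -- Up to the factor q, the layer-cake integrand for the q-th moment with the tail replaced by its
  -- bound.
  set G : ℝ → ℝ := fun t => t ^ ((q : ℝ) - 1) * Real.exp (-(b ^ (-ρ)) * t ^ ρ) with hG
  have hGi : IntegrableOn G (Set.Ioi 0) :=
    integrableOn_rpow_mul_exp_neg_mul_rpow (by
      have : (1 : ℝ) ≤ q := by exact_mod_cast hq0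
      linarith) hρ (Real.rpow_pos_of_pos hb _)
  set J : ENNReal := ENNReal.ofReal q * ∫⁻ t in Set.Ioi 0, ENNReal.ofReal (G t) with hJ
  have hJtop : J ≠ ⊤ := by
    refine ENNReal.mul_ne_top ENNReal.ofReal_ne_top ?_
    refine ((lintegral_mono fun t => ?_).trans_lt hGi.2).ne
    exact Real.ofReal_le_enorm _
  refine ⟨J.toReal, ENNReal.toReal_nonneg, fun f hf htail => ?_⟩
  have hq0' : (0 : ℝ) < q := by exact_mod_cast hq0
  have hle : ∫⁻ ω, ENNReal.ofReal (f ω ^ q) ∂μ ≤ J := by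
    have e : ∀ ω, f ω ^ q = |f ω| ^ (q : ℝ) := fun ω => by
      rw [Real.rpow_natCast, hq.pow_abs]
    simp_rw [e]
    rw [lintegral_rpow_eq_lintegral_meas_lt_mul μ (ae_of_all _ fun ω => abs_nonneg _)
      hf.abs.aemeasurable hq0']
    refine mul_le_mul_right (setLIntegral_mono' measurableSet_Ioi fun t ht => ?_) _
    have ht0 : 0 < t := ht
    have h1 : μ {ω | t < |f ω|} ≤ ENNReal.ofReal (Real.exp (-(t / b) ^ ρ)) := by
      rw [← ofReal_measureReal]
      exact ENNReal.ofReal_le_ofReal (htail t ht0)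
    refine (mul_le_mul_left h1 _).trans ?_
    rw [← ENNReal.ofReal_mul (Real.exp_pos _).le]
    refine ENNReal.ofReal_le_ofReal (le_of_eq ?_)
    rw [hG, mul_comm]
    simp only
    rw [Real.div_rpow ht0.le hb.le, Real.rpow_neg hb.le]
    congr 2
    ring
  have hint : Integrable (fun ω => f ω ^ q) μ := by
    refine ⟨(hf.pow_const q).aestronglyMeasurable, ?_⟩
    rw [hasFiniteIntegral_iff_ofReal (ae_of_all _ fun ω => hq.pow_nonneg _)]
    exact hle.trans_lt hJtop.lt_top
  refine ⟨hint, ?_⟩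
  rw [integral_eq_lintegral_of_nonneg_ae (ae_of_all _ fun ω => hq.pow_nonneg _)
    hint.aestronglyMeasurable]
  exact ENNReal.toReal_mono hJtop hle

variable {E : Type*} [mE : MeasurableSpace E] {X : ℤ → Ω → E}

/-- Variance of sums of a mixing process whose terms have a small second moment. -/
lemma MixingBound.integral_centered_sum_sq_le_of_small {c p : ℝ} (hc : 0 < c) (hp : 0 < p)
    (h : MixingBound μ X (expRate c p)) (hX : ∀ t, Measurable (X t)) {V : ℤ → Ω → ℝ}
    (hV : ∀ t, Measurable[MeasurableSpace.comap (X t) mE] (V t)) {κ σ : ℝ}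
    (h4 : ∀ t, Integrable (fun ω => V t ω ^ 4) μ) (hκ : ∀ t, ∫ ω, V t ω ^ 4 ∂μ ≤ κ)
    (hσ : ∀ t, ∫ ω, V t ω ^ 2 ∂μ ≤ σ) (I : Finset ℤ) :
    ∫ ω, (∑ s ∈ I, (V s ω - ∫ ω', V s ω' ∂μ)) ^ 2 ∂μ ≤
      (σ ^ (2 / 3 : ℝ) * (4 + 2 * (1 + 2 * κ) + 2 * (1 + κ) ^ 2) ^ (1 / 3 : ℝ)) *
        (∑' d : ℤ, expRate (c * (1 / 9)) p d.natAbs) * I.card := by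
  have hV' : ∀ t, Measurable (V t) := fun t => (hV t).mono ((hX t).comap_le) le_rfl
  have hκ0 : 0 ≤ κ := (integral_nonneg fun ω => by positivity).trans (hκ 0)
  have hσ0 : 0 ≤ σ := (integral_nonneg fun ω => by positivity).trans (hσ 0)
  have h2 : ∀ t, Integrable (fun ω => V t ω ^ 2) μ := fun t =>
    integrable_of_integrable_pow (hV' t) (by norm_num) (by decide) (h4 t)
  have hm : ∀ t, MemLp (V t) 2 μ := fun t =>
    (memLp_two_iff_integrable_sq (hV' t).aestronglyMeasurable).2 (h2 t)
  have hcent : ∀ t, MemLp (fun ω => V t ω - ∫ ω', V t ω' ∂μ) 2 μ := fun t =>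
    (hm t).sub (memLp_const _)
  have hK0 : 0 ≤ 4 + 2 * (1 + 2 * κ) + 2 * (1 + κ) ^ 2 := by positivity
  refine integral_sum_sq_le (g := expRate (c * (1 / 9)) p)
    (fun s t => (hcent s).integrable_mul (hcent t)) (by positivity)
    (fun k => (expRate_pos _ _ _).le) (summable_expRate (by positivity) hp) (fun s t => ?_) I
  have e : ∫ ω, (V s ω - ∫ ω', V s ω' ∂μ) * (V t ω - ∫ ω', V t ω' ∂μ) ∂μ =
      ∫ ω, V s ω * V t ω ∂μ - (∫ ω, V s ω ∂μ) * ∫ ω, V t ω ∂μ := by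
    have := covariance_eq_sub (hm s) (hm t)
    simpa [covariance] using this
  have b1 := h.abs_cov_le hX (fun k => expRate_pos _ _ _) hV h4 hκ s t
  have hvar : ∀ t, ∫ ω, (V t ω - ∫ ω', V t ω' ∂μ) ^ 2 ∂μ ≤ σ := fun t => by
    have e2 := variance_le_expectation_sq (hV' t).aestronglyMeasurable (μ := μ)
    rw [variance_eq_integral (hV' t).aemeasurable] at e2
    exact e2.trans (hσ t)
  have b2 : |∫ ω, (V s ω - ∫ ω', V s ω' ∂μ) * (V t ω - ∫ ω', V t ω' ∂μ) ∂μ| ≤ σ := by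
    refine abs_integral_le_integral_abs.trans ((integral_mono_of_nonneg
      (ae_of_all _ fun ω => abs_nonneg _)
      (((hcent s).integrable_sq.add (hcent t).integrable_sq).div_const 2)
      (ae_of_all _ fun ω => ?_)).trans ?_)
    · simp only [Pi.add_apply, abs_mul]
      rw [← sq_abs (V s ω - _), ← sq_abs (V t ω - _)]
      nlinarith [sq_nonneg (|V s ω - ∫ ω', V s ω' ∂μ| - |V t ω - ∫ ω', V t ω' ∂μ|)]
    · simp only [Pi.add_apply]
      rw [integral_div, integral_add (hcent s).integrable_sq (hcent t).integrable_sq]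
      linarith [hvar s, hvar t]
  rw [← e] at b1
  have z0 := abs_nonneg (∫ ω, (V s ω - ∫ ω', V s ω' ∂μ) * (V t ω - ∫ ω', V t ω' ∂μ) ∂μ)
  generalize |∫ ω, (V s ω - ∫ ω', V s ω' ∂μ) * (V t ω - ∫ ω', V t ω' ∂μ) ∂μ| = z at b1 b2 z0 ⊢
  rw [expRate_rpow] at b1
  have hg : expRate (c * (1 / 3)) p (t - s).natAbs ^ (1 / 3 : ℝ) =
      expRate (c * (1 / 9)) p (t - s).natAbs := by
    rw [expRate_rpow]; congr 1; ring
  -- Interpolation: the power 2/3 of the covariance uses its bound by the second moment σ, and the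
  -- power 1/3 keeps enough decay in the lag for summability.
  calc z = z ^ (2 / 3 : ℝ) * z ^ (1 / 3 : ℝ) := by
        rw [← Real.rpow_add_of_nonneg z0 (by norm_num) (by norm_num)]; norm_num
    _ ≤ σ ^ (2 / 3 : ℝ) * ((4 + 2 * (1 + 2 * κ) + 2 * (1 + κ) ^ 2) *
          expRate (c * (1 / 3)) p (t - s).natAbs) ^ (1 / 3 : ℝ) := by
        gcongr
    _ = _ := by
        rw [Real.mul_rpow hK0 (expRate_pos _ _ _).le, hg]; ring

end Moments

/-! ### Consequences of √N log N / T → 0 -/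

section Growth

lemma tendsto_rpow_mul_exp_neg_rpow {c a : ℝ} (hc : 0 < c) (ha : 0 < a) (k : ℝ) :
    Tendsto (fun x : ℝ => x ^ k * Real.exp (-c * x ^ a)) atTop (𝓝 0) := by
  have h1 := tendsto_rpow_mul_exp_neg_mul_atTop_nhds_zero (k / a) c hc
  have h2 := h1.comp (tendsto_rpow_atTop ha)
  refine h2.congr' ?_
  filter_upwards [eventually_ge_atTop 0] with x hx
  simp only [Function.comp_apply]
  rw [← Real.rpow_mul hx]
  congr 2
  field_simp

variable {N T : ℕ → ℕ}

/-- The sample size dominates a power of the dimension. -/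
lemma eventually_le_sq_of_growth (hN : Tendsto N atTop atTop) (hT : Tendsto T atTop atTop)
    (hNT : Tendsto (fun n => √(N n : ℝ) * Real.log (N n) / T n) atTop (𝓝 0)) :
    ∀ᶠ n in atTop, (N n : ℝ) ≤ (T n : ℝ) ^ 2 ∧ 1 ≤ Real.log (N n) ∧ 1 ≤ (T n : ℝ) := by
  have hN' : Tendsto (fun n => (N n : ℝ)) atTop atTop := tendsto_natCast_atTop_atTop.comp hN
  have hT' : Tendsto (fun n => (T n : ℝ)) atTop atTop := tendsto_natCast_atTop_atTop.comp hT
  filter_upwards [hN'.eventually_ge_atTop (Real.exp 1), hNT.eventually_lt_const zero_lt_one,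
    hT'.eventually_ge_atTop 1] with n h1 h2 h0
  have hlog : 1 ≤ Real.log (N n) := by
    rw [Real.le_log_iff_exp_le ((Real.exp_pos 1).trans_le h1)]; exact h1
  have hN0 : (0 : ℝ) < N n := (Real.exp_pos 1).trans_le h1
  rw [div_lt_one (by linarith)] at h2
  have h3 : √(N n : ℝ) ≤ T n := by
    have : √(N n : ℝ) * 1 ≤ √(N n : ℝ) * Real.log (N n) := by gcongr
    linarith
  refine ⟨?_, hlog, h0⟩
  calc (N n : ℝ) = √(N n : ℝ) ^ 2 := (Real.sq_sqrt hN0.le).symm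
    _ ≤ _ := by gcongr

/-- From N ≤ T² one gets log N ≤ 2 log T, which is of smaller order than any power of T. -/
lemma eventually_log_le_of_growth (hN : Tendsto N atTop atTop) (hT : Tendsto T atTop atTop)
    (hNT : Tendsto (fun n => √(N n : ℝ) * Real.log (N n) / T n) atTop (𝓝 0)) {a : ℝ}
    (ha : 0 < a) : ∀ᶠ n in atTop, 16 * Real.log (N n) ≤ (T n : ℝ) ^ a := by
  have hT' : Tendsto (fun n => (T n : ℝ)) atTop atTop := tendsto_natCast_atTop_atTop.comp hT
  have h1 := hT'.eventually ((isLittleO_log_rpow_atTop ha).bound (c := 1 / 32) (by norm_num))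
  filter_upwards [h1, eventually_le_sq_of_growth hN hT hNT] with n h2 h3
  obtain ⟨h3, h4, h5⟩ := h3
  have hN0 : (0 : ℝ) < N n := by
    by_contra h
    have : (N n : ℝ) = 0 := le_antisymm (not_lt.1 h) (Nat.cast_nonneg _)
    rw [this] at h4; simp at h4; linarith
  have h6 : Real.log (N n) ≤ 2 * Real.log (T n) := by
    calc Real.log (N n) ≤ Real.log ((T n : ℝ) ^ 2) := Real.log_le_log hN0 h3
      _ = _ := by rw [Real.log_pow]; norm_num
  rw [Real.norm_of_nonneg (Real.log_nonneg h5), Real.norm_of_nonneg (by positivity)] at h2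
  linarith

/-- The union bound in the concentration inequality for all pairs of components vanishes. -/
lemma tendsto_union_bound (hN : Tendsto N atTop atTop) (hT : Tendsto T atTop atTop)
    (hNT : Tendsto (fun n => √(N n : ℝ) * Real.log (N n) / T n) atTop (𝓝 0)) (r : ℕ)
    {b ρ c p : ℝ} (hb : 0 < b) (hρ : 0 < ρ) (hc : 0 < c) (hp : 0 < p) :
    Tendsto (fun n => ((N n : ℝ) + r) ^ 2 * (T n *
      (2 * Real.exp (-(√((T n : ℝ) ^ (1 / 10 : ℝ)) / b) ^ ρ)) +
      4 * (Real.exp (-(3 * Real.log (N n))) + 13 * (T n : ℝ) ^ 3 *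
        Real.exp (-c * ((T n : ℝ) ^ (1 / 10 : ℝ)) ^ p)))) atTop (𝓝 0) := by
  have hN' : Tendsto (fun n => (N n : ℝ)) atTop atTop := tendsto_natCast_atTop_atTop.comp hN
  have hT' : Tendsto (fun n => (T n : ℝ)) atTop atTop := tendsto_natCast_atTop_atTop.comp hT
  have l1 := (tendsto_rpow_mul_exp_neg_rpow (c := (b ^ ρ)⁻¹) (a := ρ / 20) (by positivity)
    (by positivity) 5).comp hT'
  have l2 := (tendsto_rpow_mul_exp_neg_rpow (c := c) (a := p / 10) hc (by positivity) 7).comp hT'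
  have l3 : Tendsto (fun n => ((N n : ℝ))⁻¹) atTop (𝓝 0) := tendsto_inv_atTop_zero.comp hN'
  have lim := ((l1.const_mul 8).add (l3.const_mul 16)).add (l2.const_mul 208)
  simp only [mul_zero, add_zero] at lim
  refine squeeze_zero' (Eventually.of_forall fun n => by positivity) ?_ lim
  filter_upwards [eventually_le_sq_of_growth hN hT hNT, hN'.eventually_ge_atTop 1,
    hN'.eventually_ge_atTop r] with n h1 h2 h3
  obtain ⟨h1, -, h5⟩ := h1
  have hT0 : (0 : ℝ) < T n := by linarith
  have hN0 : (0 : ℝ) < N n := by linarith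
  set t : ℝ := (T n : ℝ)
  set m : ℝ := (N n : ℝ)
  have e1 : (√(t ^ (1 / 10 : ℝ)) / b) ^ ρ = (b ^ ρ)⁻¹ * t ^ (ρ / 20) := by
    rw [Real.div_rpow (by positivity) hb.le, Real.sqrt_eq_rpow, ← Real.rpow_mul hT0.le,
      ← Real.rpow_mul hT0.le, div_eq_inv_mul]
    congr 2; ring
  have e2 : (t ^ (1 / 10 : ℝ)) ^ p = t ^ (p / 10) := by
    rw [← Real.rpow_mul hT0.le]; congr 1; ring
  -- The exponent 3 log N gives N^{-3}, which survives the union over about N² pairs. In the other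
  -- two terms N ≤ T², and stretched exponentials beat powers of T.
  have e3 : Real.exp (-(3 * Real.log m)) = (m ^ 3)⁻¹ := by
    rw [Real.exp_neg, mul_comm, Real.exp_mul, Real.exp_log hN0]; norm_cast
  rw [e1, e2, e3]
  simp only [Function.comp_apply]
  rw [neg_mul_eq_neg_mul]
  set x := Real.exp (-(b ^ ρ)⁻¹ * t ^ (ρ / 20))
  set z := Real.exp (-c * t ^ (p / 10))
  have hx : 0 < x := Real.exp_pos _
  have hz : 0 < z := Real.exp_pos _
  have e5 : t ^ (5 : ℝ) = t ^ 5 := by norm_cast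
  have e7 : t ^ (7 : ℝ) = t ^ 7 := by norm_cast
  change _ ≤ 8 * (t ^ (5 : ℝ) * x) + 16 * m⁻¹ + 208 * (t ^ (7 : ℝ) * z)
  rw [e5, e7]
  have hsq : (m + r) ^ 2 ≤ 4 * m ^ 2 := by
    calc (m + r) ^ 2 ≤ (m + m) ^ 2 := by gcongr
      _ = _ := by ring
  calc (m + r) ^ 2 * (t * (2 * x) + 4 * ((m ^ 3)⁻¹ + 13 * t ^ 3 * z))
      ≤ 4 * m ^ 2 * (t * (2 * x) + 4 * ((m ^ 3)⁻¹ + 13 * t ^ 3 * z)) := by gcongr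
    _ = 8 * m ^ 2 * t * x + 16 * m⁻¹ + 208 * m ^ 2 * t ^ 3 * z := by field_simp; ring
    _ ≤ 8 * (t ^ 2) ^ 2 * t * x + 16 * m⁻¹ + 208 * (t ^ 2) ^ 2 * t ^ 3 * z := by gcongr
    _ = _ := by ring

end Growth

/-! ### From spectra to quadratic forms, norms and inverses -/

section Spectral

open scoped Matrix.Norms.L2Operator

variable {n : Type*} [Fintype n] [DecidableEq n]

lemma quadForm_ge_of_spectrum {A : Matrix n n ℝ} (hA : Aᵀ = A) {c : ℝ}
    (h : ∀ x ∈ spectrum ℝ A, c ≤ x) (x : n → ℝ) :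
    c * ‖WithLp.toLp 2 x‖ ^ 2 ≤ x ⬝ᵥ A *ᵥ x := by
  have hp : (A - algebraMap ℝ (Matrix n n ℝ) c).PosSemidef := by
    rw [Matrix.posSemidef_iff_isHermitian_and_spectrum_nonneg]
    refine ⟨?_, fun y hy => ?_⟩
    · rw [IsHermitian, conjTranspose_eq_transpose_of_trivial, transpose_sub, hA]
      simp [Algebra.algebraMap_eq_smul_one]
    · rw [← spectrum.sub_singleton_eq] at hy
      obtain ⟨z, hz, w, hw, rfl⟩ := hy
      rw [Set.mem_singleton_iff] at hw
      have := h z hz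
      simp only [Set.mem_ofPred_eq]
      linarith
  have h1 := hp.dotProduct_mulVec_nonneg x
  rw [norm_sq_toLp]
  simp only [star_trivial, Algebra.algebraMap_eq_smul_one, sub_mulVec, smul_mulVec, one_mulVec,
    dotProduct_sub, dotProduct_smul, smul_eq_mul] at h1
  have h2 : x ⬝ᵥ x = ∑ i, x i ^ 2 := by simp [dotProduct, sq]
  rw [h2] at h1
  linarith

lemma quadForm_le_of_spectrum {A : Matrix n n ℝ} (hA : Aᵀ = A) {c : ℝ}
    (h : ∀ x ∈ spectrum ℝ A, x ≤ c) (x : n → ℝ) :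
    x ⬝ᵥ A *ᵥ x ≤ c * ‖WithLp.toLp 2 x‖ ^ 2 := by
  have h1 := quadForm_ge_of_spectrum (A := -A) (c := -c) (by rw [transpose_neg, hA])
    (fun y hy => by
      rw [← spectrum.neg_eq, Set.mem_neg] at hy
      linarith [h _ hy]) x
  simp only [neg_mulVec, dotProduct_neg] at h1
  linarith

/-- Cauchy–Schwarz for the semidefinite form A, applied to x and y = Ax: ‖Ax‖⁴ ≤ (x'Ax)(y'Ay) ≤
c²‖x‖²‖Ax‖². It is obtained here from the sign of a discriminant. -/
lemma l2_opNorm_le_of_quadForm {A : Matrix n n ℝ} (hA : Aᵀ = A) {c : ℝ} (hc : 0 ≤ c)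
    (h0 : ∀ x, 0 ≤ x ⬝ᵥ A *ᵥ x) (h : ∀ x, x ⬝ᵥ A *ᵥ x ≤ c * ‖WithLp.toLp 2 x‖ ^ 2) : ‖A‖ ≤ c := by
  rw [l2_opNorm_def]
  refine ContinuousLinearMap.opNorm_le_bound _ hc fun v => ?_
  set x := v.ofLp with hx
  have hsymm : ∀ x y : n → ℝ, y ⬝ᵥ A *ᵥ x = x ⬝ᵥ A *ᵥ y := fun x y => by
    rw [dotProduct_mulVec, ← mulVec_transpose, hA, dotProduct_comm]
  change ‖WithLp.toLp 2 (A *ᵥ x)‖ ≤ c * ‖WithLp.toLp 2 x‖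
  set y := A *ᵥ x with hy
  have hyx : y ⬝ᵥ A *ᵥ x = ‖WithLp.toLp 2 y‖ ^ 2 := by
    rw [← hy, norm_sq_toLp]; simp [dotProduct, sq]
  have hd := discrim_le_zero (a := x ⬝ᵥ A *ᵥ x) (b := 2 * ‖WithLp.toLp 2 y‖ ^ 2)
    (c := y ⬝ᵥ A *ᵥ y) (fun s => by
      have := h0 (y + s • x)
      simp only [mulVec_add, mulVec_smul, dotProduct_add, add_dotProduct, smul_dotProduct,
        dotProduct_smul, smul_eq_mul] at this
      rw [hsymm y x, hyx] at this
      nlinarith)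
  rw [discrim] at hd
  have h1 := h x
  have h2 := h y
  have h3 := h0 x
  have h4 := h0 y
  have ha := norm_nonneg (WithLp.toLp 2 y)
  have hb := norm_nonneg (WithLp.toLp 2 x)
  generalize ‖WithLp.toLp 2 y‖ = a at *
  generalize ‖WithLp.toLp 2 x‖ = b at *
  rcases ha.eq_or_lt with rfl | ha'
  · positivity
  have h5 : (x ⬝ᵥ A *ᵥ x) * (y ⬝ᵥ A *ᵥ y) ≤ (c * b ^ 2) * (c * a ^ 2) := by gcongr
  have h6 : a ^ 2 * a ^ 2 ≤ (c * b) ^ 2 * a ^ 2 := by nlinarith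
  exact abs_le_of_sq_le_sq' (le_of_mul_le_mul_right h6 (by positivity)) (by positivity) |>.2

/-- A lower bound on the quadratic form bounds the inverse. -/
lemma inv_bound_of_quadForm {A : Matrix n n ℝ} {c : ℝ} (hc : 0 < c)
    (h : ∀ x, c * ‖WithLp.toLp 2 x‖ ^ 2 ≤ x ⬝ᵥ A *ᵥ x) :
    A * A⁻¹ = 1 ∧ A⁻¹ * A = 1 ∧ ‖A⁻¹‖ ≤ 1 / c := by
  have h1 : ∀ x, c * ‖WithLp.toLp 2 x‖ ≤ ‖WithLp.toLp 2 (A *ᵥ x)‖ := fun x => by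
    have e1 := h x
    have e2 := (le_abs_self _).trans (abs_dotProduct_le x (A *ᵥ x))
    have e3 := norm_nonneg (WithLp.toLp 2 x)
    rcases e3.eq_or_lt with e4 | e4
    · rw [← e4]; simp
    · refine le_of_mul_le_mul_left ?_ e4
      nlinarith
  have hu : IsUnit A := by
    rw [← mulVec_injective_iff_isUnit]
    refine (injective_iff_map_eq_zero A.mulVecLin).2 fun x hx => ?_
    have e1 := h1 x
    have hx' : A *ᵥ x = 0 := hx
    rw [hx'] at e1
    have e2 : ‖WithLp.toLp 2 x‖ = 0 := by
      have e3 := norm_nonneg (WithLp.toLp 2 x)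
      simp only [WithLp.toLp_zero, norm_zero] at e1
      nlinarith
    simpa using e2
  have hd : IsUnit A.det := (isUnit_iff_isUnit_det A).1 hu
  refine ⟨mul_nonsing_inv A hd, nonsing_inv_mul A hd, ?_⟩
  rw [l2_opNorm_def]
  refine ContinuousLinearMap.opNorm_le_bound _ (by positivity) fun v => ?_
  have e1 := h1 (A⁻¹ *ᵥ v.ofLp)
  rw [mulVec_mulVec, mul_nonsing_inv A hd, one_mulVec] at e1
  change ‖WithLp.toLp 2 (A⁻¹ *ᵥ v.ofLp)‖ ≤ 1 / c * ‖v‖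
  rw [one_div, ← div_eq_inv_mul, le_div_iff₀ hc, mul_comm]
  exact e1

/-- Perturbation of the inverse. -/
lemma inv_perturbation {A D : Matrix n n ℝ} {κ : ℝ} (h1 : A * A⁻¹ = 1) (hκ : ‖A⁻¹‖ ≤ κ)
    (hD : κ * ‖D‖ ≤ 1 / 2) :
    ‖(A + D)⁻¹‖ ≤ 2 * κ ∧ (A + D)⁻¹ - A⁻¹ = -(A⁻¹ * D * (A + D)⁻¹) ∧
    (A + D)⁻¹ - A⁻¹ = -(A⁻¹ * D * A⁻¹) + A⁻¹ * D * (A + D)⁻¹ * D * A⁻¹ := by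
  have hκ0 : 0 ≤ κ := (norm_nonneg _).trans hκ
  have h2 : A⁻¹ * A = 1 := mul_eq_one_comm.1 h1
  have hΘ : ‖-(A⁻¹ * D)‖ ≤ 1 / 2 := by
    rw [norm_neg]
    refine (l2_opNorm_mul _ _).trans ((mul_le_mul_of_nonneg_right hκ (norm_nonneg _)).trans hD)
  obtain ⟨E, e1, e2, e3⟩ := exists_inverse_one_sub _ hΘ
  have hfac : A + D = A * (1 - -(A⁻¹ * D)) := by
    rw [sub_neg_eq_add, mul_add, mul_one, ← mul_assoc, h1, one_mul]
  have hr : (A + D) * ((1 + E) * A⁻¹) = 1 := by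
    rw [hfac, mul_assoc, ← mul_assoc (1 - -(A⁻¹ * D)), e2, one_mul, h1]
  have hl : ((1 + E) * A⁻¹) * (A + D) = 1 := mul_eq_one_comm.1 hr
  have hinv : (A + D)⁻¹ = (1 + E) * A⁻¹ := inv_eq_right_inv hr
  have hnorm : ‖(A + D)⁻¹‖ ≤ 2 * κ := by
    rw [hinv, add_mul, one_mul]
    calc ‖A⁻¹ + E * A⁻¹‖ ≤ ‖A⁻¹‖ + ‖E‖ * ‖A⁻¹‖ :=
          (norm_add_le _ _).trans (add_le_add_right (l2_opNorm_mul _ _) _)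
      _ ≤ κ + 1 * κ := by gcongr; linarith
      _ = 2 * κ := by ring
  rw [← hinv] at hr hl
  have i1 : (A + D)⁻¹ - A⁻¹ = -(A⁻¹ * D * (A + D)⁻¹) := by
    have : A⁻¹ * (A + D) * (A + D)⁻¹ = A⁻¹ := by rw [mul_assoc, hr, mul_one]
    rw [mul_add, h2, add_mul, one_mul] at this
    exact eq_neg_of_add_eq_zero_left (by rw [sub_add_eq_add_sub, this, sub_self])
  have i2 : (A + D)⁻¹ - A⁻¹ = -((A + D)⁻¹ * D * A⁻¹) := by
    have : (A + D)⁻¹ * ((A + D) * A⁻¹) = A⁻¹ := by rw [← mul_assoc, hl, one_mul]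
    rw [add_mul, h1, mul_add, mul_one] at this
    rw [mul_assoc]
    exact eq_neg_of_add_eq_zero_left (by rw [sub_add_eq_add_sub, this, sub_self])
  refine ⟨hnorm, i1, ?_⟩
  -- Inserting the resolvent identity with A⁻¹ on the right into the one with A⁻¹ on the left gives
  -- the second order expansion, whose remainder has A⁻¹ at both ends.
  have i3 : (A + D)⁻¹ = A⁻¹ - (A + D)⁻¹ * D * A⁻¹ := by rw [sub_eq_add_neg, ← i2]; abel
  rw [i1]
  nth_rewrite 1 [i3]
  noncomm_ring

end Spectral

/-! ### Errors of thresholded entries -/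

section Threshold

/-- Error of a thresholded entry relative to `ω ^ (1 - q) * |σ| ^ q`. -/
lemma abs_thresholding_sub_le {q ω K τ τ₀ τ₁ a b σ x : ℝ} {s : ℝ → ℝ} (hq : 0 ≤ q) (hq1 : q ≤ 1)
    (hω : 0 < ω) (hτ₀ : 0 < τ₀) (hτ : τ₀ * ω ≤ τ) (hτ' : τ ≤ τ₁ * ω) (hK : 2 * K ≤ τ₀)
    (hx : |x - σ| ≤ K * ω) (hs : IsThresholding a b τ s) :
    |s x - σ| ≤ ((2 * τ₁) ^ (1 - q) + 2 * τ₁ / (τ₀ / 2) ^ q) * ω ^ (1 - q) *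
      (if σ = 0 then 0 else |σ| ^ q) := by
  have hτpos : 0 < τ := lt_of_lt_of_le (by positivity) hτ
  have hτ₁ : 0 < τ₁ := by
    by_contra h
    nlinarith
  have hKω : K * ω ≤ τ / 2 := by nlinarith
  have e1 : ∀ y : ℝ, 0 < y → y = y ^ (1 - q) * y ^ q := fun y hy => by
    rw [← Real.rpow_add hy]; simp
  have ht : |σ| ≤ |x - σ| + |x| := by
    have := abs_sub_abs_le_abs_sub σ x
    rw [abs_sub_comm] at this
    linarith
  have ht' : |x| ≤ |x - σ| + |σ| := by
    have := abs_sub_abs_le_abs_sub x σ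
    linarith
  -- If the entry is killed, |σ| ≤ 2τ₁ω and |σ| = |σ|^{1-q}|σ|^q. If it is kept, |σ| ≥ τ₀ω/2, so an
  -- error of order ω = ω^{1-q}ω^q is at most a multiple of ω^{1-q}|σ|^q.
  by_cases h0 : |x| < τ
  · rw [hs.zero x h0, zero_sub, abs_neg]
    split_ifs with hσ
    · simp [hσ]
    · have hσ' : 0 < |σ| := abs_pos.2 hσ
      have hb : |σ| ≤ 2 * τ₁ * ω := by linarith
      calc |σ| = |σ| ^ (1 - q) * |σ| ^ q := e1 _ hσ'
        _ ≤ (2 * τ₁ * ω) ^ (1 - q) * |σ| ^ q := by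
            gcongr
        _ = ((2 * τ₁) ^ (1 - q) + 0) * ω ^ (1 - q) * |σ| ^ q := by
            rw [Real.mul_rpow (by positivity) hω.le, add_zero]
        _ ≤ _ := by gcongr; positivity
  · push Not at h0
    have hσ' : τ₀ / 2 * ω ≤ |σ| := by linarith
    have hσ'' : 0 < |σ| := lt_of_lt_of_le (by positivity) hσ'
    rw [if_neg (abs_pos.1 hσ'')]
    have hn : |s x - σ| ≤ 2 * τ₁ * ω := by
      have := abs_sub_le (s x) x σ
      linarith [hs.near x]
    calc |s x - σ| ≤ 2 * τ₁ * (ω ^ (1 - q) * ω ^ q) := by rwa [← e1 ω hω]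
      _ = 2 * τ₁ / (τ₀ / 2) ^ q * ω ^ (1 - q) * (τ₀ / 2 * ω) ^ q := by
          have : (τ₀ / 2) ^ q ≠ 0 := by positivity
          rw [Real.mul_rpow (by positivity) hω.le]
          field_simp
      _ ≤ (0 + 2 * τ₁ / (τ₀ / 2) ^ q) * ω ^ (1 - q) * |σ| ^ q := by
          rw [zero_add]; gcongr
      _ ≤ _ := by gcongr; positivity

/-- Error of an unthresholded entry that is bounded away from zero. -/
lemma abs_sub_le_rpow_mul {q ω K c σ x : ℝ} (hq : 0 ≤ q) (hω : 0 < ω) (hK : 0 ≤ K)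
    (hω1 : ω ≤ 1) (hc : 0 < c) (hσ : c ≤ σ) (hx : |x - σ| ≤ K * ω) :
    |x - σ| ≤ K / c ^ q * ω ^ (1 - q) * (if σ = 0 then 0 else |σ| ^ q) := by
  have hσ0 : 0 < σ := hc.trans_le hσ
  rw [if_neg hσ0.ne', abs_of_pos hσ0]
  calc |x - σ| ≤ K * (ω ^ (1 - q) * ω ^ q) := by
        rwa [← Real.rpow_add hω, sub_add_cancel, Real.rpow_one]
    _ ≤ K * (ω ^ (1 - q) * 1) := by
        gcongr
        exact Real.rpow_le_one hω.le hω1 hq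
    _ = K / c ^ q * ω ^ (1 - q) * c ^ q := by
        have : c ^ q ≠ 0 := by positivity
        field_simp
    _ ≤ _ := by gcongr

end Threshold

/-! ### Uniform concentration of the sample second moments -/

namespace FactorModel

variable {Ω : Type*} [MeasurableSpace Ω] {μ : Measure Ω} {D : FactorModel Ω}

/-- The components of `(u_t, f_t)`. -/
def comp (D : FactorModel Ω) (n : ℕ) (t : ℤ) (ω : Ω) : Fin (D.N n) ⊕ Fin D.r → ℝ :=
  Sum.elim (D.u n t ω) (D.f t ω)

/-- Uniform moment, tail and mixing bounds for the components of `(u_t, f_t)`. -/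
structure ModelBounds (D : FactorModel Ω) (μ : Measure Ω) (κ c p b ρ : ℝ) : Prop where
  κ_nonneg : 0 ≤ κ
  c_pos : 0 < c
  p_pos : 0 < p
  b_pos : 0 < b
  ρ_pos : 0 < ρ
  mixing : ∀ n, MixingBound μ (fun t ω => (D.u n t ω, D.f t ω)) (expRate c p)
  integrable_pow : ∀ n t i, Integrable (fun ω => D.comp n t ω i ^ 16) μ
  moment : ∀ n t i, ∫ ω, D.comp n t ω i ^ 16 ∂μ ≤ κ
  tail : ∀ n t i s, b ≤ s → μ.real {ω | s < |D.comp n t ω i|} ≤ Real.exp (-(s / b) ^ ρ)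

lemma Dynamics.measurable_state (h : D.Dynamics μ) (n : ℕ) (t : ℤ) :
    Measurable fun ω => (D.u n t ω, D.f t ω) :=
  (h.measurable_u n t).prodMk (h.measurable_f t)

/-- A measurable function of the state that extracts one component. -/
lemma measurable_comp_state {n : ℕ} (i : Fin (D.N n) ⊕ Fin D.r) :
    Measurable fun z : (Fin (D.N n) → ℝ) × (Fin D.r → ℝ) => Sum.elim z.1 z.2 i := by
  cases i with
  | inl i => exact (measurable_pi_apply i).comp measurable_fst
  | inr i => exact (measurable_pi_apply i).comp measurable_snd

lemma Dynamics.measurable_comp (h : D.Dynamics μ) (n : ℕ) (t : ℤ) (i : Fin (D.N n) ⊕ Fin D.r) :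
    Measurable fun ω => D.comp n t ω i :=
  (measurable_comp_state i).comp (h.measurable_state n t)

/-- Errors and factors have tails with different constants; the larger scale and the smaller
exponent serve both. The smaller exponent gives the weaker bound only beyond the scale b, hence the
restriction to s ≥ b in `ModelBounds.tail`. Sixteenth moments are recorded so that products of two
components have eighth moments. -/
lemma exists_modelBounds [IsProbabilityMeasure μ] (h : D.Dynamics μ) :
    ∃ κ c p b ρ, D.ModelBounds μ κ c p b ρ := by
  obtain ⟨r₁, r₂, b₁, b₂, hr₁, hr₂, hb₁, hb₂, ht⟩ := h.tails
  obtain ⟨p, c, hp, hc, hmix⟩ := h.mixing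
  obtain ⟨κ₁, hκ₁, hm₁⟩ := exists_moment_bound μ hb₁ hr₁ (q := 16) (by decide) (by norm_num)
  obtain ⟨κ₂, hκ₂, hm₂⟩ := exists_moment_bound μ hb₂ hr₂ (q := 16) (by decide) (by norm_num)
  have hu : ∀ n t i, Measurable fun ω => D.u n t ω i := fun n t i =>
    (measurable_pi_apply i).comp (h.measurable_u n t)
  have hf : ∀ t i, Measurable fun ω => D.f t ω i := fun t i =>
    (measurable_pi_apply i).comp (h.measurable_f t)
  have htail : ∀ {b' r' s : ℝ}, 0 < b' → 0 < r' → b' ≤ max b₁ b₂ → min r₁ r₂ ≤ r' →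
      max b₁ b₂ ≤ s → Real.exp (-(s / b') ^ r') ≤ Real.exp (-(s / max b₁ b₂) ^ min r₁ r₂) := by
    intro b' r' s hb' hr' hbb hrr hs
    have hB : 0 < max b₁ b₂ := lt_max_of_lt_left hb₁
    have h1 : 1 ≤ s / max b₁ b₂ := (one_le_div hB).2 hs
    have h2 : s / max b₁ b₂ ≤ s / b' := by
      have : 0 ≤ s := hB.le.trans hs
      gcongr
    rw [Real.exp_le_exp, neg_le_neg_iff]
    exact (Real.rpow_le_rpow_of_exponent_le h1 hrr).trans
      (Real.rpow_le_rpow (by positivity) h2 hr'.le)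
  refine ⟨max κ₁ κ₂, c, p, max b₁ b₂, min r₁ r₂, le_max_of_le_left hκ₁, hc, hp,
    lt_max_of_lt_left hb₁, lt_min hr₁ hr₂, fun n => ?_, ?_, ?_, ?_⟩
  · refine (mixingBound_alphaMixing (h.measurable_state n) (h.stationary n)).of_le
      (fun k hk => hmix n k hk) ?_
    simp [expRate, hp.ne']
  · rintro n t (i | i)
    · exact (hm₁ _ (hu n t i) fun s hs => (ht s hs).1 n t i).1
    · exact (hm₂ _ (hf t i) fun s hs => (ht s hs).2 t i).1
  · rintro n t (i | i)
    · exact ((hm₁ _ (hu n t i) fun s hs => (ht s hs).1 n t i).2).trans (le_max_left _ _)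
    · exact ((hm₂ _ (hf t i) fun s hs => (ht s hs).2 t i).2).trans (le_max_right _ _)
  · have hB : 0 < max b₁ b₂ := lt_max_of_lt_left hb₁
    rintro n t (i | i) s hs
    · exact ((ht s (hB.trans_le hs)).1 n t i).trans
        (htail hb₁ hr₁ (le_max_left _ _) (min_le_left _ _) hs)
    · exact ((ht s (hB.trans_le hs)).2 t i).trans
        (htail hb₂ hr₂ (le_max_right _ _) (min_le_right _ _) hs)

/-- Under stationarity, expectations of functions of the state do not depend on time. -/
lemma Dynamics.integral_state (h : D.Dynamics μ) (n : ℕ) (t : ℤ)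
    {g : (Fin (D.N n) → ℝ) × (Fin D.r → ℝ) → ℝ} (hg : Measurable g) :
    ∫ ω, g (D.u n t ω, D.f t ω) ∂μ = ∫ ω, g (D.u n 1 ω, D.f 1 ω) ∂μ := by
  have hpath : ∀ k : ℤ, Measurable fun ω (s : ℤ) => (D.u n (s + k) ω, D.f (s + k) ω) := fun k =>
    measurable_pi_lambda _ fun s => h.measurable_state n _
  have hG : Measurable fun q : ℤ → (Fin (D.N n) → ℝ) × (Fin D.r → ℝ) => g (q 1) :=
    hg.comp (measurable_pi_apply 1)
  have h1 := h.stationary n (t - 1)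
  have h2 := congrArg (fun ν => ∫ q, g (q 1) ∂ν) h1
  simp only at h2
  rw [integral_map (hpath (t - 1)).aemeasurable hG.aestronglyMeasurable,
    integral_map (by simpa using (hpath 0).aemeasurable) hG.aestronglyMeasurable] at h2
  simpa using h2

/-- Second moments of the components. -/
def secondMoment (D : FactorModel Ω) (μ : Measure Ω) (n : ℕ) (i j : Fin (D.N n) ⊕ Fin D.r) : ℝ :=
  ∫ ω, D.comp n 1 ω i * D.comp n 1 ω j ∂μ

lemma Dynamics.integral_comp_mul (h : D.Dynamics μ) (n : ℕ) (t : ℤ)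
    (i j : Fin (D.N n) ⊕ Fin D.r) :
    ∫ ω, D.comp n t ω i * D.comp n t ω j ∂μ = D.secondMoment μ n i j :=
  h.integral_state n t ((measurable_comp_state i).mul (measurable_comp_state j))

/-- The event that all sample second moments are close to the population ones. -/
def goodEvent (D : FactorModel Ω) (μ : Measure Ω) (A : ℝ) (n : ℕ) : Set Ω :=
  {ω | ∀ i j, |∑ t ∈ D.times n, (D.comp n t ω i * D.comp n t ω j - D.secondMoment μ n i j)| ≤
    A * √(D.T n * Real.log (D.N n))}

/-- Uniform concentration of the sample second moments at the rate `√(log N / T)`. -/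
theorem exists_tendsto_goodEvent [IsProbabilityMeasure μ] (h : D.Dynamics μ)
    (hNT : Tendsto (fun n => √(D.N n : ℝ) * Real.log (D.N n) / D.T n) atTop (𝓝 0)) :
    ∃ A : ℝ, 0 < A ∧ Tendsto (fun n => μ (D.goodEvent μ A n)ᶜ) atTop (𝓝 0) := by
  obtain ⟨κ, c, p, b, ρ, hM⟩ := exists_modelBounds h
  have hT' : Tendsto (fun n => (D.T n : ℝ)) atTop atTop :=
    tendsto_natCast_atTop_atTop.comp h.tendsto_T
  refine ⟨2 * (varConst (1 + κ) c p + 5), by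
    have := varConst_nonneg (κ := 1 + κ) (by linarith [hM.κ_nonneg]) c p
    positivity, ?_⟩
  have lim := tendsto_union_bound h.tendsto_N h.tendsto_T hNT D.r hM.b_pos hM.ρ_pos hM.c_pos hM.p_pos
  have lim' := ENNReal.tendsto_ofReal lim
  rw [ENNReal.ofReal_zero] at lim'
  refine tendsto_of_tendsto_of_tendsto_of_le_of_le' tendsto_const_nhds lim'
    (Eventually.of_forall fun n => zero_le) ?_
  have hpow : Tendsto (fun n => (D.T n : ℝ) ^ (1 / 10 : ℝ)) atTop atTop :=
    (tendsto_rpow_atTop (by norm_num)).comp hT'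
  filter_upwards [eventually_le_sq_of_growth h.tendsto_N h.tendsto_T hNT,
    eventually_log_le_of_growth h.tendsto_N h.tendsto_T hNT (a := 6 / 10) (by norm_num),
    hpow.eventually_ge_atTop 1, hpow.eventually_ge_atTop (κ + 1), hpow.eventually_ge_atTop (b ^ 2)]
    with n h1 h2 h3 h4 h5
  obtain ⟨-, hlog, hT1⟩ := h1
  have hT0 : (0 : ℝ) ≤ D.T n := by linarith
  -- Truncation level for the products; a product exceeds y only if a factor exceeds √y.
  set y := (D.T n : ℝ) ^ (1 / 10 : ℝ) with hy
  have hy10 : y ^ 10 = D.T n := by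
    rw [hy, ← Real.rpow_natCast, ← Real.rpow_mul hT0]; norm_num
  have hy6 : y ^ 6 = (D.T n : ℝ) ^ (6 / 10 : ℝ) := by
    rw [hy, ← Real.rpow_natCast, ← Real.rpow_mul hT0]; norm_num
  have hbs : b ≤ √y := Real.le_sqrt_of_sq_le h5
  have hpair : ∀ i j, μ.real {ω | 2 * (varConst (1 + κ) c p + 5) * √(D.T n * Real.log (D.N n)) <
      |∑ t ∈ D.times n, (D.comp n t ω i * D.comp n t ω j - D.secondMoment μ n i j)|} ≤
      D.T n * (2 * Real.exp (-(√y / b) ^ ρ)) + 4 * (Real.exp (-(3 * Real.log (D.N n))) +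
        13 * (D.T n : ℝ) ^ 3 * Real.exp (-c * y ^ p)) := by
    intro i j
    have hmeas : ∀ t i, Measurable[MeasurableSpace.comap (fun ω => (D.u n t ω, D.f t ω))
        inferInstance] fun ω => D.comp n t ω i := fun t i =>
      (measurable_comp_state i).comp (comap_measurable _)
    have hle8 : ∀ x y : ℝ, (x * y) ^ 8 ≤ (x ^ 16 + y ^ 16) / 2 := fun x y => by
      nlinarith [sq_nonneg (x ^ 8 - y ^ 8)]
    have hint : ∀ t, Integrable (fun ω => (D.comp n t ω i * D.comp n t ω j) ^ 8) μ := fun t => by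
      refine (((hM.integrable_pow n t i).add (hM.integrable_pow n t j)).div_const 2).mono'
        (((h.measurable_comp n t i).mul (h.measurable_comp n t j)).pow_const 8).aestronglyMeasurable
        (ae_of_all _ fun ω => ?_)
      rw [Real.norm_eq_abs, abs_of_nonneg ((by decide : Even 8).pow_nonneg _)]
      exact hle8 _ _
    have key := (hM.mixing n).concentration hM.c_pos hM.p_pos (h.measurable_state n)
      (V := fun t ω => D.comp n t ω i * D.comp n t ω j) (fun t => (hmeas t i).mul (hmeas t j))
      (κ := κ) hint (fun t => ?_) (T := D.T n) (y := y) (L := Real.log (D.N n))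
      (τ := 2 * Real.exp (-(√y / b) ^ ρ)) h3 hy10 (by nlinarith [hM.κ_nonneg]) hlog
      (by rw [hy6]; exact h2) (fun t => ?_)
    · simp_rw [h.integral_comp_mul] at key
      exact key
    · refine (integral_mono_of_nonneg (ae_of_all _ fun ω => (by decide : Even 8).pow_nonneg _)
        (((hM.integrable_pow n t i).add (hM.integrable_pow n t j)).div_const 2)
        (ae_of_all _ fun ω => hle8 _ _)).trans ?_
      simp only [Pi.add_apply]
      rw [integral_div, integral_add (hM.integrable_pow n t i) (hM.integrable_pow n t j)]
      linarith [hM.moment n t i, hM.moment n t j]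
    · have hsub : {ω | y < |D.comp n t ω i * D.comp n t ω j|} ⊆
          {ω | √y < |D.comp n t ω i|} ∪ {ω | √y < |D.comp n t ω j|} := by
        intro ω hω
        by_contra hcon
        simp only [Set.mem_union, Set.mem_ofPred_eq, not_or, not_lt] at hcon hω
        rw [abs_mul] at hω
        have := mul_le_mul hcon.1 hcon.2 (abs_nonneg _) (Real.sqrt_nonneg _)
        rw [Real.mul_self_sqrt (by linarith)] at this
        linarith
      refine (measureReal_mono hsub).trans ((measureReal_union_le _ _).trans ?_)
      linarith [hM.tail n t i √y hbs, hM.tail n t j √y hbs]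
  -- Union over the (N + r)² pairs of components.
  have hcompl : (D.goodEvent μ (2 * (varConst (1 + κ) c p + 5)) n)ᶜ ⊆ ⋃ i, ⋃ j,
      {ω | 2 * (varConst (1 + κ) c p + 5) * √(D.T n * Real.log (D.N n)) <
      |∑ t ∈ D.times n, (D.comp n t ω i * D.comp n t ω j - D.secondMoment μ n i j)|} := by
    intro ω hω
    simp only [goodEvent, Set.mem_compl_iff, Set.mem_ofPred_eq, not_forall, not_le] at hω
    simpa only [Set.mem_iUnion, Set.mem_ofPred_eq] using hω
  refine ENNReal.le_ofReal_iff_toReal_le (measure_ne_top _ _) (by positivity) |>.2 ?_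
  refine (measureReal_mono hcompl).trans ((measureReal_iUnion_fintype_le _).trans
    ((Finset.sum_le_sum fun i _ => (measureReal_iUnion_fintype_le _).trans
      (Finset.sum_le_sum fun j _ => hpair i j)).trans ?_))
  simp only [Finset.sum_const, Finset.card_univ, Fintype.card_sum, Fintype.card_fin, nsmul_eq_mul]
  rw [← mul_assoc, sq]
  push_cast
  exact le_rfl

end FactorModel

/-! ### Moments of linear combinations and cross-sectional averages -/

namespace FactorModel

variable {Ω : Type*} [MeasurableSpace Ω] {μ : Measure Ω} {D : FactorModel Ω}
  [IsProbabilityMeasure μ] {κ c p b ρ : ℝ}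

lemma ModelBounds.memLp_comp (hM : D.ModelBounds μ κ c p b ρ) (h : D.Dynamics μ) (n : ℕ) (t : ℤ)
    (i : Fin (D.N n) ⊕ Fin D.r) : MemLp (fun ω => D.comp n t ω i) 2 μ :=
  (memLp_two_iff_integrable_sq (h.measurable_comp n t i).aestronglyMeasurable).2
    (integrable_of_integrable_pow (h.measurable_comp n t i) (by norm_num) (by decide)
      (hM.integrable_pow n t i))

lemma ModelBounds.memLp_u (hM : D.ModelBounds μ κ c p b ρ) (h : D.Dynamics μ) (n : ℕ) (t : ℤ)
    (i : Fin (D.N n)) : MemLp (fun ω => D.u n t ω i) 2 μ :=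
  hM.memLp_comp h n t (.inl i)

lemma Dynamics.measurable_u_apply (h : D.Dynamics μ) (n : ℕ) (t : ℤ) (i : Fin (D.N n)) :
    Measurable fun ω => D.u n t ω i :=
  (measurable_pi_apply i).comp (h.measurable_u n t)

lemma ModelBounds.sigu_eq_secondMoment (hM : D.ModelBounds μ κ c p b ρ) (h : D.Dynamics μ) (n : ℕ)
    (i j : Fin (D.N n)) : D.Sigu μ n i j = D.secondMoment μ n (.inl i) (.inl j) := by
  rw [Sigu, of_apply, covariance_eq_sub (hM.memLp_u h n 1 i) (hM.memLp_u h n 1 j), h.mean_u,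
    zero_mul, sub_zero]
  rfl

lemma ModelBounds.integral_u_mul (hM : D.ModelBounds μ κ c p b ρ) (h : D.Dynamics μ) (n : ℕ)
    (t : ℤ) (i j : Fin (D.N n)) : ∫ ω, D.u n t ω i * D.u n t ω j ∂μ = D.Sigu μ n i j := by
  rw [hM.sigu_eq_secondMoment h]
  exact h.integral_comp_mul n t (.inl i) (.inl j)

lemma sigu_transpose (D : FactorModel Ω) (μ : Measure Ω) (n : ℕ) :
    (D.Sigu μ n)ᵀ = D.Sigu μ n := by
  ext i j; simp [Sigu, covariance_comm]

lemma sigu_symm (D : FactorModel Ω) (μ : Measure Ω) (n : ℕ) (i j : Fin (D.N n)) :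
    D.Sigu μ n i j = D.Sigu μ n j i := by
  simp [Sigu, covariance_comm]

lemma Dynamics.measurable_dotProduct (h : D.Dynamics μ) (n : ℕ) (t : ℤ) (x : Fin (D.N n) → ℝ) :
    Measurable fun ω => x ⬝ᵥ D.u n t ω := by
  have := h.measurable_u_apply n t
  simp only [dotProduct]
  fun_prop

lemma ModelBounds.memLp_dotProduct (hM : D.ModelBounds μ κ c p b ρ) (h : D.Dynamics μ) (n : ℕ)
    (t : ℤ) (x : Fin (D.N n) → ℝ) : MemLp (fun ω => x ⬝ᵥ D.u n t ω) 2 μ := by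
  simp only [dotProduct]
  exact memLp_finsetSum _ fun i _ => (hM.memLp_u h n t i).const_mul (x i)

/-- The variance of a linear combination of the errors. -/
lemma ModelBounds.integral_dotProduct_sq (hM : D.ModelBounds μ κ c p b ρ) (h : D.Dynamics μ)
    (n : ℕ) (t : ℤ) (x : Fin (D.N n) → ℝ) :
    ∫ ω, (x ⬝ᵥ D.u n t ω) ^ 2 ∂μ = x ⬝ᵥ D.Sigu μ n *ᵥ x := by
  have hi : ∀ i j, Integrable (fun ω => D.u n t ω i * D.u n t ω j) μ := fun i j =>
    (hM.memLp_u h n t i).integrable_mul (hM.memLp_u h n t j)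
  calc ∫ ω, (x ⬝ᵥ D.u n t ω) ^ 2 ∂μ
      = ∫ ω, ∑ i, ∑ j, x i * x j * (D.u n t ω i * D.u n t ω j) ∂μ := by
        congr 1; ext ω
        rw [sq, dotProduct, Finset.sum_mul_sum]
        exact Finset.sum_congr rfl fun i _ => Finset.sum_congr rfl fun j _ => by ring
    _ = ∑ i, ∑ j, x i * x j * D.Sigu μ n i j := by
        rw [integral_finsetSum _ fun i _ => integrable_finsetSum _ fun j _ =>
          (hi i j).const_mul _]
        refine Finset.sum_congr rfl fun i _ => ?_
        rw [integral_finsetSum _ fun j _ => (hi i j).const_mul _]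
        refine Finset.sum_congr rfl fun j _ => ?_
        rw [integral_const_mul, hM.integral_u_mul h]
    _ = _ := by
        simp only [dotProduct, mulVec, Finset.mul_sum]
        exact Finset.sum_congr rfl fun i _ => Finset.sum_congr rfl fun j _ => by ring

/-- The cross-sectional average of the errors weighted by the loadings on factor `a`. -/
def loadAvg (D : FactorModel Ω) (n : ℕ) (a : Fin D.r) (t : ℤ) (ω : Ω) : ℝ :=
  (D.N n : ℝ)⁻¹ * (D.Lam n).col a ⬝ᵥ D.u n t ω

/-- The centred time average of `loadAvg` times an error, that is, an entry of
`N⁻¹ (T⁻¹ ∑ u_t u_t' - Σ_u) Λ`. -/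
def crossAvg (D : FactorModel Ω) (μ : Measure Ω) (n : ℕ) (i : Fin (D.N n)) (a : Fin D.r)
    (ω : Ω) : ℝ :=
  (D.T n : ℝ)⁻¹ * ∑ s ∈ D.times n, (D.loadAvg n a s ω * D.u n s ω i -
    ∫ ω', D.loadAvg n a s ω' * D.u n s ω' i ∂μ)

lemma Dynamics.measurable_loadAvg (h : D.Dynamics μ) (n : ℕ) (a : Fin D.r) (t : ℤ) :
    Measurable (D.loadAvg n a t) :=
  (h.measurable_dotProduct n t _).const_mul _

/-- High moments of the weighted cross-sectional averages. -/
lemma ModelBounds.loadAvg_pow (hM : D.ModelBounds μ κ c p b ρ) (h : D.Dynamics μ) {L : ℝ}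
    (hL : ∀ n v a, |D.Lam n v a| ≤ L) {n : ℕ} (hn : D.N n ≠ 0) (a : Fin D.r) (t : ℤ) :
    Integrable (fun ω => D.loadAvg n a t ω ^ 16) μ ∧
    ∫ ω, D.loadAvg n a t ω ^ 16 ∂μ ≤ L ^ 16 * κ := by
  have hN : (D.N n : ℝ) ≠ 0 := Nat.cast_ne_zero.2 hn
  have hle : ∀ ω, D.loadAvg n a t ω ^ 16 ≤ ∑ v, (D.N n : ℝ)⁻¹ * (L ^ 16 * D.u n t ω v ^ 16) := by
    intro ω
    -- Jensen's inequality over the cross section: no dependence structure is needed for the high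
    -- moments.
    have e1 := Real.pow_arith_mean_le_arith_mean_pow_of_even Finset.univ
      (fun _ : Fin (D.N n) => (D.N n : ℝ)⁻¹) (fun v => D.Lam n v a * D.u n t ω v)
      (fun _ _ => by positivity) (by simp [hN]) (n := 16) (by decide)
    rw [← Finset.mul_sum] at e1
    refine (le_of_eq ?_).trans (e1.trans (Finset.sum_le_sum fun v _ => ?_))
    · rfl
    · rw [mul_pow]
      have e2 : D.Lam n v a ^ 16 ≤ L ^ 16 := by
        rw [← (by decide : Even 16).pow_abs]
        exact pow_le_pow_left₀ (abs_nonneg _) (hL n v a) _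
      have e3 : 0 ≤ D.u n t ω v ^ 16 := (by decide : Even 16).pow_nonneg _
      gcongr
  have hi : ∀ v, Integrable (fun ω => (D.N n : ℝ)⁻¹ * (L ^ 16 * D.u n t ω v ^ 16)) μ := fun v =>
    ((hM.integrable_pow n t (.inl v)).const_mul _).const_mul _
  have hI := integrable_finsetSum Finset.univ fun v _ => hi v
  have h0 : ∀ ω, 0 ≤ D.loadAvg n a t ω ^ 16 := fun ω => (by decide : Even 16).pow_nonneg _
  refine ⟨hI.mono' ((h.measurable_loadAvg n a t).pow_const _).aestronglyMeasurable
    (ae_of_all _ fun ω => ?_), ?_⟩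
  · rw [Real.norm_eq_abs, abs_of_nonneg (h0 ω)]
    exact hle ω
  · refine (integral_mono_of_nonneg (ae_of_all _ h0) hI (ae_of_all _ hle)).trans ?_
    rw [integral_finsetSum _ fun v _ => hi v]
    calc ∑ v, ∫ ω, (D.N n : ℝ)⁻¹ * (L ^ 16 * D.u n t ω v ^ 16) ∂μ
        ≤ ∑ v : Fin (D.N n), (D.N n : ℝ)⁻¹ * (L ^ 16 * κ) := by
          refine Finset.sum_le_sum fun v _ => ?_
          rw [integral_const_mul, integral_const_mul]
          have := hM.moment n t (.inl v)
          have h16 : 0 ≤ L ^ 16 := (by decide : Even 16).pow_nonneg _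
          gcongr
          exact this
      _ = L ^ 16 * κ := by simp [hN]

/-- Weighted cross-sectional averages have variance of order `1 / N`. -/
lemma ModelBounds.loadAvg_sq (hM : D.ModelBounds μ κ c p b ρ) (h : D.Dynamics μ) {L c₁ : ℝ}
    (hc₁ : 0 ≤ c₁) (hL : ∀ n v a, |D.Lam n v a| ≤ L) {n : ℕ}
    (hS : ∀ x, x ⬝ᵥ D.Sigu μ n *ᵥ x ≤ c₁ * ‖WithLp.toLp 2 x‖ ^ 2)
    (hn : D.N n ≠ 0) (a : Fin D.r) (t : ℤ) :
    ∫ ω, D.loadAvg n a t ω ^ 2 ∂μ ≤ c₁ * L ^ 2 / D.N n := by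
  have hN : (D.N n : ℝ) ≠ 0 := Nat.cast_ne_zero.2 hn
  simp only [loadAvg, mul_pow]
  rw [integral_const_mul, hM.integral_dotProduct_sq h]
  have e1 := hS ((D.Lam n).col a)
  rw [norm_sq_toLp] at e1
  have e2 : ∑ i, (D.Lam n).col a i ^ 2 ≤ ∑ i : Fin (D.N n), L ^ 2 := by
    refine Finset.sum_le_sum fun i _ => ?_
    rw [← sq_abs]
    exact pow_le_pow_left₀ (abs_nonneg _) (hL n i a) _
  simp only [Finset.sum_const, Finset.card_univ, Fintype.card_fin, nsmul_eq_mul] at e2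
  calc (D.N n : ℝ)⁻¹ ^ 2 * ((D.Lam n).col a ⬝ᵥ D.Sigu μ n *ᵥ (D.Lam n).col a)
      ≤ (D.N n : ℝ)⁻¹ ^ 2 * (c₁ * (D.N n * L ^ 2)) := by
        gcongr
        exact e1.trans (by gcongr)
    _ = _ := by field_simp

end FactorModel

/-! ### Variance of the averages over both dimensions -/

namespace FactorModel

variable {Ω : Type*} [MeasurableSpace Ω] {μ : Measure Ω} {D : FactorModel Ω}
  [IsProbabilityMeasure μ] {κ c p b ρ : ℝ}

lemma card_times (D : FactorModel Ω) (n : ℕ) : ((D.times n).card : ℝ) = D.T n := by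
  simp [times]

/-- The variance of `crossAvg` is of order `N^{-1/2} / T`. -/
lemma ModelBounds.exists_crossAvg_sq_le (hM : D.ModelBounds μ κ c p b ρ) (h : D.Dynamics μ)
    {L c₁ : ℝ} (hc₁ : 0 ≤ c₁) (hL : ∀ n v a, |D.Lam n v a| ≤ L)
    (hS : ∀ n x, x ⬝ᵥ D.Sigu μ n *ᵥ x ≤ c₁ * ‖WithLp.toLp 2 x‖ ^ 2) :
    ∃ K : ℝ, 0 ≤ K ∧ ∀ n, D.N n ≠ 0 → D.T n ≠ 0 → ∀ i a, MemLp (D.crossAvg μ n i a) 2 μ ∧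
      ∫ ω, D.crossAvg μ n i a ω ^ 2 ∂μ ≤ K / (√(D.N n) * D.T n) := by
  have hκ := hM.κ_nonneg
  have hL16 : 0 ≤ L ^ 16 := (by decide : Even 16).pow_nonneg _
  set κ₄ := ((1 + L ^ 16 * κ) + (1 + κ)) / 2 with hκ₄
  set κ₂ := c₁ * L ^ 2 + ((1 + L ^ 16 * κ) + κ) / 2 with hκ₂
  have hκ₂0 : 0 ≤ κ₂ := by positivity
  refine ⟨κ₂ ^ (2 / 3 : ℝ) * (4 + 2 * (1 + 2 * κ₄) + 2 * (1 + κ₄) ^ 2) ^ (1 / 3 : ℝ) *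
    ∑' d : ℤ, expRate (c * (1 / 9)) p d.natAbs, ?_, fun n hn hT i a => ?_⟩
  · have : 0 ≤ ∑' d : ℤ, expRate (c * (1 / 9)) p d.natAbs := tsum_nonneg fun d => (expRate_pos _ _ _).le
    positivity
  have hN : (0 : ℝ) < D.N n := Nat.cast_pos.2 (Nat.pos_of_ne_zero hn)
  have hT0 : (0 : ℝ) < D.T n := Nat.cast_pos.2 (Nat.pos_of_ne_zero hT)
  -- y = N^{1/4} is the level at which u² is split. The averages have second moment of order 1/N, so
  -- both parts of the bound `hV2` integrate to order y^{-3} = N^{-3/4}.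
  set y := √(√(D.N n : ℝ)) with hy
  have hy0 : 0 < y := by positivity
  have hy2 : y ^ 2 = √(D.N n : ℝ) := Real.sq_sqrt (by positivity)
  have hy4 : y ^ 4 = D.N n := by
    rw [show y ^ 4 = (y ^ 2) ^ 2 by ring, hy2, Real.sq_sqrt hN.le]
  have ma := h.measurable_loadAvg n a
  have mu := fun t => h.measurable_u_apply n t i
  have ha := hM.loadAvg_pow h hL hn a
  have ha8 : ∀ t, Integrable (fun ω => D.loadAvg n a t ω ^ 8) μ := fun t =>
    integrable_of_integrable_pow (ma t) (by norm_num) (by decide) (ha t).1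
  have ha4 : ∀ t, Integrable (fun ω => D.loadAvg n a t ω ^ 4) μ := fun t =>
    integrable_of_integrable_pow (ma t) (by norm_num) (by decide) (ha t).1
  have ha2 : ∀ t, Integrable (fun ω => D.loadAvg n a t ω ^ 2) μ := fun t =>
    integrable_of_integrable_pow (ma t) (by norm_num) (by decide) (ha t).1
  have hu16 : ∀ t, Integrable (fun ω => D.u n t ω i ^ 16) μ := fun t =>
    hM.integrable_pow n t (.inl i)
  have hu8 : ∀ t, Integrable (fun ω => D.u n t ω i ^ 8) μ := fun t =>
    integrable_of_integrable_pow (mu t) (by norm_num) (by decide) (hu16 t)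
  have hV4 : ∀ t ω, (D.loadAvg n a t ω * D.u n t ω i) ^ 4 ≤
      (D.loadAvg n a t ω ^ 8 + D.u n t ω i ^ 8) / 2 := fun t ω => by
    nlinarith [sq_nonneg (D.loadAvg n a t ω ^ 4 - D.u n t ω i ^ 4)]
  have hV2 : ∀ t ω, (D.loadAvg n a t ω * D.u n t ω i) ^ 2 ≤ y * D.loadAvg n a t ω ^ 2 +
      (D.loadAvg n a t ω ^ 4 + D.u n t ω i ^ 16) / 2 / y ^ 3 := fun t ω => by
    generalize D.loadAvg n a t ω = A
    generalize D.u n t ω i = u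
    have e1 : u ^ 2 ≤ y + u ^ 8 / y ^ 3 := by
      rcases le_total (u ^ 2) y with e | e
      · have : 0 ≤ u ^ 8 / y ^ 3 := by positivity
        linarith
      · have : u ^ 2 * y ^ 3 ≤ u ^ 2 * (u ^ 2) ^ 3 := by gcongr
        have : u ^ 2 ≤ u ^ 8 / y ^ 3 := by
          rw [le_div_iff₀ (by positivity)]
          nlinarith
        linarith
    have e2 : A ^ 2 * u ^ 8 ≤ (A ^ 4 + u ^ 16) / 2 := by
      nlinarith [sq_nonneg (A ^ 2 - u ^ 8)]
    calc (A * u) ^ 2 = A ^ 2 * u ^ 2 := by ring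
      _ ≤ A ^ 2 * (y + u ^ 8 / y ^ 3) := by gcongr
      _ = y * A ^ 2 + A ^ 2 * u ^ 8 / y ^ 3 := by ring
      _ ≤ _ := by gcongr
  have mV : ∀ t, Measurable[MeasurableSpace.comap (fun ω => (D.u n t ω, D.f t ω)) inferInstance]
      fun ω => D.loadAvg n a t ω * D.u n t ω i := fun t => by
    have : Measurable fun z : (Fin (D.N n) → ℝ) × (Fin D.r → ℝ) =>
        (D.N n : ℝ)⁻¹ * (D.Lam n).col a ⬝ᵥ z.1 * z.1 i := by
      simp only [dotProduct]
      fun_prop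
    exact this.comp (comap_measurable _)
  have hint4 : ∀ t, Integrable (fun ω => (D.loadAvg n a t ω * D.u n t ω i) ^ 4) μ := fun t => by
    refine (((ha8 t).add (hu8 t)).div_const 2).mono'
      (((ma t).mul (mu t)).pow_const 4).aestronglyMeasurable (ae_of_all _ fun ω => ?_)
    rw [Real.norm_eq_abs, abs_of_nonneg ((by decide : Even 4).pow_nonneg _)]
    exact hV4 t ω
  have key := (hM.mixing n).integral_centered_sum_sq_le_of_small hM.c_pos hM.p_pos
    (h.measurable_state n) mV (κ := κ₄) (σ := κ₂ / y ^ 3) hint4 (fun t => ?_) (fun t => ?_)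
    (D.times n)
  · have hm1 : ∀ t, MemLp (fun ω => D.loadAvg n a t ω * D.u n t ω i -
        ∫ ω', D.loadAvg n a t ω' * D.u n t ω' i ∂μ) 2 μ := fun t =>
      ((memLp_two_iff_integrable_sq ((ma t).mul (mu t)).aestronglyMeasurable).2
        (integrable_of_integrable_pow ((ma t).mul (mu t)) (by norm_num) (by decide)
          (hint4 t))).sub (memLp_const _)
    refine ⟨(memLp_finsetSum _ fun t _ => hm1 t).const_mul _, ?_⟩
    simp only [crossAvg, mul_pow]
    rw [integral_const_mul]
    refine (mul_le_mul_of_nonneg_left key (by positivity)).trans (le_of_eq ?_)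
    -- The interpolation power 2/3 turns N^{-3/4} into N^{-1/2}.
    have e3 : (κ₂ / y ^ 3) ^ (2 / 3 : ℝ) = κ₂ ^ (2 / 3 : ℝ) / √(D.N n : ℝ) := by
      rw [Real.div_rpow hκ₂0 (by positivity), ← hy2, ← Real.rpow_natCast y 3,
        ← Real.rpow_mul hy0.le, ← Real.rpow_natCast y 2]
      norm_num
    rw [e3, card_times]
    have : √(D.N n : ℝ) ≠ 0 := by positivity
    field_simp
  · refine (integral_mono_of_nonneg (ae_of_all _ fun ω => (by decide : Even 4).pow_nonneg _)
      (((ha8 t).add (hu8 t)).div_const 2) (ae_of_all _ (hV4 t))).trans ?_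
    simp only [Pi.add_apply]
    rw [integral_div, integral_add (ha8 t) (hu8 t), hκ₄]
    have e1 := integral_pow_le (by norm_num) (by decide : Even 8) (by decide) (ha t).1 (ha t).2
    have e2 := integral_pow_le (by norm_num) (by decide : Even 8) (by decide) (hu16 t)
      (hM.moment n t (.inl i))
    linarith
  · have hI1 := (ha2 t).const_mul y
    have hI2 := (((ha4 t).add (hu16 t)).div_const 2).div_const (y ^ 3)
    refine (integral_mono_of_nonneg (ae_of_all _ fun ω => sq_nonneg _)
      (hI1.add hI2) (ae_of_all _ (hV2 t))).trans ?_
    rw [integral_add' hI1 hI2]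
    simp only [Pi.add_apply]
    rw [integral_const_mul, integral_div, integral_div, integral_add (ha4 t) (hu16 t)]
    have e1 := integral_pow_le (by norm_num) (by decide : Even 4) (by decide) (ha t).1 (ha t).2
    have e2 : ∫ ω, D.u n t ω i ^ 16 ∂μ ≤ κ := hM.moment n t (.inl i)
    have e3 := hM.loadAvg_sq h hc₁ hL (hS n) hn a t
    have e4 : c₁ * L ^ 2 / y ^ 3 = y * (c₁ * L ^ 2 / D.N n) := by
      rw [← hy4]; field_simp
    rw [hκ₂, add_div (c₁ * L ^ 2), e4]
    gcongr

end FactorModel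

/-! ### Comparison of row norms with other norms -/

section RowBounds

open scoped Matrix.Norms.L2Operator

lemma rowNorm_le_l2_opNorm {m n : Type*} [Fintype m] [Fintype n] [DecidableEq m] [DecidableEq n]
    (A : Matrix m n ℝ) (i : m) : rowNorm A i ≤ ‖A‖ := by
  have h := rowNorm_mul_le (1 : Matrix m m ℝ) A i
  have h1 : rowNorm (1 : Matrix m m ℝ) i = 1 := by
    have : rowNorm (1 : Matrix m m ℝ) i ^ 2 = 1 := by
      rw [rowNorm_sq]
      simp [Matrix.one_apply]
    nlinarith [rowNorm_nonneg (1 : Matrix m m ℝ) i]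
  rwa [Matrix.one_mul, h1, one_mul] at h

lemma abs_apply_le_rowNorm {m n : Type*} [Fintype m] [Fintype n] [DecidableEq m]
    [DecidableEq n] (A : Matrix m n ℝ) (i : m) (j : n) :
    |A i j| ≤ rowNorm A i := by
  refine abs_le_of_sq_le_sq ?_ (rowNorm_nonneg _ _)
  rw [rowNorm, norm_sq_toLp]
  exact Finset.single_le_sum (f := fun j => A i j ^ 2) (fun _ _ => sq_nonneg _) (Finset.mem_univ j)

lemma rowNorm_le_sum_abs {m n : Type*} [Fintype m] [Fintype n] [DecidableEq m]
    [DecidableEq n] (A : Matrix m n ℝ) (i : m) :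
    rowNorm A i ≤ ∑ j, |A i j| := by
  refine le_of_sq_le_sq ?_ (Finset.sum_nonneg fun _ _ => abs_nonneg _)
  rw [rowNorm, norm_sq_toLp]
  calc ∑ j, A i j ^ 2 = ∑ j, |A i j| * |A i j| := by simp [← sq]
    _ ≤ ∑ j, |A i j| * ∑ k, |A i k| := by
        gcongr with j
        exact Finset.single_le_sum (f := fun k => |A i k|) (fun _ _ => abs_nonneg _)
          (Finset.mem_univ j)
    _ = (∑ j, |A i j|) ^ 2 := by rw [← Finset.sum_mul, sq]

end RowBounds

/-! ### Sample moment matrices and the signal-plus-noise form of S_y -/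

namespace FactorModel

variable {Ω : Type*} [MeasurableSpace Ω] {μ : Measure Ω} {D : FactorModel Ω}

/-- Sample second moments of the errors. -/
def sampleUU (D : FactorModel Ω) (n : ℕ) (ω : Ω) : Matrix (Fin (D.N n)) (Fin (D.N n)) ℝ :=
  (D.T n : ℝ)⁻¹ • ∑ t ∈ D.times n, vecMulVec (D.u n t ω) (D.u n t ω)

/-- Sample cross moments of the errors and the factors. -/
def sampleUF (D : FactorModel Ω) (n : ℕ) (ω : Ω) : Matrix (Fin (D.N n)) (Fin D.r) ℝ :=
  (D.T n : ℝ)⁻¹ • ∑ t ∈ D.times n, vecMulVec (D.u n t ω) (D.f t ω)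

/-- Sample second moments of the factors. -/
def sampleFF (D : FactorModel Ω) (n : ℕ) (ω : Ω) : Matrix (Fin D.r) (Fin D.r) ℝ :=
  (D.T n : ℝ)⁻¹ • ∑ t ∈ D.times n, vecMulVec (D.f t ω) (D.f t ω)

lemma sy_eq (D : FactorModel Ω) (n : ℕ) (ω : Ω) :
    D.Sy n ω = D.Lam n * D.sampleFF n ω * (D.Lam n)ᵀ + D.Lam n * (D.sampleUF n ω)ᵀ +
      D.sampleUF n ω * (D.Lam n)ᵀ + D.sampleUU n ω := by
  have h1 : ∀ t, vecMulVec (D.Y n t ω) (D.Y n t ω) =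
      D.Lam n * vecMulVec (D.f t ω) (D.f t ω) * (D.Lam n)ᵀ +
      D.Lam n * (vecMulVec (D.u n t ω) (D.f t ω))ᵀ +
      vecMulVec (D.u n t ω) (D.f t ω) * (D.Lam n)ᵀ + vecMulVec (D.u n t ω) (D.u n t ω) := fun t => by
    rw [transpose_vecMulVec, mul_vecMulVec, mul_vecMulVec, vecMulVec_mul, vecMulVec_mul,
      vecMul_transpose, Y, vecMulVec_add, add_vecMulVec, add_vecMulVec]
    abel
  simp only [Sy, sampleUU, sampleUF, sampleFF, h1, Finset.sum_add_distrib, smul_add,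
    transpose_smul, transpose_sum, Matrix.mul_smul, Matrix.smul_mul, Matrix.mul_sum, Matrix.sum_mul]

lemma sampleUU_apply (D : FactorModel Ω) (n : ℕ) (ω : Ω) (i j) :
    D.sampleUU n ω i j = (D.T n : ℝ)⁻¹ * ∑ t ∈ D.times n, D.u n t ω i * D.u n t ω j := by
  simp [sampleUU, Matrix.sum_apply, vecMulVec_apply]

lemma sampleUF_apply (D : FactorModel Ω) (n : ℕ) (ω : Ω) (i j) :
    D.sampleUF n ω i j = (D.T n : ℝ)⁻¹ * ∑ t ∈ D.times n, D.u n t ω i * D.f t ω j := by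
  simp [sampleUF, Matrix.sum_apply, vecMulVec_apply]

lemma sampleFF_apply (D : FactorModel Ω) (n : ℕ) (ω : Ω) (i j) :
    D.sampleFF n ω i j = (D.T n : ℝ)⁻¹ * ∑ t ∈ D.times n, D.f t ω i * D.f t ω j := by
  simp [sampleFF, Matrix.sum_apply, vecMulVec_apply]

lemma sampleUU_transpose (D : FactorModel Ω) (n : ℕ) (ω : Ω) :
    (D.sampleUU n ω)ᵀ = D.sampleUU n ω := by
  ext i j; simp only [transpose_apply, sampleUU_apply, mul_comm]

lemma sampleFF_transpose (D : FactorModel Ω) (n : ℕ) (ω : Ω) :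
    (D.sampleFF n ω)ᵀ = D.sampleFF n ω := by
  ext i j; simp only [transpose_apply, sampleFF_apply, mul_comm]

lemma sampleUU_quadForm_nonneg (D : FactorModel Ω) (n : ℕ) (ω : Ω) (x : Fin (D.N n) → ℝ) :
    0 ≤ x ⬝ᵥ D.sampleUU n ω *ᵥ x := by
  rw [sampleUU, smul_mulVec, sum_mulVec, dotProduct_smul, dotProduct_sum, smul_eq_mul]
  refine mul_nonneg (by positivity) (Finset.sum_nonneg fun t _ => ?_)
  rw [vecMulVec_mulVec, dotProduct_smul, dotProduct_comm]
  simpa using mul_self_nonneg _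

/-- On the good event, sample second moments are within `A √(log N / T)` of the population ones. -/
lemma abs_sample_sub_le {A : ℝ} {n : ℕ} (hT : D.T n ≠ 0) {ω : Ω}
    (hω : ω ∈ D.goodEvent μ A n) (i j : Fin (D.N n) ⊕ Fin D.r) :
    |(D.T n : ℝ)⁻¹ * ∑ t ∈ D.times n, D.comp n t ω i * D.comp n t ω j - D.secondMoment μ n i j| ≤
      A * √(Real.log (D.N n) / D.T n) := by
  have hT0 : (0 : ℝ) < D.T n := Nat.cast_pos.2 (Nat.pos_of_ne_zero hT)
  have h1 := hω i j
  rw [Finset.sum_sub_distrib, Finset.sum_const, nsmul_eq_mul, card_times] at h1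
  have e1 : (D.T n : ℝ)⁻¹ * ∑ t ∈ D.times n, D.comp n t ω i * D.comp n t ω j -
      D.secondMoment μ n i j = (D.T n : ℝ)⁻¹ * (∑ t ∈ D.times n, D.comp n t ω i * D.comp n t ω j -
      D.T n * D.secondMoment μ n i j) := by
    field_simp
  have e2 : √(Real.log (D.N n) / D.T n) = (D.T n : ℝ)⁻¹ * √(D.T n * Real.log (D.N n)) := by
    rw [Real.sqrt_div' _ hT0.le, Real.sqrt_mul hT0.le]
    have := Real.mul_self_sqrt hT0.le
    have h0 : √(D.T n : ℝ) ≠ 0 := by positivity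
    field_simp
    rw [sq, this]
  rw [e1, abs_mul, abs_of_pos (inv_pos.2 hT0), e2]
  calc (D.T n : ℝ)⁻¹ * _ ≤ (D.T n : ℝ)⁻¹ * (A * √(D.T n * Real.log (D.N n))) := by gcongr
    _ = _ := by ring

variable [IsProbabilityMeasure μ] {κ c p b ρ : ℝ}

/-- Exchanging the sums over v and over time identifies the entries of (E - Σ_u)Λ/N in the residual
bound with centred time averages of a function of the state, to which the mixing variance bound
applies. -/
lemma ModelBounds.crossAvg_eq (hM : D.ModelBounds μ κ c p b ρ) (h : D.Dynamics μ) {n : ℕ}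
    (hT : D.T n ≠ 0) (i : Fin (D.N n)) (a : Fin D.r) (ω : Ω) :
    D.crossAvg μ n i a ω =
      (D.N n : ℝ)⁻¹ * ((D.sampleUU n ω - D.Sigu μ n) * D.Lam n) i a := by
  have hT0 : (D.T n : ℝ) ≠ 0 := Nat.cast_ne_zero.2 hT
  have hi : ∀ t v, Integrable (fun ω => D.u n t ω i * D.u n t ω v) μ := fun t v =>
    (hM.memLp_u h n t i).integrable_mul (hM.memLp_u h n t v)
  have e0 : ∀ t ω, D.loadAvg n a t ω * D.u n t ω i =
      (D.N n : ℝ)⁻¹ * ∑ v, D.u n t ω i * D.u n t ω v * D.Lam n v a := fun t ω => by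
    rw [loadAvg, mul_assoc, dotProduct, Finset.sum_mul]
    congr 1
    exact Finset.sum_congr rfl fun v _ => by simp only [col_apply]; ring
  have e1 : ∀ t, ∫ ω, D.loadAvg n a t ω * D.u n t ω i ∂μ =
      (D.N n : ℝ)⁻¹ * ∑ v, D.Sigu μ n i v * D.Lam n v a := fun t => by
    simp_rw [e0]
    rw [integral_const_mul, integral_finsetSum _ fun v _ => (hi t v).mul_const _]
    simp_rw [integral_mul_const, hM.integral_u_mul h]
  rw [crossAvg, Finset.sum_sub_distrib]
  simp_rw [e1, e0]
  rw [Finset.sum_const, nsmul_eq_mul, card_times, Matrix.sub_mul, Matrix.sub_apply, mul_sub,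
    Matrix.mul_apply, Matrix.mul_apply, mul_sub]
  congr 1
  · simp_rw [sampleUU_apply]
    rw [← Finset.mul_sum, Finset.sum_comm]
    simp_rw [mul_assoc, Finset.sum_mul, ← Finset.mul_sum]
    rw [mul_left_comm]
    simp_rw [mul_assoc]
  · field_simp

lemma ModelBounds.abs_secondMoment_le (hM : D.ModelBounds μ κ c p b ρ) (h : D.Dynamics μ) (n : ℕ)
    (i j : Fin (D.N n) ⊕ Fin D.r) : |D.secondMoment μ n i j| ≤ 1 + κ := by
  have hi := fun i => (hM.memLp_comp h n 1 i).integrable_sq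
  have hb := fun i => integral_pow_le (by norm_num) (by decide : Even 2) (by decide)
    (hM.integrable_pow n 1 i) (hM.moment n 1 i)
  refine abs_integral_le_integral_abs.trans ((integral_mono_of_nonneg
    (ae_of_all _ fun ω => abs_nonneg _) (((hi i).add (hi j)).div_const 2)
    (ae_of_all _ fun ω => ?_)).trans ?_)
  · simp only [Pi.add_apply, abs_mul]
    rw [← sq_abs (D.comp n 1 ω i), ← sq_abs (D.comp n 1 ω j)]
    nlinarith [sq_nonneg (|D.comp n 1 ω i| - |D.comp n 1 ω j|)]
  · simp only [Pi.add_apply]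
    rw [integral_div, integral_add (hi i) (hi j)]
    linarith [hb i, hb j]

/-- Second moments of the factors dominate their covariances. -/
lemma ModelBounds.factor_quadForm_ge (hM : D.ModelBounds μ κ c p b ρ) (h : D.Dynamics μ) (n : ℕ)
    {c₂ : ℝ} (hf : ∀ y, c₂ * ‖WithLp.toLp 2 y‖ ^ 2 ≤ y ⬝ᵥ D.covf μ *ᵥ y) (y : Fin D.r → ℝ) :
    c₂ * ‖WithLp.toLp 2 y‖ ^ 2 ≤
      y ⬝ᵥ (Matrix.of fun a b => D.secondMoment μ n (.inr a) (.inr b)) *ᵥ y := by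
  have hm : ∀ a, MemLp (fun ω => D.f 1 ω a) 2 μ := fun a => hM.memLp_comp h n 1 (.inr a)
  -- The factors need not be centred: their second moment matrix is the covariance plus a positive
  -- semidefinite rank one term.
  have e1 : (Matrix.of fun a b => D.secondMoment μ n (.inr a) (.inr b)) =
      D.covf μ + vecMulVec (fun a => ∫ ω, D.f 1 ω a ∂μ) (fun a => ∫ ω, D.f 1 ω a ∂μ) := by
    ext a b
    simp only [covf, of_apply, Matrix.add_apply, vecMulVec_apply, covariance_eq_sub (hm a) (hm b)]
    rw [sub_add_cancel]
    rfl
  rw [e1, add_mulVec, dotProduct_add, vecMulVec_mulVec, dotProduct_smul]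
  refine (hf y).trans (le_add_of_nonneg_right ?_)
  rw [dotProduct_comm]
  simpa using mul_self_nonneg _

end FactorModel

/-! ### The residual on the good event -/

namespace FactorModel

open scoped Matrix.Norms.L2Operator

variable {Ω : Type*} [MeasurableSpace Ω] {μ : Measure Ω} {D : FactorModel Ω}

/-- The `ℓ¹` norm of row `i` of `N⁻¹ (T⁻¹ ∑ u_t u_t' - Σ_u) Λ`. -/
def crossNorm (D : FactorModel Ω) (μ : Measure Ω) (n : ℕ) (i : Fin (D.N n)) (ω : Ω) : ℝ :=
  ∑ a, |D.crossAvg μ n i a ω|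

lemma crossNorm_nonneg (n : ℕ) (i : Fin (D.N n)) (ω : Ω) : 0 ≤ D.crossNorm μ n i ω :=
  Finset.sum_nonneg fun _ _ => abs_nonneg _

lemma one_le_sqrt_mul_omegaT {n : ℕ} (hn : D.N n ≠ 0) : 1 ≤ √(D.N n : ℝ) * D.omegaT n := by
  have hN : (0 : ℝ) < D.N n := Nat.cast_pos.2 (Nat.pos_of_ne_zero hn)
  have h0 : √(D.N n : ℝ) ≠ 0 := by positivity
  rw [omegaT, mul_add, mul_one_div_cancel h0]
  have : 0 ≤ √(D.N n : ℝ) * √(Real.log (D.N n) / D.T n) := by positivity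
  linarith

lemma omegaT_pos {n : ℕ} (hn : D.N n ≠ 0) : 0 < D.omegaT n := by
  have h1 := one_le_sqrt_mul_omegaT (D := D) hn
  by_contra h
  nlinarith [Real.sqrt_nonneg (D.N n : ℝ)]

lemma sqrt_log_div_le_omegaT (D : FactorModel Ω) (n : ℕ) :
    √(Real.log (D.N n) / D.T n) ≤ D.omegaT n :=
  le_add_of_nonneg_right (by positivity)

lemma sum_le_mN (D : FactorModel Ω) (μ : Measure Ω) (q : ℝ) (n : ℕ) (i : Fin (D.N n)) :
    ∑ j, (if D.Sigu μ n i j = 0 then 0 else |D.Sigu μ n i j| ^ q) ≤ D.mN μ q n :=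
  le_ciSup (f := fun i => ∑ j, (if D.Sigu μ n i j = 0 then 0 else |D.Sigu μ n i j| ^ q))
    (Set.finite_range _).bddAbove i

lemma mN_nonneg (D : FactorModel Ω) (μ : Measure Ω) (q : ℝ) (n : ℕ) : 0 ≤ D.mN μ q n := by
  refine Real.iSup_nonneg fun i => Finset.sum_nonneg fun j _ => ?_
  split_ifs <;> positivity

/-- Entries are at most c₁, so |σ| ≤ c₁^{1-q}|σ|^q; the sparsity measure thus controls ℓ¹ row sums
and can play the role of ρ in `IsPCResidual.entry_bound`. -/
lemma sum_abs_sigu_le {q c₁ : ℝ} (hq : q ≤ 1) (hc₁ : 0 < c₁) {n : ℕ}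
    (hS : ‖D.Sigu μ n‖ ≤ c₁) (i : Fin (D.N n)) :
    ∑ j, |D.Sigu μ n i j| ≤ c₁ ^ (1 - q) * D.mN μ q n := by
  refine le_trans ?_ (mul_le_mul_of_nonneg_left (D.sum_le_mN μ q n i) (by positivity))
  rw [Finset.mul_sum]
  refine Finset.sum_le_sum fun j _ => ?_
  split_ifs with h0
  · simp [h0]
  · have hpos : 0 < |D.Sigu μ n i j| := abs_pos.2 h0
    calc |D.Sigu μ n i j| = |D.Sigu μ n i j| ^ (1 - q) * |D.Sigu μ n i j| ^ q := by
          rw [← Real.rpow_add hpos]; simp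
      _ ≤ _ := by
          gcongr
          exact (abs_apply_le_rowNorm _ _ _).trans ((rowNorm_le_l2_opNorm _ _).trans hS)

/-- Each summand is at most a multiple of w, so their sum is at most (2 + 3H)w. One constant is
arranged to serve the fine and the coarse bound. -/
lemma residual_bounds_aux {C H A w m hi hj s x y z : ℝ} (hC : 0 < C) (hA : 0 ≤ A) (hH : 0 ≤ H)
    (hw : 0 ≤ w) (hw1 : w ≤ 1) (hmw : m ≤ w) (hm : 0 ≤ m) (hi0 : 0 ≤ hi) (hj0 : 0 ≤ hj)
    (hs0 : 0 ≤ s) (hiw : hi ≤ H * w) (hjw : hj ≤ H * w) (hsw : s ≤ H * w)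
    (h1 : |x - y| ≤ C * (w ^ 2 + m + hi + hj + s)) (h2 : |y - z| ≤ A * w) :
    |x - y| ≤ (C * (2 + 3 * H) + A) * (w ^ 2 + m + hi + hj + s) ∧
    |x - z| ≤ (C * (2 + 3 * H) + A) * w := by
  have hw2 : w ^ 2 ≤ w := by
    rw [sq]; exact mul_le_of_le_one_left hw hw1
  constructor
  · refine h1.trans (mul_le_mul_of_nonneg_right ?_ (by positivity))
    have : C * 1 ≤ C * (2 + 3 * H) := mul_le_mul_of_nonneg_left (by linarith) hC.le
    linarith
  · have h3 : C * (w ^ 2 + m + hi + hj + s) ≤ C * ((2 + 3 * H) * w) :=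
      mul_le_mul_of_nonneg_left (by linarith) hC.le
    have h4 := abs_sub_le x y z
    linarith

variable [IsProbabilityMeasure μ] {κ c p b ρ : ℝ}

set_option maxHeartbeats 1000000 in
/-- On the good event, the principal component residual is close to the sample and to the
population covariance matrices of the errors. -/
theorem ModelBounds.exists_residual_bounds (hM : D.ModelBounds μ κ c p b ρ) (h : D.Dynamics μ)
    {c₁ c₂ A P q : ℝ} (hc₁ : 0 < c₁) (hc₂ : 0 < c₂) (hA : 0 < A) (hP : 0 ≤ P) (hq : q ≤ 1)
    (hS : ∀ n, ‖D.Sigu μ n‖ ≤ c₁) (hL : ∀ n j, rowNorm (D.Lam n) j ≤ c₁)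
    (hf : ∀ y, c₂ * ‖WithLp.toLp 2 y‖ ^ 2 ≤ y ⬝ᵥ D.covf μ *ᵥ y) :
    ∃ K ε : ℝ, 0 < K ∧ 0 < ε ∧ ∀ n, D.N n ≠ 0 → D.T n ≠ 0 → D.omegaT n ≤ ε →
      D.mN μ q n / D.N n ≤ D.omegaT n →
      (∀ y, √(D.N n : ℝ) * ‖WithLp.toLp 2 y‖ ≤ P * ‖WithLp.toLp 2 (D.Lam n *ᵥ y)‖) →
      ∀ ω ∈ D.goodEvent μ A n, ∀ R, IsPCResidual D.r (D.Sy n ω) R → ∀ i j,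
        |R i j - D.sampleUU n ω i j| ≤ K * (D.omegaT n ^ 2 + D.mN μ q n / D.N n +
          D.crossNorm μ n i ω + D.crossNorm μ n j ω +
          (∑ v, D.crossNorm μ n v ω) / D.N n) ∧
        |R i j - D.Sigu μ n i j| ≤ K * D.omegaT n := by
  have hκ := hM.κ_nonneg
  set r : ℝ := √(D.r : ℝ) with hr
  have hr0 : 0 ≤ r := Real.sqrt_nonneg _
  have hr2 : r ^ 2 = D.r := Real.sq_sqrt (by positivity)
  -- A single constant dominating all those required by `IsPCResidual.entry_bound`, each summand
  -- serving one hypothesis.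
  set K₀ := 1 + c₁ + P + r * (r * (1 + κ + A)) + 2 / c₂ + r * A + A + c₁ ^ (1 - q) with hK₀
  have hp1 : 0 ≤ r * (r * (1 + κ + A)) := by positivity
  have hp2 : 0 ≤ 2 / c₂ := by positivity
  have hp3 : 0 ≤ r * A := by positivity
  have hp4 : 0 ≤ c₁ ^ (1 - q) := by positivity
  have hK₀1 : 1 ≤ K₀ := by rw [hK₀]; linarith
  obtain ⟨C, ε, hC, hε, hmain⟩ := IsPCResidual.entry_bound D.r hK₀1
  set H := r ^ 2 * (A * c₁) with hH
  have hH0 : 0 ≤ H := by positivity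
  refine ⟨C * (2 + 3 * H) + A, min (min ε 1) (c₂ / (2 * (1 + r * (r * A)))), by positivity,
    by positivity, fun n hn hT hωε hmω hΛ' ω hω R hR i j => ?_⟩
  have hN : (0 : ℝ) < D.N n := Nat.cast_pos.2 (Nat.pos_of_ne_zero hn)
  have hω0 := omegaT_pos (D := D) hn
  set w := D.omegaT n with hw
  have hω1 : w ≤ 1 := hωε.trans ((min_le_left _ _).trans (min_le_right _ _))
  have hs2 : √(D.N n : ℝ) ^ 2 = D.N n := Real.sq_sqrt hN.le
  have hdev : ∀ i j, |(D.T n : ℝ)⁻¹ * ∑ t ∈ D.times n, D.comp n t ω i * D.comp n t ω j -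
      D.secondMoment μ n i j| ≤ A * w := fun i j =>
    (abs_sample_sub_le hT hω i j).trans
      (mul_le_mul_of_nonneg_left (D.sqrt_log_div_le_omegaT n) hA.le)
  have hE : ∀ i j, |D.sampleUU n ω i j - D.Sigu μ n i j| ≤ A * w := fun i j => by
    rw [sampleUU_apply, hM.sigu_eq_secondMoment h]
    exact hdev (.inl i) (.inl j)
  have hB : ∀ i, rowNorm (D.sampleUF n ω) i ≤ r * (A * w) := fun i => by
    refine rowNorm_le_of_abs_le _ hr0 (by positivity) (by simp [hr2]) i fun j => ?_
    have e1 := hdev (.inl i) (.inr j)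
    -- Here E u f = 0 enters, so that the cross moment matrix B itself is of order ω.
    have e2 : D.secondMoment μ n (.inl i) (.inr j) = 0 := h.mean_uf n 1 i j
    rw [e2, sub_zero] at e1
    rw [sampleUF_apply]
    exact e1
  set Γ : Matrix (Fin D.r) (Fin D.r) ℝ :=
    Matrix.of fun a b => D.secondMoment μ n (.inr a) (.inr b) with hΓ
  have hGΓ : ∀ a b, |(D.sampleFF n ω - Γ) a b| ≤ A * w := fun a b => by
    rw [Matrix.sub_apply, sampleFF_apply]
    exact hdev (.inr a) (.inr b)
  have hmat : ∀ (M : Matrix (Fin D.r) (Fin D.r) ℝ) {x : ℝ}, 0 ≤ x → (∀ a b, |M a b| ≤ x) →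
      ‖M‖ ≤ r * (r * x) := fun M x hx hM =>
    l2_opNorm_le_of_rowNorm_le _ hr0 (by positivity) (by simp [hr2]) fun a =>
      rowNorm_le_of_abs_le _ hr0 hx (by simp [hr2]) a (hM a)
  have hGn : ‖D.sampleFF n ω‖ ≤ r * (r * (1 + κ + A)) := by
    refine hmat _ (by positivity) fun a b => ?_
    have e1 := hGΓ a b
    have e2 : |Γ a b| ≤ 1 + κ := hM.abs_secondMoment_le h n (.inr a) (.inr b)
    have e3 := abs_sub_abs_le_abs_sub (D.sampleFF n ω a b) (Γ a b)
    rw [Matrix.sub_apply] at e1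
    nlinarith
  have hGq : ∀ y, ‖WithLp.toLp 2 y‖ ^ 2 ≤ 2 / c₂ * (y ⬝ᵥ D.sampleFF n ω *ᵥ y) := fun y => by
    have e1 := hM.factor_quadForm_ge h n hf y
    have e2 : D.sampleFF n ω = Γ + (D.sampleFF n ω - Γ) := by abel
    -- The last bound in ε keeps the sampling error of the factor moments below c₂/2, so half of the
    -- lower bound survives.
    have e3 : |y ⬝ᵥ (D.sampleFF n ω - Γ) *ᵥ y| ≤ c₂ / 2 * ‖WithLp.toLp 2 y‖ ^ 2 := by
      have e4 : ‖D.sampleFF n ω - Γ‖ ≤ c₂ / 2 := by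
        refine (hmat _ (by positivity) hGΓ).trans ?_
        have e5 : w ≤ c₂ / (2 * (1 + r * (r * A))) := hωε.trans (min_le_right _ _)
        rw [le_div_iff₀ (by positivity)] at e5
        nlinarith
      calc _ ≤ ‖WithLp.toLp 2 y‖ * (‖D.sampleFF n ω - Γ‖ * ‖WithLp.toLp 2 y‖) :=
            (abs_dotProduct_le _ _).trans (by gcongr; exact norm_mulVec_le _ _)
        _ ≤ ‖WithLp.toLp 2 y‖ * (c₂ / 2 * ‖WithLp.toLp 2 y‖) := by gcongr
        _ = _ := by ring
    rw [e2, add_mulVec, dotProduct_add, div_mul_eq_mul_div, le_div_iff₀ hc₂]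
    have := neg_abs_le (y ⬝ᵥ (D.sampleFF n ω - Γ) *ᵥ y)
    nlinarith
  have hrow : ∀ i, rowNorm ((D.sampleUU n ω - D.Sigu μ n) * D.Lam n) i / D.N n ≤
      D.crossNorm μ n i ω := fun i => by
    rw [div_le_iff₀ hN]
    refine (rowNorm_le_sum_abs _ _).trans (le_of_eq ?_)
    rw [crossNorm, Finset.sum_mul]
    refine Finset.sum_congr rfl fun a _ => ?_
    rw [hM.crossAvg_eq h hT, abs_mul, abs_of_pos (inv_pos.2 hN)]
    field_simp
  have hcross : ∀ i, D.crossNorm μ n i ω ≤ H * w := fun i => by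
    have e1 : ∀ a, |D.crossAvg μ n i a ω| ≤ A * c₁ * w := fun a => by
      rw [hM.crossAvg_eq h hT, abs_mul, abs_of_pos (inv_pos.2 hN), Matrix.mul_apply]
      calc (D.N n : ℝ)⁻¹ * |∑ v, (D.sampleUU n ω - D.Sigu μ n) i v * D.Lam n v a|
          ≤ (D.N n : ℝ)⁻¹ * ∑ v : Fin (D.N n), A * w * c₁ := by
            gcongr
            refine (Finset.abs_sum_le_sum_abs _ _).trans (Finset.sum_le_sum fun v _ => ?_)
            rw [abs_mul]
            gcongr
            · exact hE i v
            · exact (abs_apply_le_rowNorm _ _ _).trans (hL n v)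
        _ = A * c₁ * w := by
            simp only [Finset.sum_const, Finset.card_univ, Fintype.card_fin, nsmul_eq_mul]
            field_simp
    calc D.crossNorm μ n i ω ≤ ∑ a : Fin D.r, A * c₁ * w := Finset.sum_le_sum fun a _ => e1 a
      _ = H * w := by
        simp only [Finset.sum_const, Finset.card_univ, Fintype.card_fin, nsmul_eq_mul, hH, hr2]
        ring
  have key := hmain (Λ := D.Lam n) (B := D.sampleUF n ω) (G := D.sampleFF n ω)
    (E := D.sampleUU n ω) (Sg := D.Sigu μ n) (R := R) (s := √(D.N n : ℝ)) (ω := w)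
    (ρ := D.mN μ q n) (by positivity) hs2 (D.sampleUU_transpose n ω) (D.sampleFF_transpose n ω)
    (D.sy_eq n ω) (one_le_sqrt_mul_omegaT hn) (hωε.trans ((min_le_left _ _).trans (min_le_left _ _)))
    (fun i => (hL n i).trans (by rw [hK₀]; linarith))
    (fun y => (hΛ' y).trans (by gcongr; rw [hK₀]; linarith))
    (hGn.trans (by rw [hK₀]; linarith))
    (fun y => (hGq y).trans (by
      have e1 := hGq y
      have e2 : 0 ≤ y ⬝ᵥ D.sampleFF n ω *ᵥ y := by
        by_contra hcon
        push Not at hcon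
        have e3 : 2 / c₂ * (y ⬝ᵥ D.sampleFF n ω *ᵥ y) < 0 := mul_neg_of_pos_of_neg (by positivity) hcon
        nlinarith [sq_nonneg ‖WithLp.toLp 2 y‖]
      gcongr; rw [hK₀]; linarith))
    (fun i => (hB i).trans (by rw [← mul_assoc]; gcongr; rw [hK₀]; linarith))
    (D.sampleUU_quadForm_nonneg n ω)
    (fun i j => (hE i j).trans (by gcongr; rw [hK₀]; linarith))
    (fun i => (rowNorm_le_l2_opNorm _ _).trans ((hS n).trans (by rw [hK₀]; linarith)))
    (D.mN_nonneg μ q n)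
    (fun i => (sum_abs_sigu_le hq hc₁ (hS n) i).trans (by
      have := D.mN_nonneg μ q n
      gcongr; rw [hK₀]; linarith)) hR i j
  rw [hs2] at key
  have h1 : |R i j - D.sampleUU n ω i j| ≤ C * (w ^ 2 + D.mN μ q n / D.N n +
      D.crossNorm μ n i ω + D.crossNorm μ n j ω + (∑ v, D.crossNorm μ n v ω) / D.N n) := by
    refine key.trans ?_
    gcongr
    · exact hrow i
    · exact hrow j
    · exact hrow _
  have hsum0 : 0 ≤ (∑ v, D.crossNorm μ n v ω) / D.N n :=
    div_nonneg (Finset.sum_nonneg fun v _ => crossNorm_nonneg n v ω) hN.le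
  have hsum : (∑ v, D.crossNorm μ n v ω) / D.N n ≤ H * w := by
    rw [div_le_iff₀ hN]
    refine (Finset.sum_le_sum fun v _ => hcross v).trans (le_of_eq ?_)
    simp only [Finset.sum_const, Finset.card_univ, Fintype.card_fin, nsmul_eq_mul]
    ring
  exact residual_bounds_aux hC hA.le hH0 hω0.le hω1 hmω (div_nonneg (D.mN_nonneg μ q n) hN.le)
    (crossNorm_nonneg n i ω) (crossNorm_nonneg n j ω) hsum0 (hcross i) (hcross j) hsum h1
    (hE i j)

end FactorModel

/-! ### Asymptotic consequences of the sparsity rates -/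

section Rates

lemma inv_sqrt_log_div_rpow {N T q : ℝ} (hN : 1 < N) (hT : 0 < T) :
    (T / Real.log N) ^ ((1 - q) / 2) = (√(Real.log N / T) ^ (1 - q))⁻¹ := by
  have hl := Real.log_pos hN
  rw [Real.sqrt_eq_rpow, ← Real.rpow_mul (by positivity), ← Real.inv_rpow (by positivity), inv_div]
  congr 1
  ring

/-- Consequences of the growth conditions on the sparsity measure `m`. -/
structure GrowthRates (N T : ℕ → ℕ) (m : ℕ → ℝ) (q : ℝ) (w : ℕ → ℝ) : Prop where
  growth : Tendsto (fun n => √(N n : ℝ) * Real.log (N n) / T n) atTop (𝓝 0)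
  w_zero : Tendsto w atTop (𝓝 0)
  quarter : Tendsto (fun n => m n * w n ^ (1 - q) * (N n : ℝ) ^ (1 / 4 : ℝ)) atTop (𝓝 0)
  m_div : Tendsto (fun n => m n / √(N n : ℝ)) atTop (𝓝 0)
  sqrt_mul_sq : Tendsto (fun n => √(N n : ℝ) * w n ^ 2) atTop (𝓝 0)
  quarter_le : ∀ᶠ n in atTop,
    (N n : ℝ) ^ (-(1 / 4) : ℝ) ≤ √((T n : ℝ) / (N n * Real.log (N n)))

/-- Because m is bounded below by a positive constant, the conditions on m also restrict N and T
alone. The two entries of the minimum handle the two summands of ω separately. -/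
theorem growthRates {N T : ℕ → ℕ} {m : ℕ → ℝ} {q c : ℝ} (hN : Tendsto N atTop atTop)
    (hT : Tendsto T atTop atTop) (hq : 0 ≤ q) (hq1 : q < 1 / 2) (hc : 0 < c)
    (hm : ∀ᶠ n in atTop, c ≤ m n)
    (rate : m =o[atTop] fun n =>
      min (1 / (N n : ℝ) ^ (1 / 4 : ℝ) * ((T n : ℝ) / Real.log (N n)) ^ ((1 - q) / 2))
        ((N n : ℝ) ^ (1 / 4 - q / 2)))
    (hrate : Tendsto (fun n => √(N n : ℝ) * m n ^ 2 *
      (√(Real.log (N n) / T n) + 1 / √(N n : ℝ)) ^ (2 - 2 * q)) atTop (𝓝 0)) :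
    GrowthRates N T m q fun n => √(Real.log (N n) / T n) + 1 / √(N n : ℝ) := by
  have hN' : Tendsto (fun n => (N n : ℝ)) atTop atTop := tendsto_natCast_atTop_atTop.comp hN
  have hT' : Tendsto (fun n => (T n : ℝ)) atTop atTop := tendsto_natCast_atTop_atTop.comp hT
  have hev : ∀ᶠ n in atTop, (1 : ℝ) < N n ∧ (0 : ℝ) < T n ∧ c ≤ m n := by
    filter_upwards [hN'.eventually_gt_atTop 1, hT'.eventually_gt_atTop 0, hm] with n a b c
    exact ⟨a, b, c⟩
  have hq' : 0 < 1 - q := by linarith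
  -- the two parts of the rate condition
  have r1 : Tendsto (fun n => m n * √(Real.log (N n) / T n) ^ (1 - q) * (N n : ℝ) ^ (1 / 4 : ℝ))
      atTop (𝓝 0) := by
    have h0 : (fun n => min (1 / (N n : ℝ) ^ (1 / 4 : ℝ) *
        ((T n : ℝ) / Real.log (N n)) ^ ((1 - q) / 2)) ((N n : ℝ) ^ (1 / 4 - q / 2))) =O[atTop]
        fun n => 1 / (N n : ℝ) ^ (1 / 4 : ℝ) * ((T n : ℝ) / Real.log (N n)) ^ ((1 - q) / 2) := by
      refine Asymptotics.IsBigO.of_bound 1 ?_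
      filter_upwards [hev] with n hn
      have hl := Real.log_pos hn.1
      rw [Real.norm_of_nonneg (by positivity), Real.norm_of_nonneg (by positivity), one_mul]
      exact min_le_left _ _
    refine (rate.trans_isBigO h0).tendsto_div_nhds_zero.congr' ?_
    filter_upwards [hev] with n hn
    rw [inv_sqrt_log_div_rpow hn.1 hn.2.1]
    simp only [div_eq_mul_inv, mul_inv, inv_inv]
    ring
  have r2 : Tendsto (fun n => m n / (N n : ℝ) ^ (1 / 4 - q / 2)) atTop (𝓝 0) := by
    have h0 : (fun n => min (1 / (N n : ℝ) ^ (1 / 4 : ℝ) *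
        ((T n : ℝ) / Real.log (N n)) ^ ((1 - q) / 2)) ((N n : ℝ) ^ (1 / 4 - q / 2))) =O[atTop]
        fun n => (N n : ℝ) ^ (1 / 4 - q / 2) := by
      refine Asymptotics.IsBigO.of_bound 1 ?_
      filter_upwards [hev] with n hn
      have hl := Real.log_pos hn.1
      rw [Real.norm_of_nonneg (by positivity), Real.norm_of_nonneg (by positivity), one_mul]
      exact min_le_right _ _
    exact (rate.trans_isBigO h0).tendsto_div_nhds_zero
  -- With v = √(log N / T), first v^{1-q} N^{1/4} ≤ 1 forces v ≤ 1, and then v ≤ v^{1-q}.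
  have r3 : Tendsto (fun n => √(Real.log (N n) / T n) * (N n : ℝ) ^ (1 / 4 : ℝ)) atTop (𝓝 0) := by
    have h1 := r1.const_mul c⁻¹
    rw [mul_zero] at h1
    refine tendsto_of_tendsto_of_tendsto_of_le_of_le' tendsto_const_nhds h1
      (Eventually.of_forall fun n => by positivity) ?_
    filter_upwards [hev, h1.eventually_le_const one_pos] with n hn h2
    set v := √(Real.log (N n) / T n) with hv
    have hv0 : 0 ≤ v := Real.sqrt_nonneg _
    have hN4 : 1 ≤ (N n : ℝ) ^ (1 / 4 : ℝ) := Real.one_le_rpow hn.1.le (by norm_num)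
    have h3 : v ^ (1 - q) * (N n : ℝ) ^ (1 / 4 : ℝ) ≤
        c⁻¹ * (m n * v ^ (1 - q) * (N n : ℝ) ^ (1 / 4 : ℝ)) := by
      have : 1 ≤ c⁻¹ * m n := by
        rw [inv_mul_eq_div, le_div_iff₀ hc, one_mul]; exact hn.2.2
      calc _ ≤ (c⁻¹ * m n) * (v ^ (1 - q) * (N n : ℝ) ^ (1 / 4 : ℝ)) :=
            le_mul_of_one_le_left (by positivity) this
        _ = _ := by ring
    have hv1 : v ≤ 1 := by
      by_contra hcon
      push Not at hcon
      have h4 : 1 < v ^ (1 - q) := Real.one_lt_rpow hcon hq'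
      nlinarith
    have h5 : v ≤ v ^ (1 - q) := by
      rcases hv0.eq_or_lt with h0 | h0
      · rw [← h0]; positivity
      · calc v = v ^ (1 : ℝ) := (Real.rpow_one v).symm
          _ ≤ v ^ (1 - q) := Real.rpow_le_rpow_of_exponent_ge h0 hv1 (by linarith)
    refine le_trans ?_ h3
    gcongr
  have hroot : Tendsto (fun n => 1 / √(N n : ℝ)) atTop (𝓝 0) := by
    simp only [one_div]
    exact tendsto_inv_atTop_zero.comp (Real.tendsto_sqrt_atTop.comp hN')
  have hw : Tendsto (fun n => √(Real.log (N n) / T n) + 1 / √(N n : ℝ)) atTop (𝓝 0) := by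
    have h0 : Tendsto (fun n => √(Real.log (N n) / T n)) atTop (𝓝 0) := by
      refine tendsto_of_tendsto_of_tendsto_of_le_of_le' tendsto_const_nhds r3
        (Eventually.of_forall fun n => by positivity) ?_
      filter_upwards [hev] with n hn
      exact le_mul_of_one_le_right (Real.sqrt_nonneg _) (Real.one_le_rpow hn.1.le (by norm_num))
    simpa using h0.add hroot
  refine ⟨?_, hw, ?_, ?_, ?_, ?_⟩
  -- Squaring v N^{1/4} gives √N log N / T.
  · have h1 := r3.mul r3
    rw [mul_zero] at h1
    refine h1.congr' ?_
    filter_upwards [hev] with n hn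
    have hl := Real.log_pos hn.1
    have hN0 : (0 : ℝ) < N n := by linarith
    have e1 : √(Real.log (N n) / T n) * √(Real.log (N n) / T n) = Real.log (N n) / T n :=
      Real.mul_self_sqrt (div_nonneg hl.le hn.2.1.le)
    have e2 : (N n : ℝ) ^ (1 / 4 : ℝ) * (N n : ℝ) ^ (1 / 4 : ℝ) = √(N n : ℝ) := by
      rw [← Real.rpow_add hN0, Real.sqrt_eq_rpow]; norm_num
    rw [mul_mul_mul_comm, e1, e2]
    ring
  · have h1 := r1.add r2
    rw [add_zero] at h1
    refine tendsto_of_tendsto_of_tendsto_of_le_of_le' tendsto_const_nhds h1 ?_ ?_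
    · filter_upwards [hev] with n hn
      have : 0 < m n := hc.trans_le hn.2.2
      positivity
    filter_upwards [hev] with n hn
    have hm0 : 0 < m n := hc.trans_le hn.2.2
    have hN0 : (0 : ℝ) < N n := by linarith
    -- Subadditivity of x ↦ x^{1-q} separates the summands. For the second, N^{-(1-q)/2} N^{1/4} =
    -- N^{-(1/4 - q/2)} is exactly the second entry of the minimum in the rate.
    have e1 := Real.rpow_add_le_add_rpow (p := 1 - q) (Real.sqrt_nonneg (Real.log (N n) / T n))
      (by positivity : 0 ≤ 1 / √(N n : ℝ)) hq'.le (by linarith)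
    have e2 : (1 / √(N n : ℝ)) ^ (1 - q) * (N n : ℝ) ^ (1 / 4 : ℝ) =
        ((N n : ℝ) ^ (1 / 4 - q / 2))⁻¹ := by
      rw [one_div, Real.sqrt_eq_rpow, ← Real.rpow_neg hN0.le, ← Real.rpow_neg hN0.le,
        ← Real.rpow_mul hN0.le, ← Real.rpow_add hN0]
      congr 1; ring
    calc m n * (√(Real.log (N n) / T n) + 1 / √(N n : ℝ)) ^ (1 - q) * (N n : ℝ) ^ (1 / 4 : ℝ)
        ≤ m n * (√(Real.log (N n) / T n) ^ (1 - q) + (1 / √(N n : ℝ)) ^ (1 - q)) *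
          (N n : ℝ) ^ (1 / 4 : ℝ) := by gcongr
      _ = m n * √(Real.log (N n) / T n) ^ (1 - q) * (N n : ℝ) ^ (1 / 4 : ℝ) +
          m n * ((1 / √(N n : ℝ)) ^ (1 - q) * (N n : ℝ) ^ (1 / 4 : ℝ)) := by ring
      _ = _ := by rw [e2, ← div_eq_mul_inv (m n)]
  · refine tendsto_of_tendsto_of_tendsto_of_le_of_le' tendsto_const_nhds r2 ?_ ?_
    · filter_upwards [hev] with n hn
      have : 0 < m n := hc.trans_le hn.2.2
      positivity
    · filter_upwards [hev] with n hn
      have hm0 : 0 < m n := hc.trans_le hn.2.2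
      have hN0 : (0 : ℝ) < N n := by linarith
      rw [Real.sqrt_eq_rpow]
      gcongr
      · exact hn.1.le
      · linarith
  · have h1 := hrate.const_mul ((c ^ 2)⁻¹)
    rw [mul_zero] at h1
    refine tendsto_of_tendsto_of_tendsto_of_le_of_le' tendsto_const_nhds h1
      (Eventually.of_forall fun n => by positivity) ?_
    filter_upwards [hev, hw.eventually_le_const one_pos] with n hn hw1
    have hN0 : (0 : ℝ) < N n := by linarith
    have hw0 : 0 < √(Real.log (N n) / T n) + 1 / √(N n : ℝ) := by positivity
    set v := √(Real.log (N n) / T n) + 1 / √(N n : ℝ) with hv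
    have e1 : v ^ 2 ≤ v ^ (2 - 2 * q) := by
      rw [← Real.rpow_natCast]
      exact Real.rpow_le_rpow_of_exponent_ge hw0 hw1 (by push_cast; linarith)
    have e2 : 1 ≤ (c ^ 2)⁻¹ * m n ^ 2 := by
      rw [inv_mul_eq_div, le_div_iff₀ (by positivity), one_mul]
      exact pow_le_pow_left₀ hc.le hn.2.2 2
    calc √(N n : ℝ) * v ^ 2 ≤ √(N n : ℝ) * v ^ (2 - 2 * q) := by gcongr
      _ ≤ ((c ^ 2)⁻¹ * m n ^ 2) * (√(N n : ℝ) * v ^ (2 - 2 * q)) :=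
          le_mul_of_one_le_left (by positivity) e2
      _ = _ := by ring
  · filter_upwards [hev, r3.eventually_le_const one_pos] with n hn h1
    have hl := Real.log_pos hn.1
    have hN0 : (0 : ℝ) < N n := by linarith
    have hT0 := hn.2.1
    have hv0 : 0 < √(Real.log (N n) / T n) := by positivity
    -- This square root is N^{-1/2}/v, so it exceeds N^{-1/4} as soon as v N^{1/4} ≤ 1.
    have e1 : √((T n : ℝ) / (N n * Real.log (N n))) =
        (√(N n : ℝ))⁻¹ * (√(Real.log (N n) / T n))⁻¹ := by
      rw [← Real.sqrt_inv, ← Real.sqrt_inv, ← Real.sqrt_mul (by positivity)]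
      congr 1; field_simp
    have e2 : (N n : ℝ) ^ (-(1 / 4) : ℝ) = (√(N n : ℝ))⁻¹ * (N n : ℝ) ^ (1 / 4 : ℝ) := by
      rw [Real.sqrt_eq_rpow, ← Real.rpow_neg hN0.le, ← Real.rpow_add hN0]; norm_num
    rw [e1, e2]
    gcongr
    rw [← one_div, le_div_iff₀ hv0, mul_comm]
    exact h1

end Rates

/-! ### Calculus of o_p -/

section LittleOP

variable {Ω : Type*} [MeasurableSpace Ω] {μ : Measure Ω}

lemma IsLittleOP.add {X Y : ℕ → Ω → ℝ} (hX : IsLittleOP μ X fun _ => 1)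
    (hY : IsLittleOP μ Y fun _ => 1) : IsLittleOP μ (fun n ω => X n ω + Y n ω) fun _ => 1 := by
  intro ε hε
  have h := (hX (ε / 2) (by positivity)).add (hY (ε / 2) (by positivity))
  rw [add_zero] at h
  refine tendsto_of_tendsto_of_tendsto_of_le_of_le tendsto_const_nhds h (fun n => zero_le)
    fun n => ?_
  refine (measure_mono fun ω hω => ?_).trans (measure_union_le _ _)
  by_contra hcon
  simp only [Set.mem_union, Set.mem_ofPred_eq, not_or, not_lt, mul_one] at hcon hω
  have := abs_add_le (X n ω) (Y n ω)
  linarith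

lemma isLittleOP_zero : IsLittleOP μ (fun _ _ => 0) fun _ => 1 := by
  intro ε hε
  have : ¬ ε < 0 := not_lt.2 hε.le
  simp [this]

lemma IsLittleOP.sum {ι : Type*} (s : Finset ι) {X : ι → ℕ → Ω → ℝ}
    (h : ∀ i ∈ s, IsLittleOP μ (X i) fun _ => 1) :
    IsLittleOP μ (fun n ω => ∑ i ∈ s, X i n ω) fun _ => 1 := by
  classical
  induction s using Finset.induction_on with
  | empty => simpa using isLittleOP_zero
  | insert i s hi ih =>
    simp only [Finset.sum_insert hi]
    exact (h i (by simp)).add (ih fun j hj => h j (by simp [hj]))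

lemma IsLittleOP.abs {X : ℕ → Ω → ℝ} {a : ℕ → ℝ} (hX : IsLittleOP μ X a) :
    IsLittleOP μ (fun n ω => |X n ω|) a := by
  simpa only [IsLittleOP, abs_abs] using hX

lemma IsLittleOP.const_mul {X : ℕ → Ω → ℝ} (hX : IsLittleOP μ X fun _ => 1) {c : ℝ} (hc : 0 < c) :
    IsLittleOP μ (fun n ω => c * X n ω) fun _ => 1 := by
  intro ε hε
  convert hX (ε / c) (by positivity) using 5 with n ω
  rw [abs_mul, abs_of_pos hc, mul_one, mul_one, div_lt_iff₀' hc]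

/-- Markov's inequality in `o_p` form. -/
lemma isLittleOP_of_integral {Y : ℕ → Ω → ℝ} (h0 : ∀ n ω, 0 ≤ Y n ω)
    (hi : ∀ᶠ n in atTop, Integrable (Y n) μ) {v : ℕ → ℝ} (hv : ∀ᶠ n in atTop, ∫ ω, Y n ω ∂μ ≤ v n)
    (hv0 : Tendsto v atTop (𝓝 0)) : IsLittleOP μ Y fun _ => 1 := by
  intro ε hε
  have h1 : Tendsto (fun n => ENNReal.ofReal (v n / ε)) atTop (𝓝 0) := by
    have := ENNReal.tendsto_ofReal (hv0.div_const ε)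
    simpa using this
  refine tendsto_of_tendsto_of_tendsto_of_le_of_le' tendsto_const_nhds h1
    (Eventually.of_forall fun n => zero_le) ?_
  filter_upwards [hi, hv] with n hin hvn
  have h2 := mul_meas_ge_le_integral_of_nonneg (ae_of_all _ (h0 n)) hin ε
  have hfin : μ {ω | ε ≤ Y n ω} ≠ ⊤ := (hin.measure_ge_lt_top hε).ne
  refine (measure_mono fun ω hω => ?_).trans
    ((ENNReal.le_ofReal_iff_toReal_le hfin (div_nonneg ?_ hε.le)).2 ?_) (b := μ {ω | ε ≤ Y n ω})
  · simp only [Set.mem_ofPred_eq, mul_one, abs_of_nonneg (h0 n ω)] at hω ⊢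
    exact hω.le
  · exact (integral_nonneg (h0 n)).trans hvn
  · rw [le_div_iff₀ hε, mul_comm]
    exact h2.trans hvn

/-- A bound on events of probability tending to one suffices. -/
lemma IsLittleOP.of_le_on {X Y : ℕ → Ω → ℝ} {a : ℕ → ℝ} {G : ℕ → Set Ω}
    (hG : Tendsto (fun n => μ (G n)ᶜ) atTop (𝓝 0)) (hY : IsLittleOP μ Y a)
    (h : ∀ᶠ n in atTop, ∀ ω ∈ G n, |X n ω| ≤ |Y n ω|) : IsLittleOP μ X a := by
  intro ε hε
  have h1 := hG.add (hY ε hε)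
  rw [add_zero] at h1
  refine tendsto_of_tendsto_of_tendsto_of_le_of_le' tendsto_const_nhds h1
    (Eventually.of_forall fun n => zero_le) ?_
  filter_upwards [h] with n hn
  refine (measure_mono fun ω hω => ?_).trans (measure_union_le _ _)
  by_cases hg : ω ∈ G n
  · exact Or.inr (lt_of_lt_of_le hω (hn ω hg))
  · exact Or.inl hg

lemma isLittleOP_of_bound_on {X : ℕ → Ω → ℝ} {a v : ℕ → ℝ} {G : ℕ → Set Ω}
    (hG : Tendsto (fun n => μ (G n)ᶜ) atTop (𝓝 0))
    (h : ∀ᶠ n in atTop, ∀ ω ∈ G n, |X n ω| ≤ v n) (hva : v =o[atTop] a)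
    (ha : ∀ n, 0 ≤ a n) : IsLittleOP μ X a := by
  intro ε hε
  refine tendsto_of_tendsto_of_tendsto_of_le_of_le' tendsto_const_nhds hG
    (Eventually.of_forall fun n => zero_le) ?_
  filter_upwards [h, hva.def hε] with n hn hv
  refine measure_mono fun ω hω hg => ?_
  rw [Real.norm_eq_abs, Real.norm_of_nonneg (ha n)] at hv
  exact absurd ((hn ω hg).trans ((le_abs_self _).trans hv)) (not_le.2 hω)

end LittleOP

/-! ### The thresholding estimator on the good event -/

namespace FactorModel

open scoped Matrix.Norms.L2Operator

variable {Ω : Type*} [MeasurableSpace Ω] {μ : Measure Ω} {D : FactorModel Ω}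

/-- Entrywise error bound for the sample covariances on the large entries. -/
def entryBound (D : FactorModel Ω) (μ : Measure Ω) (q : ℝ) (n : ℕ) (i j : Fin (D.N n)) (ω : Ω) : ℝ :=
  D.omegaT n ^ 2 + D.mN μ q n / D.N n + D.crossNorm μ n i ω + D.crossNorm μ n j ω +
    (∑ v, D.crossNorm μ n v ω) / D.N n

lemma omegaT_nonneg (D : FactorModel Ω) (n : ℕ) : 0 ≤ D.omegaT n := by
  unfold omegaT; positivity

lemma sq_omegaT_le_entryBound (D : FactorModel Ω) (μ : Measure Ω) (q : ℝ) (n : ℕ)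
    (i j : Fin (D.N n)) (ω : Ω) : D.omegaT n ^ 2 ≤ D.entryBound μ q n i j ω := by
  have h1 := D.mN_nonneg μ q n
  have h2 := fun i => crossNorm_nonneg (D := D) (μ := μ) n i ω
  have h3 : 0 ≤ (∑ v, D.crossNorm μ n v ω) / D.N n :=
    div_nonneg (Finset.sum_nonneg fun v _ => h2 v) (by positivity)
  have h4 : 0 ≤ D.mN μ q n / D.N n := by positivity
  unfold entryBound
  linarith [h2 i, h2 j]

/-- What a thresholding estimator achieves, given uniform bounds for the residual. -/
theorem exists_thresholding_bounds {c₁ c₂ q K₁ Ks : ℝ} (hc₂ : 0 < c₂) (hcc : c₂ ≤ c₁)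
    (hK₁ : 0 < K₁) (hq : 0 ≤ q) (hq1 : q ≤ 1)
    {SU : (n : ℕ) → Finset (Fin (D.N n) × Fin (D.N n))} {G : ℕ → Set Ω}
    (hdiag : ∀ n i, c₂ ≤ D.Sigu μ n i i ∧ D.Sigu μ n i i ≤ c₁)
    (hw : Tendsto D.omegaT atTop (𝓝 0)) (hN : Tendsto D.N atTop atTop)
    (hres : ∀ᶠ n in atTop, ∀ ω ∈ G n, ∀ R, IsPCResidual D.r (D.Sy n ω) R → ∀ i j,
      |R i j - D.sampleUU n ω i j| ≤ K₁ * D.entryBound μ q n i j ω ∧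
      |R i j - D.Sigu μ n i j| ≤ K₁ * D.omegaT n)
    (hdiagSU : ∀ n i, (i, i) ∈ SU n)
    (hsmall : ∀ᶠ n in atTop, ∀ p ∈ (SU n)ᶜ, |D.Sigu μ n p.1 p.2| ≤ Ks * D.omegaT n)
    (hlarge : ∀ ε : ℝ, 0 < ε → ∀ᶠ n in atTop, ∀ p ∈ SU n,
      D.omegaT n ≤ ε * |D.Sigu μ n p.1 p.2|) :
    ∃ C₀ : ℝ, 0 < C₀ ∧ ∀ C : ℝ, C₀ ≤ C →
      ∀ Sig : (n : ℕ) → Ω → Matrix (Fin (D.N n)) (Fin (D.N n)) ℝ, D.IsThresholdEstimator C Sig →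
      ∃ K : ℝ, 0 < K ∧ ∀ᶠ n in atTop, ∀ ω ∈ G n,
        ‖Sig n ω - D.Sigu μ n‖ ≤ K * (D.mN μ q n * D.omegaT n ^ (1 - q)) ∧
        (∀ i j, (i, j) ∉ SU n → Sig n ω i j = 0) ∧
        ∀ i j, (i, j) ∈ SU n →
          |Sig n ω i j - D.sampleUU n ω i j| ≤ K * D.entryBound μ q n i j ω := by
  have hc₁ : 0 < c₁ := hc₂.trans_le hcc
  -- Chosen so that τ₀ = Cc₂/2 is at least 2K₁ + |Ks| + 1: thresholds then exceed twice the
  -- entrywise error, and also exceed any small entry plus its error.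
  refine ⟨(4 * K₁ + 2 * |Ks| + 2) / c₂, by positivity, fun C hC Sig hSig => ?_⟩
  obtain ⟨a, b, ha, hb, hest⟩ := hSig
  rw [div_le_iff₀ hc₂] at hC
  have hKs := abs_nonneg Ks
  have hC0 : 0 < C := by
    by_contra h
    nlinarith
  set τ₀ := C * (c₂ / 2) with hτ₀
  set τ₁ := C * (2 * c₁) with hτ₁
  have hτ₀0 : 0 < τ₀ := by positivity
  have hτ₁0 : 0 < τ₁ := by positivity
  have hτ₀K : 2 * K₁ ≤ τ₀ := by rw [hτ₀]; linarith
  have hτ₀K' : |Ks| + K₁ < τ₀ := by rw [hτ₀]; linarith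
  set Kt := (2 * τ₁) ^ (1 - q) + 2 * τ₁ / (τ₀ / 2) ^ q + K₁ / c₂ ^ q with hKt
  have hKt0 : 0 < Kt := by positivity
  refine ⟨Kt + K₁ + a * τ₁ ^ 2, by positivity, ?_⟩
  -- This choice gives |σ| ≥ (K₁ + bτ₁ + 1)ω on the large entries, so |R| exceeds bτ and the sharp
  -- regime of the thresholding function applies there.
  filter_upwards [hres, hsmall, hlarge (1 / (K₁ + b * τ₁ + 1)) (by positivity),
    hw.eventually_le_const (show (0 : ℝ) < min 1 (c₂ / (2 * K₁)) by positivity),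
    hN.eventually_gt_atTop 0] with n hres hsmall hlarge hw hN ω hω
  obtain ⟨R, hR, s, hs, hSig⟩ := hest n ω
  have hR' := hres ω hω R hR
  have hw0 : 0 < D.omegaT n := omegaT_pos hN.ne'
  have hw1 : D.omegaT n ≤ 1 := hw.trans (min_le_left _ _)
  have hwK : K₁ * D.omegaT n ≤ c₂ / 2 := by
    have := hw.trans (min_le_right _ _)
    rw [le_div_iff₀ (by positivity)] at this
    linarith
  have hRii : ∀ i, c₂ / 2 ≤ R i i ∧ R i i ≤ 2 * c₁ := fun i => by
    have h1 := abs_le.1 (hR' i i).2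
    have h2 := hdiag n i
    constructor <;> linarith
  -- The data-driven thresholds are thus comparable to the deterministic ω, between τ₀ω and τ₁ω.
  have hRR : ∀ i j, c₂ / 2 ≤ √(R i i * R j j) ∧ √(R i i * R j j) ≤ 2 * c₁ := fun i j => by
    obtain ⟨h1, h2⟩ := hRii i
    obtain ⟨h3, h4⟩ := hRii j
    constructor
    · refine Real.le_sqrt_of_sq_le ?_
      rw [sq]
      exact mul_le_mul h1 h3 (by positivity) (by linarith)
    · rw [Real.sqrt_le_left (by positivity), sq]
      exact mul_le_mul h2 h4 (by linarith) (by positivity)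
  have hτl : ∀ i j, τ₀ * D.omegaT n ≤ C * √(R i i * R j j) * D.omegaT n := fun i j => by
    rw [hτ₀]
    have := (hRR i j).1
    gcongr
  have hτu : ∀ i j, C * √(R i i * R j j) * D.omegaT n ≤ τ₁ * D.omegaT n := fun i j => by
    rw [hτ₁]
    have := (hRR i j).2
    gcongr
  have hwq : 0 ≤ D.omegaT n ^ (1 - q) := by positivity
  refine ⟨?_, fun i j hij => ?_, fun i j hij => ?_⟩
  · have hm := D.mN_nonneg μ q n
    -- Schur's test with the dominating matrix Kt ω^{1-q}|σ|^q, whose rows sum to at most Kt ω^{1-q}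
    -- m_N. It is symmetric even if the estimator is not.
    refine (l2_opNorm_le_of_symm_bound _ (Matrix.of fun i j => Kt * D.omegaT n ^ (1 - q) *
      (if D.Sigu μ n i j = 0 then 0 else |D.Sigu μ n i j| ^ q))
      (ρ := Kt * (D.mN μ q n * D.omegaT n ^ (1 - q))) (by positivity) ?_ ?_ ?_).trans ?_
    · intro i j
      simp only [of_apply, D.sigu_symm μ n i j]
    · intro i j
      rw [Matrix.sub_apply, of_apply, hSig]
      by_cases hij : i = j
      · subst hij
        rw [if_pos rfl]
        refine (abs_sub_le_rpow_mul hq hw0 hK₁.le hw1 hc₂ (hdiag n i).1 (hR' i i).2).trans ?_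
        gcongr
        rw [hKt]
        have : 0 ≤ (2 * τ₁) ^ (1 - q) + 2 * τ₁ / (τ₀ / 2) ^ q := by positivity
        linarith
      · rw [if_neg hij]
        have h1 := abs_thresholding_sub_le hq hq1 hw0 hτ₀0 (hτl i j) (hτu i j) hτ₀K (hR' i j).2
          (hs i j)
        refine h1.trans ?_
        gcongr
        rw [hKt]
        have : 0 ≤ K₁ / c₂ ^ q := by positivity
        linarith
    · intro i
      simp only [of_apply, ← Finset.mul_sum]
      have := D.sum_le_mN μ q n i
      calc _ ≤ Kt * D.omegaT n ^ (1 - q) * D.mN μ q n := by gcongr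
        _ = _ := by ring
    · gcongr
      have : 0 ≤ a * τ₁ ^ 2 := by positivity
      linarith
  · have hne : i ≠ j := by
      rintro rfl
      exact hij (hdiagSU n i)
    rw [hSig, if_neg hne]
    refine (hs i j).zero _ (lt_of_lt_of_le ?_ (hτl i j))
    have h1 := hsmall (i, j) (by simpa using hij)
    have h2 := (hR' i j).2
    have h3 := abs_sub_abs_le_abs_sub (R i j) (D.Sigu μ n i j)
    have h4 : Ks * D.omegaT n ≤ |Ks| * D.omegaT n := by gcongr; exact le_abs_self _
    simp only at h1
    nlinarith
  · have he := D.sq_omegaT_le_entryBound μ q n i j ω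
    have he0 : 0 ≤ D.entryBound μ q n i j ω := (sq_nonneg _).trans he
    have h1 := (hR' i j).1
    rw [hSig]
    split_ifs with hne
    · subst hne
      refine h1.trans ?_
      gcongr
      have : 0 ≤ a * τ₁ ^ 2 := by positivity
      linarith
    · have h2 := hlarge (i, j) hij
      simp only [one_div] at h2
      rw [inv_mul_eq_div, le_div_iff₀ (by positivity)] at h2
      have h3 := abs_sub_abs_le_abs_sub (D.Sigu μ n i j) (R i j)
      rw [abs_sub_comm] at h3
      have h4 := (hR' i j).2
      have h5 : b * (C * √(R i i * R j j) * D.omegaT n) ≤ b * (τ₁ * D.omegaT n) := by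
        have := hτu i j
        gcongr
      have h6 := (hs i j).sharp (R i j) (by linarith)
      -- In the sharp regime thresholding moves the entry only by order ω², which the entry bound
      -- already contains.
      have h7 : a * (C * √(R i i * R j j) * D.omegaT n) ^ 2 ≤ a * τ₁ ^ 2 * D.entryBound μ q n i j ω :=
        calc _ ≤ a * (τ₁ * D.omegaT n) ^ 2 := by
              have := hτu i j
              gcongr
          _ = a * τ₁ ^ 2 * D.omegaT n ^ 2 := by ring
          _ ≤ _ := by gcongr
      have h8 := abs_sub_le (s i j (R i j)) (R i j) (D.sampleUU n ω i j)
      have h9 : 0 ≤ Kt * D.entryBound μ q n i j ω := by positivity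
      linarith

end FactorModel

/-! ### Splitting double sums along the sparsity pattern -/

lemma euclNorm_le_sum_abs {k : ℕ} (v : Fin k → ℝ) : euclNorm v ≤ ∑ i, |v i| :=
  rowNorm_le_sum_abs (Matrix.of fun _ : Unit => v) ()

lemma sum_mul_mulVec_split {N : ℕ} (S : Finset (Fin N × Fin N)) (hS : ∀ i, (i, i) ∈ S)
    (F : Fin N → Fin N → ℝ) :
    ∑ i, ∑ j, F i j = ∑ p ∈ Sᶜ, F p.1 p.2 +
      (∑ i, F i i + ∑ p ∈ S.filter fun p => p.1 ≠ p.2, F p.1 p.2) := by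
  rw [← Fintype.sum_prod_type' F, ← Finset.sum_compl_add_sum S]
  congr 1
  rw [← Finset.sum_filter_add_sum_filter_not S fun p => p.1 = p.2]
  congr 1
  have : (S.filter fun p => p.1 = p.2) = Finset.univ.image fun i : Fin N => (i, i) := by
    ext ⟨i, j⟩
    simp only [Finset.mem_filter, Finset.mem_image, Finset.mem_univ, true_and, Prod.mk.injEq]
    constructor
    · rintro ⟨_, rfl⟩
      exact ⟨i, rfl, rfl⟩
    · rintro ⟨k, rfl, rfl⟩
      exact ⟨hS k, rfl⟩
  rw [this, Finset.sum_image fun i _ j _ hij => (Prod.mk.inj hij).1]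

/-! ### Decomposition of the weighted error -/

namespace FactorModel

open scoped Matrix.Norms.L2Operator

variable {Ω : Type*} [MeasurableSpace Ω] {μ : Measure Ω} {D : FactorModel Ω}

/-- The weighted average over the diagonal in `WeightedAverages.diag`. -/
def diagAvg (D : FactorModel Ω) (μ : Measure Ω) (t : ℤ) (k : Fin D.r) (n : ℕ) (ω : Ω) : ℝ :=
  1 / (D.T n * √(D.N n : ℝ)) *
    ∑ i, ∑ s ∈ D.times n, D.uu μ n s i i ω * D.xi μ n i k * D.e μ n t ω i

/-- The weighted average over the large off-diagonal entries in `WeightedAverages.offDiag`. -/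
def offDiagAvg (D : FactorModel Ω) (μ : Measure Ω)
    (SU : (n : ℕ) → Finset (Fin (D.N n) × Fin (D.N n))) (t : ℤ) (k : Fin D.r) (n : ℕ) (ω : Ω) : ℝ :=
  1 / (D.T n * √(D.N n : ℝ)) *
    ∑ p ∈ (SU n).filter fun p => p.1 ≠ p.2, ∑ s ∈ D.times n,
      D.uu μ n s p.1 p.2 ω * D.xi μ n p.1 k * D.e μ n t ω p.2

/-- Contribution of the small entries to the weighted error. -/
def smallPart (D : FactorModel Ω) (μ : Measure Ω)
    (SU : (n : ℕ) → Finset (Fin (D.N n) × Fin (D.N n))) (t : ℤ) (n : ℕ) (ω : Ω) : ℝ :=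
  (√(D.N n : ℝ))⁻¹ * ∑ p ∈ (SU n)ᶜ, |D.Sigu μ n p.1 p.2| * |D.e μ n t ω p.2|

/-- Contribution of the estimation errors of the large entries to the weighted error. -/
def largePart (D : FactorModel Ω) (μ : Measure Ω) (q : ℝ)
    (SU : (n : ℕ) → Finset (Fin (D.N n) × Fin (D.N n))) (t : ℤ) (n : ℕ) (ω : Ω) : ℝ :=
  (√(D.N n : ℝ))⁻¹ * ∑ p ∈ SU n, D.entryBound μ q n p.1 p.2 ω * |D.e μ n t ω p.2|

variable [IsProbabilityMeasure μ] {κ c p b ρ : ℝ}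

lemma ModelBounds.sampleUU_sub_sigu (hM : D.ModelBounds μ κ c p b ρ) (h : D.Dynamics μ) {n : ℕ}
    (hT : D.T n ≠ 0) (ω : Ω) (i j : Fin (D.N n)) :
    D.sampleUU n ω i j - D.Sigu μ n i j = (D.T n : ℝ)⁻¹ * ∑ s ∈ D.times n, D.uu μ n s i j ω := by
  have hT0 : (D.T n : ℝ) ≠ 0 := Nat.cast_ne_zero.2 hT
  simp only [uu, hM.integral_u_mul h]
  rw [Finset.sum_sub_distrib, Finset.sum_const, nsmul_eq_mul, card_times, sampleUU_apply]
  field_simp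

/-- First order term of the weighted error. -/
lemma ModelBounds.abs_firstOrder_le (hM : D.ModelBounds μ κ c p b ρ) (h : D.Dynamics μ) {n : ℕ}
    (hT : D.T n ≠ 0) {SU : (n : ℕ) → Finset (Fin (D.N n) × Fin (D.N n))}
    (hSU : ∀ i, (i, i) ∈ SU n) {q K X : ℝ}
    {S : Matrix (Fin (D.N n)) (Fin (D.N n)) ℝ} {t : ℤ} {ω : Ω}
    (hX : ∀ i k, |D.xi μ n i k| ≤ X) (hzero : ∀ i j, (i, j) ∉ SU n → S i j = 0)
    (hlarge : ∀ i j, (i, j) ∈ SU n → |S i j - D.sampleUU n ω i j| ≤ K * D.entryBound μ q n i j ω)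
    (k : Fin D.r) :
    |(√(D.N n : ℝ))⁻¹ * ((((D.Lam n)ᵀ * (D.Sigu μ n)⁻¹) *ᵥ
      ((S - D.Sigu μ n) *ᵥ D.e μ n t ω)) k)| ≤
      |D.diagAvg μ t k n ω| + |D.offDiagAvg μ SU t k n ω| +
        (X * D.smallPart μ SU t n ω + X * K * D.largePart μ q SU t n ω) := by
  set e := D.e μ n t ω with he
  set x := fun i => D.xi μ n i k with hx
  set R := (√(D.N n : ℝ))⁻¹ with hR
  have hR0 : 0 ≤ R := by positivity
  have e1 : (((D.Lam n)ᵀ * (D.Sigu μ n)⁻¹) *ᵥ ((S - D.Sigu μ n) *ᵥ e)) k =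
      ∑ i, ∑ j, x i * (S i j - D.Sigu μ n i j) * e j := by
    simp only [mulVec, dotProduct, hx, xi, Finset.mul_sum, Matrix.sub_apply, mul_assoc]
  have e2 : D.diagAvg μ t k n ω =
      R * ∑ i, x i * (D.sampleUU n ω i i - D.Sigu μ n i i) * e i := by
    simp only [diagAvg, hM.sampleUU_sub_sigu h hT, Finset.mul_sum, Finset.sum_mul]
    refine Finset.sum_congr rfl fun i _ => Finset.sum_congr rfl fun s _ => ?_
    rw [hR, one_div, mul_inv]
    ring
  have e3 : D.offDiagAvg μ SU t k n ω = R * ∑ p ∈ (SU n).filter fun p => p.1 ≠ p.2,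
      x p.1 * (D.sampleUU n ω p.1 p.2 - D.Sigu μ n p.1 p.2) * e p.2 := by
    simp only [offDiagAvg, hM.sampleUU_sub_sigu h hT, Finset.mul_sum, Finset.sum_mul]
    refine Finset.sum_congr rfl fun i _ => Finset.sum_congr rfl fun s _ => ?_
    rw [hR, one_div, mul_inv]
    ring
  -- On the small entries the estimator is 0, so its error is -Σ_u. On the large ones the sample
  -- covariance is inserted, and its centred part is split into diagonal and off-diagonal as in
  -- `WeightedAverages`.
  have e4 : ∑ i, ∑ j, x i * (S i j - D.Sigu μ n i j) * e j =
      ∑ p ∈ (SU n)ᶜ, x p.1 * (-D.Sigu μ n p.1 p.2) * e p.2 +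
      (∑ i, x i * (D.sampleUU n ω i i - D.Sigu μ n i i) * e i +
        ∑ p ∈ (SU n).filter fun p => p.1 ≠ p.2,
          x p.1 * (D.sampleUU n ω p.1 p.2 - D.Sigu μ n p.1 p.2) * e p.2) +
      ∑ p ∈ SU n, x p.1 * (S p.1 p.2 - D.sampleUU n ω p.1 p.2) * e p.2 := by
    have f1 := sum_mul_mulVec_split (SU n) hSU fun i j =>
      x i * (D.sampleUU n ω i j - D.Sigu μ n i j) * e j
    have f2 : ∑ i, ∑ j, x i * (S i j - D.Sigu μ n i j) * e j =
        ∑ i, ∑ j, x i * (D.sampleUU n ω i j - D.Sigu μ n i j) * e j +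
        ∑ p : Fin (D.N n) × Fin (D.N n), x p.1 * (S p.1 p.2 - D.sampleUU n ω p.1 p.2) * e p.2 := by
      rw [Fintype.sum_prod_type, ← Finset.sum_add_distrib]
      refine Finset.sum_congr rfl fun i _ => ?_
      rw [← Finset.sum_add_distrib]
      exact Finset.sum_congr rfl fun j _ => by ring
    have f3 : ∑ p ∈ (SU n)ᶜ, x p.1 * (-D.Sigu μ n p.1 p.2) * e p.2 =
        ∑ p ∈ (SU n)ᶜ, x p.1 * (D.sampleUU n ω p.1 p.2 - D.Sigu μ n p.1 p.2) * e p.2 +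
        ∑ p ∈ (SU n)ᶜ, x p.1 * (S p.1 p.2 - D.sampleUU n ω p.1 p.2) * e p.2 := by
      rw [← Finset.sum_add_distrib]
      refine Finset.sum_congr rfl fun p hp => ?_
      rw [hzero p.1 p.2 (by simpa using hp)]
      ring
    rw [f2, f1, f3, ← Finset.sum_compl_add_sum (SU n)]
    ring
  have b1 : |∑ p ∈ (SU n)ᶜ, x p.1 * (-D.Sigu μ n p.1 p.2) * e p.2| ≤
      X * ∑ p ∈ (SU n)ᶜ, |D.Sigu μ n p.1 p.2| * |e p.2| := by
    rw [Finset.mul_sum]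
    refine (Finset.abs_sum_le_sum_abs _ _).trans (Finset.sum_le_sum fun p _ => ?_)
    rw [abs_mul, abs_mul, abs_neg, mul_assoc]
    gcongr
    exact hX p.1 k
  have b2 : |∑ p ∈ SU n, x p.1 * (S p.1 p.2 - D.sampleUU n ω p.1 p.2) * e p.2| ≤
      X * K * ∑ p ∈ SU n, D.entryBound μ q n p.1 p.2 ω * |e p.2| := by
    rw [Finset.mul_sum]
    refine (Finset.abs_sum_le_sum_abs _ _).trans (Finset.sum_le_sum fun p hp => ?_)
    rw [abs_mul, abs_mul]
    have g1 := hX p.1 k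
    have g2 := hlarge p.1 p.2 hp
    have g3 : 0 ≤ X := (abs_nonneg _).trans g1
    calc |x p.1| * |S p.1 p.2 - D.sampleUU n ω p.1 p.2| * |e p.2|
        ≤ X * (K * D.entryBound μ q n p.1 p.2 ω) * |e p.2| := by gcongr
      _ = _ := by ring
  rw [e1, e4, mul_add, mul_add, mul_add R (∑ i, _), ← e2, ← e3]
  have t1 := abs_add_le (R * ∑ p ∈ (SU n)ᶜ, x p.1 * (-D.Sigu μ n p.1 p.2) * e p.2 +
    (D.diagAvg μ t k n ω + D.offDiagAvg μ SU t k n ω))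
    (R * ∑ p ∈ SU n, x p.1 * (S p.1 p.2 - D.sampleUU n ω p.1 p.2) * e p.2)
  have t2 := abs_add_le (R * ∑ p ∈ (SU n)ᶜ, x p.1 * (-D.Sigu μ n p.1 p.2) * e p.2)
    (D.diagAvg μ t k n ω + D.offDiagAvg μ SU t k n ω)
  have t3 := abs_add_le (D.diagAvg μ t k n ω) (D.offDiagAvg μ SU t k n ω)
  rw [abs_mul R, abs_of_nonneg hR0] at t1 t2
  have b1' := mul_le_mul_of_nonneg_left b1 hR0
  have b2' := mul_le_mul_of_nonneg_left b2 hR0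
  have s1 : R * (X * ∑ p ∈ (SU n)ᶜ, |D.Sigu μ n p.1 p.2| * |e p.2|) =
      X * D.smallPart μ SU t n ω := by rw [smallPart]; ring
  have s2 : R * (X * K * ∑ p ∈ SU n, D.entryBound μ q n p.1 p.2 ω * |e p.2|) =
      X * K * D.largePart μ q SU t n ω := by rw [largePart]; ring
  rw [s1] at b1'
  rw [s2] at b2'
  linarith

/-- Bound for the weighted error on the event where the estimator is accurate. -/
lemma ModelBounds.weightedError_le (hM : D.ModelBounds μ κ c p b ρ) (h : D.Dynamics μ) {n : ℕ}
    (hN : D.N n ≠ 0) (hT : D.T n ≠ 0) {SU : (n : ℕ) → Finset (Fin (D.N n) × Fin (D.N n))}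
    (hSU : ∀ i, (i, i) ∈ SU n) {q K X c₁ η x : ℝ}
    {Sig : (n : ℕ) → Ω → Matrix (Fin (D.N n)) (Fin (D.N n)) ℝ} {t : ℤ} {ω : Ω}
    (hX : ∀ i k, |D.xi μ n i k| ≤ X) (hzero : ∀ i j, (i, j) ∉ SU n → Sig n ω i j = 0)
    (hlarge : ∀ i j, (i, j) ∈ SU n →
      |Sig n ω i j - D.sampleUU n ω i j| ≤ K * D.entryBound μ q n i j ω)
    (hc₁ : 0 ≤ c₁) (hL : ∀ j, rowNorm (D.Lam n) j ≤ c₁)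
    (hinv : D.Sigu μ n * (D.Sigu μ n)⁻¹ = 1) (hη : ‖(D.Sigu μ n)⁻¹‖ ≤ η)
    (hx : ‖Sig n ω - D.Sigu μ n‖ ≤ x) (hηx : η * x ≤ 1 / 2) :
    D.weightedError (fun n => (D.Sigu μ n)⁻¹) (fun n ω => (Sig n ω)⁻¹) t n ω ≤
      ∑ k, (|D.diagAvg μ t k n ω| + |D.offDiagAvg μ SU t k n ω| +
        (X * D.smallPart μ SU t n ω + X * K * D.largePart μ q SU t n ω)) +
      2 * c₁ * η ^ 3 * (√(D.N n : ℝ) * x ^ 2 * ((√(D.N n : ℝ))⁻¹ * euclNorm (D.u n t ω))) := by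
  have hN0 : (0 : ℝ) < D.N n := Nat.cast_pos.2 (Nat.pos_of_ne_zero hN)
  have hs0 : 0 < √(D.N n : ℝ) := by positivity
  have hη0 : 0 ≤ η := (norm_nonneg _).trans hη
  have hx0 : 0 ≤ x := (norm_nonneg _).trans hx
  set W := (D.Sigu μ n)⁻¹ with hW
  set Δ := Sig n ω - D.Sigu μ n with hΔ
  set L := (D.Lam n)ᵀ with hLt
  set u := D.u n t ω with hu
  obtain ⟨p1, -, p3⟩ := inv_perturbation (D := Δ) hinv hη
    ((mul_le_mul_of_nonneg_left hx hη0).trans hηx)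
  have hsum : D.Sigu μ n + Δ = Sig n ω := by rw [hΔ]; abel
  rw [hsum] at p1 p3
  rw [← hW] at p3
  set V := (Sig n ω)⁻¹ with hV
  have hLn : ‖L‖ ≤ √(D.N n : ℝ) * c₁ := by
    rw [hLt, l2_opNorm_transpose]
    exact l2_opNorm_le_of_rowNorm_le _ hs0.le hc₁ (by rw [Real.sq_sqrt hN0.le]; simp) hL
  -- Second order expansion of the inverse. The linear term needs the cancellation in
  -- `abs_firstOrder_le`; the quadratic one is bounded by norms alone.
  have e1 : (√(D.N n : ℝ))⁻¹ • (L *ᵥ ((V - W) *ᵥ u)) =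
      -((√(D.N n : ℝ))⁻¹ • ((L * W) *ᵥ (Δ *ᵥ (W *ᵥ u)))) +
      (√(D.N n : ℝ))⁻¹ • (L *ᵥ ((W * Δ * V * Δ * W) *ᵥ u)) := by
    rw [p3, add_mulVec, neg_mulVec, mulVec_add, mulVec_neg, smul_add, smul_neg]
    simp only [mulVec_mulVec, Matrix.mul_assoc]
  have hrem : euclNorm ((√(D.N n : ℝ))⁻¹ • (L *ᵥ ((W * Δ * V * Δ * W) *ᵥ u))) ≤
      2 * c₁ * η ^ 3 * (√(D.N n : ℝ) * x ^ 2 * ((√(D.N n : ℝ))⁻¹ * euclNorm u)) := by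
    have f1 : ‖W * Δ * V * Δ * W‖ ≤ η * x * (2 * η) * x * η := by
      refine (l2_opNorm_mul _ _).trans (mul_le_mul ?_ hη (norm_nonneg _) (by positivity))
      refine (l2_opNorm_mul _ _).trans (mul_le_mul ?_ hx (norm_nonneg _) (by positivity))
      refine (l2_opNorm_mul _ _).trans (mul_le_mul ?_ p1 (norm_nonneg _) (by positivity))
      exact (l2_opNorm_mul _ _).trans (mul_le_mul hη hx (norm_nonneg _) (by positivity))
    have f2 : ‖WithLp.toLp 2 (L *ᵥ ((W * Δ * V * Δ * W) *ᵥ u))‖ ≤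
        √(D.N n : ℝ) * c₁ * (η * x * (2 * η) * x * η * ‖WithLp.toLp 2 u‖) := by
      refine (norm_mulVec_le _ _).trans (mul_le_mul hLn ?_ (norm_nonneg _) (by positivity))
      exact (norm_mulVec_le _ _).trans (mul_le_mul_of_nonneg_right f1 (norm_nonneg _))
    rw [euclNorm, WithLp.toLp_smul, norm_smul, Real.norm_of_nonneg (by positivity), euclNorm]
    calc _ ≤ (√(D.N n : ℝ))⁻¹ *
          (√(D.N n : ℝ) * c₁ * (η * x * (2 * η) * x * η * ‖WithLp.toLp 2 u‖)) := by gcongr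
      _ = _ := by ring
  have hfirst : euclNorm (-((√(D.N n : ℝ))⁻¹ • ((L * W) *ᵥ (Δ *ᵥ (W *ᵥ u))))) ≤
      ∑ k, (|D.diagAvg μ t k n ω| + |D.offDiagAvg μ SU t k n ω| +
        (X * D.smallPart μ SU t n ω + X * K * D.largePart μ q SU t n ω)) := by
    refine (euclNorm_le_sum_abs _).trans (Finset.sum_le_sum fun k _ => ?_)
    rw [Pi.neg_apply, abs_neg, Pi.smul_apply, smul_eq_mul]
    exact hM.abs_firstOrder_le h hT hSU hX hzero hlarge k
  rw [weightedError, e1]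
  refine le_trans ?_ (add_le_add hfirst hrem)
  simp only [euclNorm, WithLp.toLp_add]
  exact norm_add_le _ _

end FactorModel

/-! ### First moments of products -/

section

variable {Ω : Type*} [MeasurableSpace Ω] {μ : Measure Ω} [IsProbabilityMeasure μ]

/-- Weighted arithmetic-geometric mean: |XY| ≤ X²/δ + Y²δ, with δ the L² scale of X. -/
lemma integral_abs_mul_abs_le {X Y : Ω → ℝ} (hX : MemLp X 2 μ) (hY : MemLp Y 2 μ) {δ a b : ℝ}
    (hδ : 0 < δ) (ha : ∫ ω, X ω ^ 2 ∂μ ≤ a * δ ^ 2) (hb : ∫ ω, Y ω ^ 2 ∂μ ≤ b) :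
    Integrable (fun ω => |X ω| * |Y ω|) μ ∧ ∫ ω, |X ω| * |Y ω| ∂μ ≤ (a + b) * δ := by
  have hle : ∀ ω, |X ω| * |Y ω| ≤ X ω ^ 2 * δ⁻¹ + Y ω ^ 2 * δ := fun ω => by
    rw [← sq_abs (X ω), ← sq_abs (Y ω)]
    have h1 : 0 ≤ (|X ω| - δ * |Y ω|) ^ 2 * δ⁻¹ := by positivity
    have h2 : (|X ω| - δ * |Y ω|) ^ 2 * δ⁻¹ =
        |X ω| ^ 2 * δ⁻¹ - 2 * (|X ω| * |Y ω|) + |Y ω| ^ 2 * δ := by field_simp; ring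
    have h3 : 0 ≤ |X ω| * |Y ω| := by positivity
    linarith
  have hi : Integrable (fun ω => X ω ^ 2 * δ⁻¹ + Y ω ^ 2 * δ) μ :=
    (hX.integrable_sq.mul_const _).add (hY.integrable_sq.mul_const _)
  refine ⟨hX.abs.integrable_mul hY.abs, (integral_mono_of_nonneg
    (ae_of_all _ fun ω => by positivity) hi (ae_of_all _ hle)).trans ?_⟩
  rw [integral_add (hX.integrable_sq.mul_const _) (hY.integrable_sq.mul_const _),
    integral_mul_const, integral_mul_const]
  calc _ ≤ a * δ ^ 2 * δ⁻¹ + b * δ := by gcongr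
    _ = _ := by field_simp

lemma integral_abs_le_of_sq {Y : Ω → ℝ} (hY : MemLp Y 2 μ) {b : ℝ} (hb : ∫ ω, Y ω ^ 2 ∂μ ≤ b) :
    Integrable (fun ω => |Y ω|) μ ∧ ∫ ω, |Y ω| ∂μ ≤ 1 + b := by
  have := integral_abs_mul_abs_le (memLp_const (1 : ℝ) (μ := μ)) hY one_pos (a := 1) (by simp) hb
  simpa using this

end

/-! ### Expectations of the parts of the weighted error -/

namespace FactorModel

open scoped Matrix.Norms.L2Operator

variable {Ω : Type*} [MeasurableSpace Ω] {μ : Measure Ω} {D : FactorModel Ω}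
  [IsProbabilityMeasure μ] {κ c p b ρ : ℝ}

lemma ModelBounds.memLp_e (hM : D.ModelBounds μ κ c p b ρ) (h : D.Dynamics μ) (n : ℕ) (t : ℤ)
    (j : Fin (D.N n)) : MemLp (fun ω => D.e μ n t ω j) 2 μ :=
  hM.memLp_dotProduct h n t ((D.Sigu μ n)⁻¹ j)

lemma ModelBounds.integral_e_sq_le (hM : D.ModelBounds μ κ c p b ρ) (h : D.Dynamics μ) {n : ℕ}
    {c₁ η : ℝ} (hc₁ : 0 ≤ c₁)
    (hS : ∀ x, x ⬝ᵥ D.Sigu μ n *ᵥ x ≤ c₁ * ‖WithLp.toLp 2 x‖ ^ 2)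
    (hη : ‖(D.Sigu μ n)⁻¹‖ ≤ η) (t : ℤ) (j : Fin (D.N n)) :
    ∫ ω, D.e μ n t ω j ^ 2 ∂μ ≤ c₁ * η ^ 2 := by
  refine (hM.integral_dotProduct_sq h n t ((D.Sigu μ n)⁻¹ j)).trans_le ((hS _).trans ?_)
  have : ‖WithLp.toLp 2 ((D.Sigu μ n)⁻¹ j)‖ ≤ η := (rowNorm_le_l2_opNorm _ j).trans hη
  gcongr

/-- The small entries contribute `O(N^{-1/2})` in expectation. -/
lemma ModelBounds.integral_smallPart_le (hM : D.ModelBounds μ κ c p b ρ) (h : D.Dynamics μ) {n : ℕ}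
    {V M : ℝ} (hV : ∀ (t : ℤ) (j : Fin (D.N n)), ∫ ω, D.e μ n t ω j ^ 2 ∂μ ≤ V)
    (hV0 : 0 ≤ V) {SU : (n : ℕ) → Finset (Fin (D.N n) × Fin (D.N n))}
    (hSL : ∑ p ∈ (SU n)ᶜ, |D.Sigu μ n p.1 p.2| ≤ M) (t : ℤ) :
    Integrable (D.smallPart μ SU t n) μ ∧
      ∫ ω, D.smallPart μ SU t n ω ∂μ ≤ M * (1 + V) * (1 / √(D.N n : ℝ)) := by
  have he := fun j => integral_abs_le_of_sq (hM.memLp_e h n t j) (hV t j)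
  have hi : ∀ p ∈ (SU n)ᶜ, Integrable (fun ω => |D.Sigu μ n p.1 p.2| * |D.e μ n t ω p.2|) μ :=
    fun p _ => (he p.2).1.const_mul _
  refine ⟨(integrable_finsetSum _ hi).const_mul _, ?_⟩
  simp only [smallPart]
  rw [integral_const_mul, integral_finsetSum _ hi]
  simp_rw [integral_const_mul]
  calc _ ≤ (√(D.N n : ℝ))⁻¹ * ∑ p ∈ (SU n)ᶜ, |D.Sigu μ n p.1 p.2| * (1 + V) := by
        gcongr with p
        exact (he p.2).2
    _ ≤ (√(D.N n : ℝ))⁻¹ * (M * (1 + V)) := by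
        rw [← Finset.sum_mul]
        gcongr
    _ = _ := by ring

/-- The estimation errors of the large entries are small in expectation. -/
lemma ModelBounds.integral_largePart_le (hM : D.ModelBounds μ κ c p b ρ) (h : D.Dynamics μ) {n : ℕ}
    (hN : D.N n ≠ 0) (hT : D.T n ≠ 0)
    {V M K q : ℝ} (hV : ∀ (t : ℤ) (j : Fin (D.N n)), ∫ ω, D.e μ n t ω j ^ 2 ∂μ ≤ V)
    (hV0 : 0 ≤ V) (hK : 0 ≤ K) {SU : (n : ℕ) → Finset (Fin (D.N n) × Fin (D.N n))}
    (hcross : ∀ i a, MemLp (D.crossAvg μ n i a) 2 μ ∧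
      ∫ ω, D.crossAvg μ n i a ω ^ 2 ∂μ ≤ K / (√(D.N n) * D.T n))
    (hSU : ((SU n).card : ℝ) ≤ M * D.N n) (t : ℤ) :
    Integrable (D.largePart μ q SU t n) μ ∧
      ∫ ω, D.largePart μ q SU t n ω ∂μ ≤ M * ((1 + V) * (√(D.N n : ℝ) * D.omegaT n ^ 2) +
        (1 + V) * (D.mN μ q n / √(D.N n : ℝ)) +
        3 * D.r * (K + V) * √(√(D.N n : ℝ) / D.T n)) := by
  have hN0 : (0 : ℝ) < D.N n := Nat.cast_pos.2 (Nat.pos_of_ne_zero hN)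
  have hT0 : (0 : ℝ) < D.T n := Nat.cast_pos.2 (Nat.pos_of_ne_zero hT)
  have hm := D.mN_nonneg μ q n
  set S := √(D.N n : ℝ) with hS
  have hS0 : 0 < S := by positivity
  have hS2 : D.N n = S * S := (Real.mul_self_sqrt hN0.le).symm
  -- The L² scale of `crossAvg`. No independence from e_t is used, only second moments.
  set δ := √(1 / (S * D.T n)) with hδ
  have hδ0 : 0 < δ := by positivity
  have hδ2 : δ ^ 2 = 1 / (S * D.T n) := Real.sq_sqrt (by positivity)
  have he := fun j => integral_abs_le_of_sq (hM.memLp_e h n t j) (hV t j)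
  have hc := fun i a j => integral_abs_mul_abs_le (hcross i a).1 (hM.memLp_e h n t j) hδ0
    (a := K) (by rw [hδ2, mul_one_div]; exact (hcross i a).2) (hV t j)
  have hH : ∀ i j, Integrable (fun ω => D.crossNorm μ n i ω * |D.e μ n t ω j|) μ ∧
      ∫ ω, D.crossNorm μ n i ω * |D.e μ n t ω j| ∂μ ≤ D.r * (K + V) * δ := fun i j => by
    simp only [crossNorm, Finset.sum_mul]
    refine ⟨integrable_finsetSum _ fun a _ => (hc i a j).1, ?_⟩
    rw [integral_finsetSum _ fun a _ => (hc i a j).1]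
    refine (Finset.sum_le_sum fun a _ => (hc i a j).2).trans (le_of_eq ?_)
    simp only [Finset.sum_const, Finset.card_univ, Fintype.card_fin, nsmul_eq_mul]
    ring
  have hsplit : ∀ i j ω, D.entryBound μ q n i j ω * |D.e μ n t ω j| =
      (D.omegaT n ^ 2 + D.mN μ q n / D.N n) * |D.e μ n t ω j| +
      (D.crossNorm μ n i ω * |D.e μ n t ω j| + D.crossNorm μ n j ω * |D.e μ n t ω j| +
      (D.N n : ℝ)⁻¹ * ∑ v, D.crossNorm μ n v ω * |D.e μ n t ω j|) := fun i j ω => by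
    rw [entryBound, ← Finset.sum_mul]
    ring
  have hterm : ∀ i j, Integrable (fun ω => D.entryBound μ q n i j ω * |D.e μ n t ω j|) μ ∧
      ∫ ω, D.entryBound μ q n i j ω * |D.e μ n t ω j| ∂μ ≤
        (D.omegaT n ^ 2 + D.mN μ q n / D.N n) * (1 + V) + 3 * (D.r * (K + V) * δ) := fun i j => by
    have i1 := (he j).1.const_mul (D.omegaT n ^ 2 + D.mN μ q n / D.N n)
    have i2 := (hH i j).1
    have i3 := (hH j j).1
    have i4 := (integrable_finsetSum Finset.univ fun v _ => (hH v j).1).const_mul (D.N n : ℝ)⁻¹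
    simp_rw [hsplit]
    refine ⟨i1.add ((i2.add i3).add i4), ?_⟩
    have i5 : Integrable (fun ω => D.crossNorm μ n i ω * |D.e μ n t ω j| +
      D.crossNorm μ n j ω * |D.e μ n t ω j|) μ := i2.add i3
    have i6 : Integrable (fun ω => D.crossNorm μ n i ω * |D.e μ n t ω j| +
      D.crossNorm μ n j ω * |D.e μ n t ω j| +
      (D.N n : ℝ)⁻¹ * ∑ v, D.crossNorm μ n v ω * |D.e μ n t ω j|) μ := i5.add i4
    rw [integral_add i1 i6, integral_add i5 i4, integral_add i2 i3, integral_const_mul,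
      integral_const_mul, integral_finsetSum _ fun v _ => (hH v j).1]
    have s1 : (D.N n : ℝ)⁻¹ * ∑ v, ∫ ω, D.crossNorm μ n v ω * |D.e μ n t ω j| ∂μ ≤
        D.r * (K + V) * δ := by
      rw [inv_mul_le_iff₀ hN0]
      refine (Finset.sum_le_sum fun v _ => (hH v j).2).trans (le_of_eq ?_)
      simp only [Finset.sum_const, Finset.card_univ, Fintype.card_fin, nsmul_eq_mul]
    have s2 : (D.omegaT n ^ 2 + D.mN μ q n / D.N n) * ∫ ω, |D.e μ n t ω j| ∂μ ≤
        (D.omegaT n ^ 2 + D.mN μ q n / D.N n) * (1 + V) := by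
      gcongr
      exact (he j).2
    linarith [(hH i j).2, (hH j j).2]
  refine ⟨(integrable_finsetSum _ fun p _ => (hterm p.1 p.2).1).const_mul _, ?_⟩
  simp only [largePart]
  rw [integral_const_mul, integral_finsetSum _ fun p _ => (hterm p.1 p.2).1]
  -- There are O(N) large entries and a prefactor N^{-1/2}, so the averages contribute √N δ = √(√N /
  -- T).
  have hδS : S * δ = √(S / D.T n) := by
    rw [hδ, ← Real.sqrt_sq hS0.le, ← Real.sqrt_mul (by positivity), Real.sqrt_sq hS0.le]
    congr 1; field_simp
  calc _ ≤ S⁻¹ * ∑ p ∈ SU n,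
        ((D.omegaT n ^ 2 + D.mN μ q n / D.N n) * (1 + V) + 3 * (D.r * (K + V) * δ)) := by
        gcongr with p
        exact (hterm p.1 p.2).2
    _ = S⁻¹ * ((SU n).card *
        ((D.omegaT n ^ 2 + D.mN μ q n / D.N n) * (1 + V) + 3 * (D.r * (K + V) * δ))) := by
        simp only [Finset.sum_const, nsmul_eq_mul]
    _ ≤ S⁻¹ * (M * D.N n *
        ((D.omegaT n ^ 2 + D.mN μ q n / D.N n) * (1 + V) + 3 * (D.r * (K + V) * δ))) := by
        gcongr
    _ = _ := by
        rw [← hδS, hS2]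
        field_simp

/-- The scaled norm of the errors is bounded in expectation. -/
lemma ModelBounds.integral_norm_u_le (hM : D.ModelBounds μ κ c p b ρ) (h : D.Dynamics μ) {n : ℕ}
    (hN : D.N n ≠ 0) {c₁ : ℝ} (hd : ∀ i, D.Sigu μ n i i ≤ c₁) (t : ℤ) :
    Integrable (fun ω => (√(D.N n : ℝ))⁻¹ * euclNorm (D.u n t ω)) μ ∧
    ∫ ω, (√(D.N n : ℝ))⁻¹ * euclNorm (D.u n t ω) ∂μ ≤ 1 + c₁ := by
  have hN0 : (0 : ℝ) < D.N n := Nat.cast_pos.2 (Nat.pos_of_ne_zero hN)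
  have hi : ∀ i, Integrable (fun ω => D.u n t ω i ^ 2) μ := fun i => (hM.memLp_u h n t i).integrable_sq
  have hsq : ∀ ω, ((√(D.N n : ℝ))⁻¹ * euclNorm (D.u n t ω)) ^ 2 =
      (D.N n : ℝ)⁻¹ * ∑ i, D.u n t ω i ^ 2 := fun ω => by
    rw [mul_pow, inv_pow, Real.sq_sqrt hN0.le, euclNorm, norm_sq_toLp]
  have hm : Measurable fun ω => (√(D.N n : ℝ))⁻¹ * euclNorm (D.u n t ω) := by
    have : Measurable fun v : Fin (D.N n) → ℝ => euclNorm v := by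
      unfold euclNorm
      fun_prop
    exact (this.comp (h.measurable_u n t)).const_mul _
  have hL : MemLp (fun ω => (√(D.N n : ℝ))⁻¹ * euclNorm (D.u n t ω)) 2 μ := by
    rw [memLp_two_iff_integrable_sq hm.aestronglyMeasurable]
    simp_rw [hsq]
    exact (integrable_finsetSum _ fun i _ => hi i).const_mul _
  have hb : ∫ ω, ((√(D.N n : ℝ))⁻¹ * euclNorm (D.u n t ω)) ^ 2 ∂μ ≤ c₁ := by
    simp_rw [hsq]
    rw [integral_const_mul, integral_finsetSum _ fun i _ => hi i, inv_mul_le_iff₀ hN0]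
    have : ∀ i, ∫ ω, D.u n t ω i ^ 2 ∂μ ≤ c₁ := fun i => by
      simp_rw [sq]
      rw [hM.integral_u_mul h]
      exact hd i
    refine (Finset.sum_le_sum fun i _ => this i).trans (le_of_eq ?_)
    simp only [Finset.sum_const, Finset.card_univ, Fintype.card_fin, nsmul_eq_mul]
  have h0 : ∀ ω, 0 ≤ (√(D.N n : ℝ))⁻¹ * euclNorm (D.u n t ω) := fun ω => by
    unfold euclNorm; positivity
  have := integral_abs_le_of_sq hL hb
  simpa only [abs_of_nonneg (h0 _)] using this

end FactorModel

/-! ### Comparison of rates -/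

section Asymptotics

lemma isLittleO_min {f g₁ g₂ : ℕ → ℝ} (h₁ : f =o[atTop] g₁) (h₂ : f =o[atTop] g₂) :
    f =o[atTop] fun n => min (g₁ n) (g₂ n) := by
  rw [Asymptotics.isLittleO_iff] at *
  intro c hc
  filter_upwards [h₁ hc, h₂ hc] with n a b
  rcases min_choice (g₁ n) (g₂ n) with e | e <;> rwa [e]

/-- If T ≤ cN then N^{-1/4} ≤ c^{1/4}T^{-1/4}, while √(N/T) stays above c^{-1/2} and N^{-1/4} ≤ 1.
-/
lemma rpow_neg_quarter_isBigO {N T : ℕ → ℕ} (hN : Tendsto N atTop atTop)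
    (hT : Tendsto T atTop atTop)
    (h : (fun n => (T n : ℝ)) =O[atTop] fun n => (N n : ℝ)) :
    (fun n => (N n : ℝ) ^ (-(1 / 4) : ℝ)) =O[atTop]
      fun n => min ((T n : ℝ) ^ (-(1 / 4) : ℝ)) √((N n : ℝ) / T n) := by
  obtain ⟨c, hc, hb⟩ := h.exists_pos
  rw [Asymptotics.isBigOWith_iff] at hb
  refine Asymptotics.IsBigO.of_bound (c ^ (1 / 4 : ℝ) + √c) ?_
  filter_upwards [hb, hN.eventually_gt_atTop 0, hT.eventually_gt_atTop 0] with n hb hN hT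
  have hN0 : (0 : ℝ) < N n := Nat.cast_pos.2 hN
  have hT0 : (0 : ℝ) < T n := Nat.cast_pos.2 hT
  rw [Real.norm_of_nonneg hN0.le, Real.norm_of_nonneg hT0.le] at hb
  rw [Real.norm_of_nonneg (by positivity), Real.norm_of_nonneg (by positivity)]
  have hN4 : (N n : ℝ) ^ (-(1 / 4) : ℝ) ≤ 1 :=
    Real.rpow_le_one_of_one_le_of_nonpos (Nat.one_le_cast.2 hN) (by norm_num)
  rcases min_choice ((T n : ℝ) ^ (-(1 / 4) : ℝ)) √((N n : ℝ) / T n) with e | e <;> rw [e]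
  · have h1 : (N n : ℝ) ^ (-(1 / 4) : ℝ) ≤ c ^ (1 / 4 : ℝ) * (T n : ℝ) ^ (-(1 / 4) : ℝ) := by
      rw [Real.rpow_neg hN0.le, Real.rpow_neg hT0.le, ← div_eq_mul_inv, le_div_iff₀ (by positivity),
        inv_mul_le_iff₀ (by positivity), mul_comm, ← Real.mul_rpow hc.le hN0.le]
      gcongr
    have h2 : 0 ≤ √c * (T n : ℝ) ^ (-(1 / 4) : ℝ) := by positivity
    linarith
  · have h1 : 1 ≤ √c * √((N n : ℝ) / T n) := by
      rw [← Real.sqrt_mul hc.le, Real.one_le_sqrt, mul_div_assoc', one_le_div hT0]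
      exact hb
    have h2 : 0 ≤ c ^ (1 / 4 : ℝ) * √((N n : ℝ) / T n) := by positivity
    linarith

end Asymptotics

/-! ### Constants extracted from the assumptions -/

namespace FactorModel

open scoped Matrix.Norms.L2Operator

variable {Ω : Type*} [MeasurableSpace Ω] {μ : Measure Ω} {D : FactorModel Ω}

lemma quadForm_single {k : ℕ} (A : Matrix (Fin k) (Fin k) ℝ) (i : Fin k) :
    Pi.single i 1 ⬝ᵥ A *ᵥ Pi.single i 1 = A i i := by simp

lemma norm_toLp_single {k : ℕ} (i : Fin k) :
    ‖WithLp.toLp 2 (Pi.single i (1 : ℝ) : Fin k → ℝ)‖ ^ 2 = 1 := by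
  rw [norm_sq_toLp]
  simp [Pi.single_apply]

/-- Spectral consequences of the assumptions on the model. -/
lemma Dynamics.exists_spectral_bounds (h : D.Dynamics μ) : ∃ c₁ c₂ : ℝ, 0 < c₂ ∧ c₂ ≤ c₁ ∧
    (∀ n x, c₂ * ‖WithLp.toLp 2 x‖ ^ 2 ≤ x ⬝ᵥ D.Sigu μ n *ᵥ x) ∧
    (∀ n x, x ⬝ᵥ D.Sigu μ n *ᵥ x ≤ c₁ * ‖WithLp.toLp 2 x‖ ^ 2) ∧
    (∀ n j, rowNorm (D.Lam n) j ≤ c₁) ∧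
    (∀ y, c₂ * ‖WithLp.toLp 2 y‖ ^ 2 ≤ y ⬝ᵥ D.covf μ *ᵥ y) := by
  obtain ⟨c₁, c₂, h1, h2, hS, hL, hf⟩ := h.bounds
  have hcov : (D.covf μ)ᵀ = D.covf μ := by
    ext i j; simp [covf, covariance_comm]
  refine ⟨max c₁ c₂, c₂, h2, le_max_right _ _, fun n x => ?_, fun n x => ?_, fun n j => ?_,
    fun y => ?_⟩
  · exact quadForm_ge_of_spectrum (D.sigu_transpose μ n) (fun y hy => (hS n hy).1.le) x
  · exact quadForm_le_of_spectrum (D.sigu_transpose μ n)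
      (fun y hy => (hS n hy).2.le.trans (le_max_left _ _)) x
  · exact (hL n j).le.trans (le_max_left _ _)
  · exact quadForm_ge_of_spectrum hcov (fun y hy => (hf hy).1.le) y

/-- The least eigenvalue of Λ'Λ/N bounds ‖Λy‖² from below by cN‖y‖². This quantitative injectivity
is what makes r eigenvalues of S_y of order N. -/
lemma Pervasive.exists_norm_le (h : D.Pervasive) (hN : Tendsto D.N atTop atTop) :
    ∃ P : ℝ, 0 ≤ P ∧ ∀ᶠ n in atTop, ∀ y, √(D.N n : ℝ) * ‖WithLp.toLp 2 y‖ ≤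
      P * ‖WithLp.toLp 2 (D.Lam n *ᵥ y)‖ := by
  obtain ⟨c, C, hc, hev⟩ := h
  refine ⟨(√c)⁻¹, by positivity, ?_⟩
  filter_upwards [hev, hN.eventually_gt_atTop 0] with n hn hN y
  have hN0 : (0 : ℝ) < D.N n := Nat.cast_pos.2 hN
  have hsymm : ((D.N n : ℝ)⁻¹ • ((D.Lam n)ᵀ * D.Lam n))ᵀ =
      (D.N n : ℝ)⁻¹ • ((D.Lam n)ᵀ * D.Lam n) := by
    rw [transpose_smul, transpose_mul, transpose_transpose]
  have h1 := quadForm_ge_of_spectrum hsymm (fun x hx => (hn hx).1) y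
  rw [smul_mulVec, dotProduct_smul, ← mulVec_mulVec, dotProduct_mulVec, vecMul_transpose,
    smul_eq_mul] at h1
  have h2 : (D.Lam n *ᵥ y) ⬝ᵥ (D.Lam n *ᵥ y) = ‖WithLp.toLp 2 (D.Lam n *ᵥ y)‖ ^ 2 := by
    rw [norm_sq_toLp]; simp [dotProduct, sq]
  rw [h2, inv_mul_eq_div, le_div_iff₀ hN0] at h1
  rw [inv_mul_eq_div, le_div_iff₀ (by positivity)]
  refine abs_le_of_sq_le_sq' ?_ (norm_nonneg _) |>.2
  rw [mul_pow, mul_pow, Real.sq_sqrt hN0.le, Real.sq_sqrt hc.le]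
  linarith

/-- One diagonal entry alone contributes c₂^q to its row; this gives the lower bound on m required
by `growthRates`. -/
lemma le_mN_of_diag {q c₂ : ℝ} (hq : 0 ≤ q) (hc₂ : 0 < c₂)
    (hd : ∀ n i, c₂ ≤ D.Sigu μ n i i) {n : ℕ} (hN : 0 < D.N n) : c₂ ^ q ≤ D.mN μ q n := by
  have i : Fin (D.N n) := ⟨0, hN⟩
  refine le_trans ?_ (D.sum_le_mN μ q n i)
  have h0 : 0 < D.Sigu μ n i i := hc₂.trans_le (hd n i)
  have h1 : c₂ ^ q ≤ (if D.Sigu μ n i i = 0 then 0 else |D.Sigu μ n i i| ^ q) := by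
    rw [if_neg h0.ne', abs_of_pos h0]
    exact Real.rpow_le_rpow hc₂.le (hd n i) hq
  refine h1.trans (Finset.single_le_sum
    (f := fun j => if D.Sigu μ n i j = 0 then 0 else |D.Sigu μ n i j| ^ q) (fun j _ => ?_)
    (Finset.mem_univ i))
  split_ifs <;> positivity

/-- ξ_i sums loadings against a column of W, which by symmetry is a row of W and so has bounded ℓ¹
norm. -/
lemma abs_xi_le {c₁ M : ℝ} {n : ℕ} (hL : ∀ j, rowNorm (D.Lam n) j ≤ c₁)
    (hM : ∀ i, ∑ j, |(D.Sigu μ n)⁻¹ i j| ≤ M) (hc₁ : 0 ≤ c₁) (i : Fin (D.N n)) (k : Fin D.r) :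
    |D.xi μ n i k| ≤ c₁ * M := by
  have hW : ∀ v, (D.Sigu μ n)⁻¹ v i = (D.Sigu μ n)⁻¹ i v := fun v => by
    have := transpose_nonsing_inv (D.Sigu μ n)
    rw [sigu_transpose] at this
    rw [← transpose_apply (D.Sigu μ n)⁻¹, this]
  rw [xi, Matrix.mul_apply]
  refine (Finset.abs_sum_le_sum_abs _ _).trans ?_
  calc ∑ v, |(D.Lam n)ᵀ k v * (D.Sigu μ n)⁻¹ v i| ≤ ∑ v, c₁ * |(D.Sigu μ n)⁻¹ i v| := by
        refine Finset.sum_le_sum fun v _ => ?_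
        rw [abs_mul, hW, transpose_apply]
        gcongr
        exact (abs_apply_le_rowNorm _ _ _).trans (hL v)
    _ ≤ c₁ * M := by
        rw [← Finset.mul_sum]
        gcongr
        exact hM i

lemma card_le_of_card_offDiag {N : ℕ} (S : Finset (Fin N × Fin N)) {M : ℝ} (hN : 0 < N)
    (h : ((S.filter fun p => p.1 ≠ p.2).card : ℝ) / N ≤ M) : (S.card : ℝ) ≤ (1 + M) * N := by
  have hN0 : (0 : ℝ) < N := Nat.cast_pos.2 hN
  rw [div_le_iff₀ hN0] at h
  have h1 : (S.filter fun p => p.1 = p.2).card ≤ N := by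
    refine (Finset.card_le_card_of_injOn Prod.fst (t := Finset.univ) (fun _ _ => Finset.mem_univ _)
      ?_).trans (by simp)
    rintro ⟨a, b⟩ hp ⟨a', b'⟩ hp' heq
    simp only [Finset.coe_filter, Set.mem_ofPred_eq] at hp hp' heq
    obtain ⟨_, rfl⟩ := hp
    obtain ⟨_, rfl⟩ := hp'
    rw [heq]
  have h2 := Finset.card_filter_add_card_filter_not (s := S) fun p => p.1 = p.2
  have h3 : (S.card : ℝ) = (S.filter fun p => p.1 = p.2).card +
      (S.filter fun p => p.1 ≠ p.2).card := by exact_mod_cast h2.symm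
  have h4 : ((S.filter fun p => p.1 = p.2).card : ℝ) ≤ N := by exact_mod_cast h1
  linarith

end FactorModel

/-! ### Negligibility of the small and the large entries -/

namespace FactorModel

open scoped Matrix.Norms.L2Operator

variable {Ω : Type*} [MeasurableSpace Ω] {μ : Measure Ω} {D : FactorModel Ω}
  [IsProbabilityMeasure μ] {κ c p b ρ : ℝ}

lemma smallPart_nonneg (D : FactorModel Ω) (μ : Measure Ω)
    (SU : (n : ℕ) → Finset (Fin (D.N n) × Fin (D.N n))) (t : ℤ) (n : ℕ) (ω : Ω) :
    0 ≤ D.smallPart μ SU t n ω := by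
  unfold smallPart; positivity

lemma largePart_nonneg (D : FactorModel Ω) (μ : Measure Ω) (q : ℝ)
    (SU : (n : ℕ) → Finset (Fin (D.N n) × Fin (D.N n))) (t : ℤ) (n : ℕ) (ω : Ω) :
    0 ≤ D.largePart μ q SU t n ω := by
  refine mul_nonneg (by positivity) (Finset.sum_nonneg fun p _ => mul_nonneg ?_ (abs_nonneg _))
  exact (sq_nonneg _).trans (D.sq_omegaT_le_entryBound μ q n p.1 p.2 ω)

lemma tendsto_one_div_sqrt (hN : Tendsto D.N atTop atTop) :
    Tendsto (fun n => 1 / √(D.N n : ℝ)) atTop (𝓝 0) := by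
  simp only [one_div]
  exact tendsto_inv_atTop_zero.comp
    (Real.tendsto_sqrt_atTop.comp (tendsto_natCast_atTop_atTop.comp hN))

/-- The contribution of the small entries is negligible. -/
lemma ModelBounds.isLittleOP_smallPart (hM : D.ModelBounds μ κ c p b ρ) (h : D.Dynamics μ) {V : ℝ}
    (hV : ∀ n t j, ∫ ω, D.e μ n t ω j ^ 2 ∂μ ≤ V) (hV0 : 0 ≤ V)
    {SU : (n : ℕ) → Finset (Fin (D.N n) × Fin (D.N n))}
    (hSL : IsBoundedSeq fun n => ∑ p ∈ (SU n)ᶜ, |D.Sigu μ n p.1 p.2|) (t : ℤ) :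
    IsLittleOP μ (D.smallPart μ SU t) fun _ => 1 := by
  obtain ⟨M, hSL⟩ := hSL
  refine isLittleOP_of_integral (D.smallPart_nonneg μ SU t) (v := fun n =>
    M * (1 + V) * (1 / √(D.N n : ℝ))) ?_ ?_ ?_
  · filter_upwards [hSL] with n hn
    exact (hM.integral_smallPart_le h (hV n) hV0 hn t).1
  · filter_upwards [hSL] with n hn
    exact (hM.integral_smallPart_le h (hV n) hV0 hn t).2
  · simpa using (tendsto_one_div_sqrt h.tendsto_N).const_mul (M * (1 + V))

/-- The contribution of the estimation errors of the large entries is negligible. -/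
lemma ModelBounds.isLittleOP_largePart (hM : D.ModelBounds μ κ c p b ρ) (h : D.Dynamics μ)
    {V K q : ℝ} (hV : ∀ n t j, ∫ ω, D.e μ n t ω j ^ 2 ∂μ ≤ V) (hV0 : 0 ≤ V) (hK : 0 ≤ K)
    (hcross : ∀ n, D.N n ≠ 0 → D.T n ≠ 0 → ∀ i a, MemLp (D.crossAvg μ n i a) 2 μ ∧
      ∫ ω, D.crossAvg μ n i a ω ^ 2 ∂μ ≤ K / (√(D.N n) * D.T n))
    (hg : GrowthRates D.N D.T (D.mN μ q) q D.omegaT)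
    {SU : (n : ℕ) → Finset (Fin (D.N n) × Fin (D.N n))}
    (hSU : IsBoundedSeq fun n => (((SU n).filter fun p => p.1 ≠ p.2).card : ℝ) / D.N n) (t : ℤ) :
    IsLittleOP μ (D.largePart μ q SU t) fun _ => 1 := by
  obtain ⟨M, hSU⟩ := hSU
  have hN' : Tendsto (fun n => (D.N n : ℝ)) atTop atTop :=
    tendsto_natCast_atTop_atTop.comp h.tendsto_N
  have hev : ∀ᶠ n in atTop, Integrable (D.largePart μ q SU t n) μ ∧
      ∫ ω, D.largePart μ q SU t n ω ∂μ ≤ (1 + M) *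
        ((1 + V) * (√(D.N n : ℝ) * D.omegaT n ^ 2) + (1 + V) * (D.mN μ q n / √(D.N n : ℝ)) +
        3 * D.r * (K + V) * √(√(D.N n : ℝ) / D.T n)) := by
    filter_upwards [hSU, h.tendsto_N.eventually_gt_atTop 0, h.tendsto_T.eventually_gt_atTop 0]
      with n h1 h2 h3
    exact hM.integral_largePart_le h h2.ne' h3.ne' (hV n) hV0 hK (hcross n h2.ne' h3.ne')
      (card_le_of_card_offDiag (SU n) h2 h1) t
  refine isLittleOP_of_integral (D.largePart_nonneg μ q SU t) (hev.mono fun n hn => hn.1)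
    (hev.mono fun n hn => hn.2) ?_
  have hroot : Tendsto (fun n => √(√(D.N n : ℝ) / D.T n)) atTop (𝓝 0) := by
    have h1 : Tendsto (fun n => √(D.N n : ℝ) / D.T n) atTop (𝓝 0) := by
      refine tendsto_of_tendsto_of_tendsto_of_le_of_le' tendsto_const_nhds hg.growth
        (Eventually.of_forall fun n => by positivity) ?_
      filter_upwards [(Real.tendsto_log_atTop.comp hN').eventually_ge_atTop 1] with n hn
      gcongr
      exact le_mul_of_one_le_right (by positivity) hn
    simpa using h1.sqrt
  have h1 := (((hg.sqrt_mul_sq.const_mul (1 + V)).add (hg.m_div.const_mul (1 + V))).add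
    (hroot.const_mul (3 * D.r * (K + V)))).const_mul (1 + M)
  simpa using h1

end FactorModel

/-! ### Assembly of the proposition -/

open scoped Matrix.Norms.L2Operator in
lemma opNorm_eq_l2_opNorm {k : ℕ} (A : Matrix (Fin k) (Fin k) ℝ) : opNorm A = ‖A‖ := rfl

theorem proposition4p1 {Ω : Type*} [MeasurableSpace Ω] (μ : Measure Ω) [IsProbabilityMeasure μ]
    (D : FactorModel Ω) (q : ℝ) (SU : (n : ℕ) → Finset (Fin (D.N n) × Fin (D.N n)))
    (hdyn : D.Dynamics μ)
    (hperv : D.Pervasive)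
    (hrow : D.BoundedRowSums fun n => (D.Sigu μ n)⁻¹)
    (hmom : D.WeightMoments μ fun n => (D.Sigu μ n)⁻¹)
    (hlim : D.WeightLimits μ fun n => (D.Sigu μ n)⁻¹)
    (hsparse : D.ConditionalSparsity μ q SU)
    (havg : D.WeightedAverages μ SU)
    (hrate : Tendsto (fun n => √(D.N n : ℝ) * D.mN μ q n ^ 2 * D.omegaT n ^ (2 - 2 * q))
      atTop (𝓝 0)) :
    ∃ C₀ : ℝ, 0 < C₀ ∧ ∀ C : ℝ, C₀ ≤ C → ∀ Sig : (n : ℕ) → Ω → Matrix (Fin (D.N n)) (Fin (D.N n)) ℝ,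
      D.IsThresholdEstimator C Sig →
      -- the weighted error is negligible
      (∀ t : ℤ, 1 ≤ t → IsLittleOP μ
        (D.weightedError (fun n => (D.Sigu μ n)⁻¹) (fun n ω => (Sig n ω)⁻¹) t) (fun _ => 1)) ∧
      -- the absolute error
      IsLittleOP μ (fun n ω => opNorm ((Sig n ω)⁻¹ - (D.Sigu μ n)⁻¹)) (fun n =>
        min ((D.N n : ℝ) ^ (-(1 / 4) : ℝ)) √((D.T n : ℝ) / (D.N n * Real.log (D.N n)))) ∧
      -- the estimated weight matrix is good enough for weighted principal components
      (((fun n => (D.T n : ℝ)) =O[atTop] (fun n => (D.N n : ℝ)) ∨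
        (fun n => D.mN μ q n * D.omegaT n ^ (1 - q)) =o[atTop] (fun n =>
          min ((D.T n : ℝ) ^ (-(1 / 4) : ℝ)) √((D.N n : ℝ) / D.T n))) →
        D.WeightConsistent μ (fun n => (D.Sigu μ n)⁻¹) (fun n ω => (Sig n ω)⁻¹)) := by
  open scoped Matrix.Norms.L2Operator in
  obtain ⟨κ, c, p, b, ρ, hM⟩ := FactorModel.exists_modelBounds hdyn
  obtain ⟨c₁, c₂, hc₂, hcc, hSl, hSu, hL, hf⟩ := hdyn.exists_spectral_bounds
  obtain ⟨M, hrow⟩ := hrow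
  have hc₁ : 0 < c₁ := hc₂.trans_le hcc
  have hq := hsparse.q_nonneg
  have hq1 : q ≤ 1 := by linarith [hsparse.q_lt]
  have hN := hdyn.tendsto_N
  have hT := hdyn.tendsto_T
  have hN' : Tendsto (fun n => (D.N n : ℝ)) atTop atTop := tendsto_natCast_atTop_atTop.comp hN
  have hSn : ∀ n, ‖D.Sigu μ n‖ ≤ c₁ := fun n =>
    l2_opNorm_le_of_quadForm (D.sigu_transpose μ n) hc₁.le
      (fun x => le_trans (by positivity) (hSl n x)) (hSu n)
  have hinv := fun n => inv_bound_of_quadForm hc₂ (hSl n)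
  set η := 1 / c₂ with hη
  have hη0 : 0 < η := by positivity
  have hdiag : ∀ n i, c₂ ≤ D.Sigu μ n i i ∧ D.Sigu μ n i i ≤ c₁ := fun n i => by
    have h1 := hSl n (Pi.single i 1)
    have h2 := hSu n (Pi.single i 1)
    rw [FactorModel.quadForm_single, FactorModel.norm_toLp_single, mul_one] at h1 h2
    exact ⟨h1, h2⟩
  have hg : GrowthRates D.N D.T (D.mN μ q) q D.omegaT :=
    growthRates hN hT hq hsparse.q_lt (c := c₂ ^ q) (by positivity)
      ((hN.eventually_gt_atTop 0).mono fun n hn =>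
        FactorModel.le_mN_of_diag hq hc₂ (fun n i => (hdiag n i).1) hn) hsparse.rate hrate
  obtain ⟨A, hA, hgood⟩ := FactorModel.exists_tendsto_goodEvent hdyn hg.growth
  obtain ⟨P, hP, hPev⟩ := hperv.exists_norm_le hN
  obtain ⟨K₁, ε, hK₁, hε, hres⟩ :=
    hM.exists_residual_bounds hdyn hc₁ hc₂ hA hP hq1 hSn hL hf
  have hresev : ∀ᶠ n in atTop, ∀ ω ∈ D.goodEvent μ A n, ∀ R, IsPCResidual D.r (D.Sy n ω) R →
      ∀ i j, |R i j - D.sampleUU n ω i j| ≤ K₁ * D.entryBound μ q n i j ω ∧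
        |R i j - D.Sigu μ n i j| ≤ K₁ * D.omegaT n := by
    filter_upwards [hPev, hN.eventually_gt_atTop 0, hT.eventually_gt_atTop 0,
      hg.w_zero.eventually_le_const hε, hg.m_div.eventually_le_const one_pos] with n h1 h2 h3 h4 h5
    refine hres n h2.ne' h3.ne' h4 ?_ h1
    have hN0 : (0 : ℝ) < D.N n := Nat.cast_pos.2 h2
    have hs0 : 0 < √(D.N n : ℝ) := by positivity
    -- Eventually m_N ≤ √N, so m_N/N ≤ 1/√N ≤ ω.
    refine le_trans ?_ (le_add_of_nonneg_left (Real.sqrt_nonneg _) :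
      1 / √(D.N n : ℝ) ≤ D.omegaT n)
    rw [div_le_iff₀ hs0, one_mul] at h5
    rw [div_le_div_iff₀ hN0 hs0, one_mul]
    calc D.mN μ q n * √(D.N n : ℝ) ≤ √(D.N n : ℝ) * √(D.N n : ℝ) := by gcongr
      _ = D.N n := Real.mul_self_sqrt hN0.le
  obtain ⟨Ks, hsmall⟩ := hsparse.max_small
  obtain ⟨C₀, hC₀, hmain⟩ := FactorModel.exists_thresholding_bounds hc₂ hcc hK₁ hq hq1 hdiag
    hg.w_zero hN hresev hsparse.diag_mem hsmall hsparse.min_large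
  refine ⟨C₀, hC₀, fun C hC Sig hSig => ?_⟩
  obtain ⟨K, hK, hKev⟩ := hmain C hC Sig hSig
  have hmw0 : Tendsto (fun n => D.mN μ q n * D.omegaT n ^ (1 - q)) atTop (𝓝 0) := by
    refine tendsto_of_tendsto_of_tendsto_of_le_of_le' tendsto_const_nhds hg.quarter
      (Eventually.of_forall fun n => ?_) ?_
    · have := D.mN_nonneg μ q n
      have := D.omegaT_nonneg n
      positivity
    · filter_upwards [hN'.eventually_ge_atTop 1] with n hn
      have := D.mN_nonneg μ q n
      have := D.omegaT_nonneg n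
      exact le_mul_of_one_le_right (by positivity) (Real.one_le_rpow hn (by norm_num))
  -- Smallness needed to invert the perturbed matrix; it also makes the estimator invertible on the
  -- good event.
  have hsmallx : ∀ᶠ n in atTop, η * (K * (D.mN μ q n * D.omegaT n ^ (1 - q))) ≤ 1 / 2 := by
    have h1 := (hmw0.const_mul K).const_mul η
    rw [mul_zero, mul_zero] at h1
    exact h1.eventually_le_const (by norm_num)
  -- the rate of the absolute error
  have habs : ∀ᶠ n in atTop, ∀ ω ∈ D.goodEvent μ A n,
      |opNorm ((Sig n ω)⁻¹ - (D.Sigu μ n)⁻¹)| ≤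
        2 * η ^ 2 * K * (D.mN μ q n * D.omegaT n ^ (1 - q)) := by
    filter_upwards [hKev, hsmallx] with n h1 h2 ω hω
    obtain ⟨h3, -, -⟩ := h1 ω hω
    have hx0 := (norm_nonneg _).trans h3
    obtain ⟨p1, p2, -⟩ := inv_perturbation (hinv n).1 (hinv n).2.2
      ((mul_le_mul_of_nonneg_left h3 hη0.le).trans h2)
    rw [add_sub_cancel] at p1 p2
    rw [p2, opNorm_eq_l2_opNorm, abs_of_nonneg (norm_nonneg _), norm_neg]
    calc _ ≤ η * (K * (D.mN μ q n * D.omegaT n ^ (1 - q))) * (2 * η) := by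
          refine (l2_opNorm_mul _ _).trans (mul_le_mul ?_ p1 (norm_nonneg _) (by positivity))
          exact (l2_opNorm_mul _ _).trans (mul_le_mul (hinv n).2.2 h3 (norm_nonneg _) hη0.le)
      _ = _ := by ring
  have ho1 : (fun n => D.mN μ q n * D.omegaT n ^ (1 - q)) =o[atTop] fun n =>
      (D.N n : ℝ) ^ (-(1 / 4) : ℝ) := by
    refine Asymptotics.isLittleO_of_tendsto' ?_ (hg.quarter.congr' ?_)
    · filter_upwards [hN'.eventually_gt_atTop 0] with n hn h0
      exact absurd h0 (by positivity)
    · filter_upwards [hN'.eventually_gt_atTop 0] with n hn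
      rw [Real.rpow_neg hn.le, div_inv_eq_mul]
  -- The minimum is eventually N^{-1/4}, so the rate already established suffices.
  have ho2 : (fun n => D.mN μ q n * D.omegaT n ^ (1 - q)) =o[atTop] fun n =>
      min ((D.N n : ℝ) ^ (-(1 / 4) : ℝ)) √((D.T n : ℝ) / (D.N n * Real.log (D.N n))) :=
    ho1.trans_eventuallyEq (hg.quarter_le.mono fun n hn => (min_eq_left hn).symm)
  have hpart1 : ∀ t : ℤ, 1 ≤ t → IsLittleOP μ
      (D.weightedError (fun n => (D.Sigu μ n)⁻¹) (fun n ω => (Sig n ω)⁻¹) t) (fun _ => 1) := by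
    intro t ht
    set V := c₁ * η ^ 2 with hV
    have hV0 : 0 ≤ V := by positivity
    have heV : ∀ n t j, ∫ ω, D.e μ n t ω j ^ 2 ∂μ ≤ V := fun n t j =>
      hM.integral_e_sq_le hdyn hc₁.le (hSu n) (hinv n).2.2 t j
    obtain ⟨Kc, hKc, hcross⟩ := hM.exists_crossAvg_sq_le hdyn hc₁.le
      (fun n v a => (abs_apply_le_rowNorm _ _ _).trans (hL n v)) hSu
    set X := c₁ * (|M| + 1) with hX
    have hX0 : 0 < X := by positivity
    have hxi : ∀ n i k, |D.xi μ n i k| ≤ X := fun n =>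
      FactorModel.abs_xi_le (hL n) (fun i => (hrow n i).le.trans (by linarith [le_abs_self M])) hc₁.le
    have o1 := hM.isLittleOP_smallPart hdyn heV hV0 hsparse.sum_small t
    have o2 := hM.isLittleOP_largePart hdyn heV hV0 hKc hcross hg hsparse.card_offDiag t
    -- The quadratic remainder: √N (m_N ω^{1-q})² is the quantity assumed to vanish in (A7), and
    -- N^{-1/2}‖u_t‖ has bounded mean.
    have o3 : IsLittleOP μ (fun n ω => √(D.N n : ℝ) *
        (K * (D.mN μ q n * D.omegaT n ^ (1 - q))) ^ 2 *
        ((√(D.N n : ℝ))⁻¹ * euclNorm (D.u n t ω))) fun _ => 1 := by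
      refine isLittleOP_of_integral (fun n ω => ?_) (v := fun n =>
        √(D.N n : ℝ) * (K * (D.mN μ q n * D.omegaT n ^ (1 - q))) ^ 2 * (1 + c₁)) ?_ ?_ ?_
      · unfold euclNorm; positivity
      · filter_upwards [hN.eventually_gt_atTop 0] with n hn
        exact (hM.integral_norm_u_le hdyn hn.ne' (fun i => (hdiag n i).2) t).1.const_mul _
      · filter_upwards [hN.eventually_gt_atTop 0] with n hn
        rw [integral_const_mul]
        exact mul_le_mul_of_nonneg_left
          (hM.integral_norm_u_le hdyn hn.ne' (fun i => (hdiag n i).2) t).2 (by positivity)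
      · have h1 := hrate.const_mul (K ^ 2 * (1 + c₁))
        rw [mul_zero] at h1
        refine h1.congr fun n => ?_
        have e1 : D.omegaT n ^ (2 - 2 * q) = (D.omegaT n ^ (1 - q)) ^ 2 := by
          rw [← Real.rpow_natCast, ← Real.rpow_mul (D.omegaT_nonneg n)]
          congr 1; push_cast; ring
        rw [e1]; ring
    have o4 : IsLittleOP μ (fun n ω => ∑ k, (|D.diagAvg μ t k n ω| + |D.offDiagAvg μ SU t k n ω| +
        (X * D.smallPart μ SU t n ω + X * K * D.largePart μ q SU t n ω))) fun _ => 1 :=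
      IsLittleOP.sum _ fun k _ => (IsLittleOP.add
        (IsLittleOP.abs (X := D.diagAvg μ t k) (havg.diag t ht k))
        (IsLittleOP.abs (X := D.offDiagAvg μ SU t k) (havg.offDiag t ht k))).add
        ((o1.const_mul hX0).add (o2.const_mul (mul_pos hX0 hK)))
    refine IsLittleOP.of_le_on hgood
      (o4.add (o3.const_mul (show 0 < 2 * c₁ * η ^ 3 by positivity))) ?_
    filter_upwards [hKev, hsmallx, hN.eventually_gt_atTop 0, hT.eventually_gt_atTop 0]
      with n h1 h2 h3 h4 ω hω
    obtain ⟨h5, h6, h7⟩ := h1 ω hω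
    rw [abs_of_nonneg (by unfold FactorModel.weightedError euclNorm; positivity)]
    exact (hM.weightedError_le hdyn h3.ne' h4.ne' (hsparse.diag_mem n) (hxi n) h6 h7 hc₁.le (hL n)
      (hinv n).1 (hinv n).2.2 h5 h2).trans (le_abs_self _)
  refine ⟨hpart1, isLittleOP_of_bound_on hgood habs (ho2.const_mul_left _)
    (fun n => by positivity), fun h => ⟨?_, hpart1⟩⟩
  -- If T = O(N), the two extra bounds dominate N^{-1/4} up to constants; otherwise the rate is
  -- assumed.
  have ho3 : (fun n => D.mN μ q n * D.omegaT n ^ (1 - q)) =o[atTop] fun n =>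
      min ((D.T n : ℝ) ^ (-(1 / 4) : ℝ)) √((D.N n : ℝ) / D.T n) := by
    rcases h with h | h
    · exact ho1.trans_isBigO (rpow_neg_quarter_isBigO hN hT h)
    · exact h
  have ho4 := isLittleO_min ho3 ho2
  simp only [min_min_min_comm] at ho4
  exact isLittleOP_of_bound_on hgood habs (ho4.const_mul_left _) (fun n => by positivity)

end
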